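/- Let $\mathcal P^{(n)}=\{\mathbb 1,X,Y,Z\}^{\otimes n}$ be the set of $n$-qubit Pauli operators. Fix a constant $\epsilon\in(0,1)$, independent of $n$. There are a learning algorithm and a deterministic classical retrieval algorithm, depending only on $\epsilon$, such that the following holds for every $n\ge 1$ and every $n$-qubit quantum state (density matrix) $\rho$. (i) Given $n$ and copies of the unknown state $\rho$, the learning algorithm accesses $\rho$ only by two-copy Clifford measurements: it applies to $\rho\otimes\rho$ a Clifford circuit on $2n$ qubits, which it may choose adaptively, and measures all the qubits in the computational basis. It uses $\mathrm{poly}(n)$ copies of $\rho$ in total, runs in time $2^{O(n)}$ (classical steps and Clifford gates together), and outputs a classical description $D(\rho,\epsilon)$ of $\rho$ that consists of $\mathrm{poly}(n)$ bits. (ii) Given $n$, $D(\rho,\epsilon)$ and a Pauli operator $P\in\mathcal P^{(n)}$, the retrieval algorithm outputs a rational number in $\mathrm{poly}(n)$ time. (iii) With probability at least $99\%$ over the measurement outcomes, the description $D(\rho,\epsilon)$ is such that, for every $P\in\mathcal P^{(n)}$ simultaneously, the output of the retrieval algorithm is within $\epsilon$ of $\mathrm{Tr}(\rho P)$. The polynomials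 and the constant in $O(n)$ depend only on $\epsilon$. -/

import Mathlib

namespace PauliLearning

open scoped ComplexOrder

/-! ### States and Pauli operators on `m` qubits

The computational basis of `m` qubits is indexed by `Fin m → Bool`. -/

/-- Operators on `m` qubits, written in the computational basis. -/
abbrev QMat (m : ℕ) : Type := Matrix (Fin m → Bool) (Fin m → Bool) ℂ

/-- The tensor product `A 0 ⊗ A 1 ⊗ ⋯ ⊗ A (m - 1)` of one-qubit operators. -/
def tensor {m : ℕ} (A : Fin m → Matrix Bool Bool ℂ) : QMat m :=
  Matrix.of fun x y => ∏ i, A i (x i) (y i)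

/-- An `m`-qubit (mixed) quantum state. -/
structure DensityMatrix (m : ℕ) where
  mat : QMat m
  posSemidef : mat.PosSemidef
  trace_eq_one : mat.trace = 1

/-- The labels of the one-qubit Pauli operators `𝟙, X, Y, Z`. -/
inductive Pauli : Type
  | I | X | Y | Z

/-- The one-qubit Pauli operators. -/
def Pauli.mat : Pauli → Matrix Bool Bool ℂ
  | .I => 1
  | .X => Matrix.of fun a b => if a = b then 0 else 1
  | .Y => Matrix.of fun a b => if a = b then 0 else if a then Complex.I else -Complex.I
  | .Z => Matrix.of fun a b => if a = b then (if a then -1 else 1) else 0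

/-- The numerical code of a one-qubit Pauli operator, as it is handed to a program. -/
def Pauli.code : Pauli → ℕ
  | .I => 0
  | .X => 1
  | .Y => 2
  | .Z => 3

/-- The `n`-qubit Pauli operator `P 0 ⊗ ⋯ ⊗ P (n - 1)`; as `P` varies these are all the elements
of `{𝟙, X, Y, Z}^{⊗ n}`. -/
def pauliOp {n : ℕ} (P : Fin n → Pauli) : QMat n := tensor fun i => (P i).mat

/-! ### Clifford circuits -/

/-- The generators of the Clifford group on `m` qubits. -/
inductive Gate (m : ℕ) : Type
  | H (i : Fin m)
  | S (i : Fin m)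
  | CNOT (control target : Fin m) (h : control ≠ target)

/-- The Hadamard gate `(1/√2) [[1, 1], [1, -1]]`. -/
noncomputable def hadamard : Matrix Bool Bool ℂ :=
  Matrix.of fun a b => ((Real.sqrt 2)⁻¹ : ℝ) * (if a && b then -1 else 1)

/-- The phase gate `diag(1, i)`. -/
def phase : Matrix Bool Bool ℂ :=
  Matrix.of fun a b => if a = b then (if a then Complex.I else 1) else 0

/-- The action of the controlled-NOT gate on basis vectors. -/
def cnotFun {m : ℕ} (c t : Fin m) (x : Fin m → Bool) : Fin m → Bool :=
  Function.update x t (xor (x t) (x c))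

/-- The operator of a gate on the whole `m`-qubit register. -/
noncomputable def Gate.mat {m : ℕ} : Gate m → QMat m
  | .H i => tensor fun j => if j = i then hadamard else 1
  | .S i => tensor fun j => if j = i then phase else 1
  | .CNOT c t _ => Matrix.of fun x y => if x = cnotFun c t y then 1 else 0

theorem tensor_mul {m : ℕ} (A B : Fin m → Matrix Bool Bool ℂ) :
    tensor A * tensor B = tensor fun i => A i * B i := by
  ext x y
  simp only [tensor, Matrix.mul_apply, Matrix.of_apply, ← Finset.prod_mul_distrib]
  rw [Finset.prod_univ_sum, Fintype.piFinset_univ]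

theorem tensor_one {m : ℕ} : (tensor fun _ => 1 : QMat m) = 1 := by
  ext x y
  simp only [tensor, Matrix.of_apply, Matrix.one_apply]
  by_cases h : x = y
  · simp [h]
  · obtain ⟨i, hi⟩ := Function.ne_iff.mp h
    rw [if_neg h]
    exact Finset.prod_eq_zero (Finset.mem_univ i) (if_neg hi)

theorem tensor_star {m : ℕ} (A : Fin m → Matrix Bool Bool ℂ) :
    star (tensor A) = tensor fun i => star (A i) := by
  ext x y
  simp [tensor, Matrix.star_apply]

theorem hadamard_star_mul : star hadamard * hadamard = 1 := by
  have h : ((Real.sqrt 2 : ℝ) : ℂ) * ((Real.sqrt 2 : ℝ) : ℂ) = 2 := by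
    rw [← Complex.ofReal_mul, Real.mul_self_sqrt (by norm_num)]; norm_num
  have h' : ((Real.sqrt 2 : ℝ) : ℂ)⁻¹ * ((Real.sqrt 2 : ℝ) : ℂ)⁻¹ = 1 / 2 := by
    rw [← mul_inv, h]; norm_num
  ext a b
  cases a <;> cases b <;>
    simp [hadamard, Matrix.mul_apply, Matrix.star_apply, h'] <;> norm_num

theorem phase_star_mul : star phase * phase = 1 := by
  ext a b
  cases a <;> cases b <;> simp [phase, Matrix.mul_apply, Matrix.star_apply]

theorem cnotFun_cnotFun {m : ℕ} {c t : Fin m} (h : c ≠ t) (x : Fin m → Bool) :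
    cnotFun c t (cnotFun c t x) = x := by
  ext j
  by_cases hj : j = t
  · subst hj; simp [cnotFun, Function.update_of_ne h]
  · simp [cnotFun, Function.update_of_ne hj]

theorem Gate.mat_mem {m : ℕ} (g : Gate m) : g.mat ∈ Matrix.unitaryGroup (Fin m → Bool) ℂ := by
  rw [Matrix.mem_unitaryGroup_iff']
  cases g with
  | H i =>
    rw [Gate.mat, tensor_star, tensor_mul, ← tensor_one]
    congr 1; funext j
    by_cases hj : j = i <;> simp [hj, hadamard_star_mul]
  | S i =>
    rw [Gate.mat, tensor_star, tensor_mul, ← tensor_one]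
    congr 1; funext j
    by_cases hj : j = i <;> simp [hj, phase_star_mul]
  | CNOT c t h =>
    ext x y
    have hinj : cnotFun c t x = cnotFun c t y ↔ x = y :=
      ⟨fun e => by rw [← cnotFun_cnotFun h x, e, cnotFun_cnotFun h y], fun e => by rw [e]⟩
    simp [Gate.mat, Matrix.mul_apply, Matrix.star_apply, Matrix.one_apply, hinj, eq_comm]

/-- The Clifford unitary of a circuit; the gates are applied in the order of the list. -/
noncomputable def circuitUnitary {m : ℕ} : List (Gate m) → Matrix.unitaryGroup (Fin m → Bool) ℂ
  | [] => 1
  | g :: gs => circuitUnitary gs * ⟨g.mat, g.mat_mem⟩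

/-! ### Two-copy Clifford measurements -/

/-- The matrix of `ρ ⊗ ρ` on `n + n` qubits; the first `n` qubits carry the first copy. -/
def twoCopiesMat {n : ℕ} (ρ : QMat n) : QMat (n + n) :=
  Matrix.of fun x y =>
    ρ (fun i => x (Fin.castAdd n i)) (fun i => y (Fin.castAdd n i)) *
      ρ (fun i => x (Fin.natAdd n i)) (fun i => y (Fin.natAdd n i))

/-- The state `ρ ⊗ ρ`. -/
def DensityMatrix.twoCopies {n : ℕ} (ρ : DensityMatrix n) : DensityMatrix (n + n) where
  mat := twoCopiesMat ρ.mat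
  posSemidef := by
    have h := (ρ.posSemidef.kronecker ρ.posSemidef).submatrix
      (fun x : Fin (n + n) → Bool =>
        ((fun i => x (Fin.castAdd n i), fun i => x (Fin.natAdd n i)) :
          (Fin n → Bool) × (Fin n → Bool)))
    exact h
  trace_eq_one := by
    have h := ρ.trace_eq_one
    simp only [Matrix.trace, Matrix.diag_apply] at h
    simp only [Matrix.trace, Matrix.diag_apply, twoCopiesMat, Matrix.of_apply]
    rw [← Equiv.sum_comp (Fin.appendEquiv n n), Fintype.sum_prod_type]
    simp only [Fin.appendEquiv, Equiv.coe_fn_mk, Fin.append_left, Fin.append_right,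
      ← Finset.mul_sum, h, mul_one]

theorem conj_posSemidef {m : ℕ} (σ : DensityMatrix m)
    (U : Matrix.unitaryGroup (Fin m → Bool) ℂ) :
    ((U : QMat m) * σ.mat * star (U : QMat m)).PosSemidef :=
  σ.posSemidef.mul_mul_conjTranspose_same (U : QMat m)

theorem born_sum {m : ℕ} (σ : DensityMatrix m) (U : Matrix.unitaryGroup (Fin m → Bool) ℂ) :
    ∑ z, ENNReal.ofReal (((U : QMat m) * σ.mat * star (U : QMat m)) z z).re = 1 := by
  have hpos := conj_posSemidef σ U
  rw [← ENNReal.ofReal_sum_of_nonneg fun z _ => (Complex.le_def.mp (hpos.diag_nonneg (i := z))).1]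
  have htr : ((U : QMat m) * σ.mat * star (U : QMat m)).trace = 1 := by
    rw [Matrix.trace_mul_comm, ← Matrix.mul_assoc, Matrix.UnitaryGroup.star_mul_self,
      Matrix.one_mul, σ.trace_eq_one]
  rw [← Complex.re_sum]
  have : (∑ z, ((U : QMat m) * σ.mat * star (U : QMat m)) z z) = 1 := htr
  rw [this]; simp

/-- Born's rule: apply the unitary `U` to the state `σ`, then measure all the qubits in the
computational basis. The outcome `z` has probability `⟨z| U σ U† |z⟩`. -/
noncomputable def born {m : ℕ} (σ : DensityMatrix m)
    (U : Matrix.unitaryGroup (Fin m → Bool) ℂ) : PMF (Fin m → Bool) :=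
  PMF.ofFintype (fun z => ENNReal.ofReal (((U : QMat m) * σ.mat * star (U : QMat m)) z z).re)
    (born_sum σ U)

/-! ### Programs

Programs run on a random access machine whose memory cells hold natural numbers. The arithmetic
instructions are addition, truncated subtraction and halving, so that one step at most doubles
the largest number in memory and the number of steps is polynomially related to the running time
on a Turing machine. Control is structured. `Q` is a type of additional instructions; a purely
classical program is a `Prog Empty`. -/

/-- Programs. Below, `M` is the memory. -/
inductive Prog (Q : Type) : Type
  /-- `M[x] := c` -/
  | const (x c : ℕ)
  /-- `M[x] :=` the input entry with index `M[y]` -/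
  | input (x y : ℕ)
  /-- `M[x] := M[y] + M[z]` -/
  | add (x y z : ℕ)
  /-- `M[x] := M[y] - M[z]`, truncated at zero -/
  | sub (x y z : ℕ)
  /-- `M[x] := ⌊M[y] / 2⌋` -/
  | half (x y : ℕ)
  /-- `M[x] := M[M[y]]` -/
  | load (x y : ℕ)
  /-- `M[M[x]] := M[y]` -/
  | store (x y : ℕ)
  /-- an additional instruction -/
  | ext (q : Q)
  /-- first `p`, then `q` -/
  | seq (p q : Prog Q)
  /-- if `M[x] ≠ 0` then `p` else `q` -/
  | ite (x : ℕ) (p q : Prog Q)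
  /-- while `M[x] ≠ 0` do `p` -/
  | loop (x : ℕ) (p : Prog Q)

/-- A configuration of the machine: the programs that remain to be executed, in this order, and
the memory. -/
structure Config (Q : Type) where
  todo : List (Prog Q)
  mem : ℕ → ℕ

/-- The machine has halted when nothing remains to be executed. -/
def Config.Halted {Q : Type} (c : Config Q) : Prop := c.todo = []

/-- One step of the machine on the input list `inp`; entries beyond its end read as `0`. A halted
machine does not move. The effect of an additional instruction is described elsewhere. -/
def Config.step {Q : Type} (inp : List ℕ) : Config Q → Config Q
  | ⟨[], M⟩ => ⟨[], M⟩
  | ⟨.const x c :: K, M⟩ => ⟨K, Function.update M x c⟩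
  | ⟨.input x y :: K, M⟩ => ⟨K, Function.update M x (inp.getD (M y) 0)⟩
  | ⟨.add x y z :: K, M⟩ => ⟨K, Function.update M x (M y + M z)⟩
  | ⟨.sub x y z :: K, M⟩ => ⟨K, Function.update M x (M y - M z)⟩
  | ⟨.half x y :: K, M⟩ => ⟨K, Function.update M x (M y / 2)⟩
  | ⟨.load x y :: K, M⟩ => ⟨K, Function.update M x (M (M y))⟩
  | ⟨.store x y :: K, M⟩ => ⟨K, Function.update M (M x) (M y)⟩
  | ⟨.ext _ :: K, M⟩ => ⟨K, M⟩
  | ⟨.seq p q :: K, M⟩ => ⟨p :: q :: K, M⟩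
  | ⟨.ite x p q :: K, M⟩ => ⟨(if M x ≠ 0 then p else q) :: K, M⟩
  | ⟨.loop x p :: K, M⟩ => ⟨if M x ≠ 0 then p :: .loop x p :: K else K, M⟩

/-- The configuration of a classical program after `t` steps, started on the input `inp` with
empty memory. -/
def Prog.run (p : Prog Empty) (inp : List ℕ) (t : ℕ) : Config Empty :=
  (Config.step inp)^[t] ⟨[p], fun _ => 0⟩

/-! ### Learning programs -/

/-- The additional instructions of a learning program. The gate instructions act on the quantum
register that holds `ρ ⊗ ρ`, one gate per step; its qubits have the numbers `0, …, 2 n - 1`. -/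
inductive LearnerInstr : Type
  /-- apply a Hadamard gate to the qubit with number `M[x]` -/
  | gateH (x : ℕ)
  /-- apply a phase gate to the qubit with number `M[x]` -/
  | gateS (x : ℕ)
  /-- apply a CNOT gate with control `M[x]` and target `M[y]` -/
  | gateCNOT (x y : ℕ)
  /-- measure the quantum register in the computational basis and refill it with two fresh
  copies of the state -/
  | measure
  /-- `M[x] :=` the bit with number `M[y]` of the most recent measurement outcome -/
  | readout (x y : ℕ)
  /-- append a bit to the output: `1` if `M[x] ≠ 0`, else `0` -/
  | emit (x : ℕ)

/-- A configuration of a learning program on `n`-qubit states. -/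
structure LConfig (n : ℕ) where
  /-- control and classical memory -/
  core : Config LearnerInstr
  /-- the gates applied so far to the current content `ρ ⊗ ρ` of the quantum register -/
  circuit : List (Gate (n + n))
  /-- the outcome of the most recent measurement -/
  outcome : Fin (n + n) → Bool
  /-- the number of copies of the state measured so far -/
  copies : ℕ
  /-- the output so far -/
  out : List Bool

/-- The learning program has halted. -/
def LConfig.Halted {n : ℕ} (c : LConfig n) : Prop := c.core.Halted

/-- The gate list `H_i`; empty if there is no qubit with number `i`. -/
def gateH? (m i : ℕ) : List (Gate m) :=
  if h : i < m then [.H ⟨i, h⟩] else []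

/-- The gate list `S_i`; empty if there is no qubit with number `i`. -/
def gateS? (m i : ℕ) : List (Gate m) :=
  if h : i < m then [.S ⟨i, h⟩] else []

/-- The gate list `CNOT_{i j}`; empty unless `i` and `j` are the numbers of distinct qubits. -/
def gateCNOT? (m i j : ℕ) : List (Gate m) :=
  if h : i < m ∧ j < m ∧ i ≠ j then
    [.CNOT ⟨i, h.1⟩ ⟨j, h.2.1⟩ fun e => h.2.2 (Fin.mk.inj e)]
  else []

/-- The bit with number `i` of `z`, as a number; `0` if there is no such bit. -/
def bitAt {m : ℕ} (z : Fin m → Bool) (i : ℕ) : ℕ :=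
  if h : i < m then (z ⟨i, h⟩).toNat else 0

/-- One step of a learning program on copies of the state `ρ`. Only measurements are random, and
the state enters only through their outcome distribution. -/
noncomputable def LConfig.step {n : ℕ} (ρ : DensityMatrix n) (inp : List ℕ) (c : LConfig n) :
    PMF (LConfig n) :=
  let M := c.core.mem
  match c.core.todo with
  | .ext (.gateH x) :: K =>
    PMF.pure { c with core := ⟨K, M⟩, circuit := c.circuit ++ gateH? (n + n) (M x) }
  | .ext (.gateS x) :: K =>
    PMF.pure { c with core := ⟨K, M⟩, circuit := c.circuit ++ gateS? (n + n) (M x) }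
  | .ext (.gateCNOT x y) :: K =>
    PMF.pure { c with core := ⟨K, M⟩, circuit := c.circuit ++ gateCNOT? (n + n) (M x) (M y) }
  | .ext .measure :: K =>
    (born ρ.twoCopies (circuitUnitary c.circuit)).map fun z =>
      { c with core := ⟨K, M⟩, circuit := [], outcome := z, copies := c.copies + 2 }
  | .ext (.readout x y) :: K =>
    PMF.pure { c with core := ⟨K, Function.update M x (bitAt c.outcome (M y))⟩ }
  | .ext (.emit x) :: K =>
    PMF.pure { c with core := ⟨K, M⟩, out := c.out ++ [decide (M x ≠ 0)] }
  | _ => PMF.pure { c with core := c.core.step inp }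

/-- The random configuration of a learning program after `t` steps on copies of the `n`-qubit
state `ρ`. The only input is the number `n`. -/
noncomputable def Prog.learn (p : Prog LearnerInstr) {n : ℕ} (ρ : DensityMatrix n) :
    ℕ → PMF (LConfig n)
  | 0 => PMF.pure ⟨⟨[p], fun _ => 0⟩, [], fun _ => false, 0, []⟩
  | t + 1 => (Prog.learn p ρ t).bind (LConfig.step ρ [n])

/-! ### Retrieval -/

/-- The input of a retrieval program: the number `n` of qubits, the length of the description
`D`, the codes of the `n` tensor factors of the Pauli operator `P`, and the bits of `D`. -/
def retrievalInput {n : ℕ} (P : Fin n → Pauli) (D : List Bool) : List ℕ :=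
  n :: D.length :: ((List.ofFn fun i => (P i).code) ++ D.map Bool.toNat)

/-- The final memory `M` holds the rational number `(M[0] - M[1]) / M[2]`, which is required to
be an `ε`-approximation to the number `v`. -/
def Config.Approximates {Q : Type} (c : Config Q) (ε : ℝ) (v : ℂ) : Prop :=
  c.mem 2 ≠ 0 ∧ ‖((c.mem 0 : ℂ) - (c.mem 1 : ℂ)) / (c.mem 2 : ℂ) - v‖ ≤ ε

end PauliLearning

open PauliLearning
open scoped ENNReal

/-! Anticommuting observables cannot be measured together, but all the operators P⊗P commute. A Bell
measurement of ρ⊗ρ diagonalizes them simultaneously (`conjList_bellOps`), and the mean of P⊗P is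
Tr(ρP)² (`bell_trace`). So O(n) Bell measurements estimate all 4^n squares at once. Let 1/r ≤ ε and
K = 4r². A threshold on the estimates selects a set T that contains every P with |Tr(ρP)| > ε and
only P with Tr(ρP)² ≥ 1/K. Outside T the answer 0 is good enough.

The squared expectation values of pairwise anticommuting Pauli operators sum to at most 1
(`sum_sq_le_one`), so T has no anticommuting subset with more than K elements. Hence T is covered by
(2n+1)^K commuting families (`exists_marks`). Given q₀ in T, choose an operator of the current set
that anticommutes with another member, keep only what relates to it as q₀ does, and repeat. A
dimension count (`triangular_le`) shows that after at most 2n steps a commuting set around q₀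
remains. The operators chosen at the steps where they anticommute with q₀ anticommute pairwise, so
there are at most K such steps; and their positions alone determine the family, so all families can
be enumerated without knowing q₀.

A commuting family is diagonalized by a Clifford circuit of at most 2n rounds, each determined by
one Pauli operator (`roundOps_self`, `roundOps_diag`, `BasisInv.push`). The learner measures each
circuit O(n) times on the first copy, and writes down the circuit and the outcomes. Retrieval
conjugates P by each circuit and averages the signs for one that makes P diagonal; if there is none,
then P was not in T and the answer is 0.

The circuits depend on earlier outcomes, so concentration comes from an exponential supermartingale
(`potentialTerm_step`, `learn_bad_le`). The union bound runs over all pairs of a block of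
measurements and a Pauli operator; a pair counts as exact if the circuit does not diagonalize the
operator. To separate probability from computation, programs are run deterministically on a tape of
outcomes (`exists_tape`, `learn_le_potential`).

Both programs are written in a loop language whose loop bounds are parameters fixed at the start,
and are compiled to the machine (`Stmt.comp_correct`). Running times are then read off the syntax;
the only exponential parameter, 4^n, is confined to the learner. -/

namespace PauliLearning

/-! ### A language with bounded loops and its compilation to programs -/

/-- `iter f k s = f (k - 1) (… (f 0 s))`. -/
def iter {σ : Type} (f : ℕ → σ → σ) : ℕ → σ → σ
  | 0, s => s
  | k + 1, s => f k (iter f k s)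

theorem iter_inv {σ : Type} {f : ℕ → σ → σ} (I : ℕ → σ → Prop) {s : σ} {N : ℕ} (h0 : I 0 s)
    (hs : ∀ i, i < N → ∀ s, I i s → I (i + 1) (f i s)) : I N (iter f N s) := by
  induction N with
  | zero => exact h0
  | succ k ih => exact hs k (Nat.lt_succ_self k) _ (ih fun i hi => hs i (hi.trans (Nat.lt_succ_self k)))

/-- Stores of the loop language: read-only parameters, variables, arrays and a device state. -/
structure Store (X : Type) where
  p : ℕ → ℕ
  v : ℕ → ℕ
  a : ℕ → ℕ → ℕ
  x : X

def Store.setv {X : Type} (s : Store X) (x c : ℕ) : Store X :=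
  { s with v := Function.update s.v x c }

def Store.seta {X : Type} (s : Store X) (a i c : ℕ) : Store X :=
  { s with a := Function.update s.a a (Function.update (s.a a) i c) }

def Store.setp {X : Type} (s : Store X) (k c : ℕ) : Store X :=
  { s with p := Function.update s.p k c }

/-- The meaning of additional instructions: an optional write to the memory and a new device
state. The operands of an instruction can be relabelled, and the address of the write is fixed. -/
structure Device (Q X : Type) where
  act : Q → (ℕ → ℕ) → X → Option (ℕ × ℕ) × X
  relabel : (ℕ → ℕ) → Q → Q
  act_relabel : ∀ f q M x, act (relabel f q) M x =
    ((act q (M ∘ f) x).1.map (fun w => (f w.1, w.2)), (act q (M ∘ f) x).2)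
  target : Q → Option ℕ
  act_target : ∀ q M x, (act q M x).1.map Prod.fst = target q

/-- The effect of an optional write. -/
def applyWrite : Option (ℕ × ℕ) → (ℕ → ℕ) → ℕ → ℕ
  | none, M => M
  | some w, M => Function.update M w.1 w.2

/-- Statements of the loop language. -/
inductive Stmt (Q : Type) : Type
  | set (x c : ℕ)
  | mov (x y : ℕ)
  | add (x y z : ℕ)
  | sub (x y z : ℕ)
  | half (x y : ℕ)
  | inp (x y : ℕ)
  | par (x k : ℕ)
  | rd (x a y : ℕ)
  | wr (a x y : ℕ)
  | ext (q : Q)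
  | seq (p q : Stmt Q)
  | ite (x : ℕ) (p q : Stmt Q)
  | loop (x k : ℕ) (p : Stmt Q)

infixr:60 " ;; " => Stmt.seq

variable {Q X : Type}

/-- The effect of a statement. `loop x k p` runs `p` with `x = 0, …, p k - 1`. -/
def Stmt.eval (D : Device Q X) (inp : List ℕ) : Stmt Q → Store X → Store X
  | .set x c, s => s.setv x c
  | .mov x y, s => s.setv x (s.v y)
  | .add x y z, s => s.setv x (s.v y + s.v z)
  | .sub x y z, s => s.setv x (s.v y - s.v z)
  | .half x y, s => s.setv x (s.v y / 2)
  | .inp x y, s => s.setv x (inp.getD (s.v y) 0)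
  | .par x k, s => s.setv x (s.p k)
  | .rd x a y, s => s.setv x (s.a a (s.v y))
  | .wr a x y, s => s.seta a (s.v x) (s.v y)
  | .ext q, s => { s with v := applyWrite (D.act q s.v s.x).1 s.v, x := (D.act q s.v s.x).2 }
  | .seq p q, s => q.eval D inp (p.eval D inp s)
  | .ite x p q, s => if s.v x ≠ 0 then p.eval D inp s else q.eval D inp s
  | .loop x k p, s => iter (fun i s => p.eval D inp (s.setv x i)) (s.p k) s

/-- A bound on the number of machine steps, in terms of the parameters. -/
def Stmt.cost : Stmt Q → (ℕ → ℕ) → ℕ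
  | .seq p q, e => 1 + p.cost e + q.cost e
  | .ite _ p q, e => 1 + p.cost e + q.cost e
  | .loop _ k p, e => 10 + e k * (15 + p.cost e)
  | _, _ => 20

/-- All array numbers are at most `12`. -/
def Stmt.arrOK : Stmt Q → Bool
  | .rd _ a _ => decide (a < 13)
  | .wr a _ _ => decide (a < 13)
  | .seq p q => p.arrOK && q.arrOK
  | .ite _ p q => p.arrOK && q.arrOK
  | .loop _ _ p => p.arrOK
  | _ => true

/-- The program that computes the address of entry `M[16 y]` of array `a` in cell `1`. -/
def idxProg (a y : ℕ) : Prog Q :=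
  .seq (.add 1 (16 * y) (16 * y)) <| .seq (.add 1 1 1) <| .seq (.add 1 1 1) <|
    .seq (.add 1 1 1) <| .seq (.const 17 (3 + a)) (.add 1 1 17)

/-- Compilation at loop depth `h`. Variable `i` lives at address `16 i`, parameter `i` at
`2 + 16 i`, entry `i` of array `a` at `3 + a + 16 i`; the other addresses are auxiliary. -/
def Stmt.comp (R : (ℕ → ℕ) → Q → Q) : ℕ → Stmt Q → Prog Q
  | _, .set x c => .const (16 * x) c
  | _, .mov x y => .seq (.const 1 0) (.add (16 * x) (16 * y) 1)
  | _, .add x y z => .add (16 * x) (16 * y) (16 * z)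
  | _, .sub x y z => .sub (16 * x) (16 * y) (16 * z)
  | _, .half x y => .half (16 * x) (16 * y)
  | _, .inp x y => .input (16 * x) (16 * y)
  | _, .par x k => .seq (.const 1 0) (.add (16 * x) (2 + 16 * k) 1)
  | _, .rd x a y => .seq (idxProg a y) (.load (16 * x) 1)
  | _, .wr a x y => .seq (idxProg a x) (.store 1 (16 * y))
  | _, .ext q => .ext (R (fun i => 16 * i) q)
  | h, .seq p q => .seq (p.comp R h) (q.comp R h)
  | h, .ite x p q => .ite (16 * x) (p.comp R h) (q.comp R h)
  | h, .loop x k p =>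
    .seq (.const 1 0) <| .seq (.add (1 + 16 * (2 + 2 * h)) (2 + 16 * k) 1) <|
      .seq (.const (1 + 16 * (3 + 2 * h)) 0) <|
      .loop (1 + 16 * (2 + 2 * h)) <|
        .seq (.const 1 0) <| .seq (.add (16 * x) (1 + 16 * (3 + 2 * h)) 1) <|
        .seq (p.comp R (h + 1)) <| .seq (.const 17 1) <|
        .seq (.add (1 + 16 * (3 + 2 * h)) (1 + 16 * (3 + 2 * h)) 17)
          (.sub (1 + 16 * (2 + 2 * h)) (1 + 16 * (2 + 2 * h)) 17)

/-- One step of the machine with a device. -/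
def mstep (D : Device Q X) (inp : List ℕ) (c : Config Q × X) : Config Q × X :=
  match c.1.todo with
  | .ext q :: K => (⟨K, applyWrite (D.act q c.1.mem c.2).1 c.1.mem⟩, (D.act q c.1.mem c.2).2)
  | _ => (Config.step inp c.1, c.2)

/-- The program `pr` turns `(M, x)` into `(M', x')` within `T` steps. -/
def Runs (D : Device Q X) (inp : List ℕ) (pr : Prog Q) (M : ℕ → ℕ) (x : X) (M' : ℕ → ℕ) (x' : X)
    (T : ℕ) : Prop :=
  ∃ t ≤ T, ∀ K, (mstep D inp)^[t] (⟨pr :: K, M⟩, x) = (⟨K, M'⟩, x')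

/-! ### Runs of compiled programs and correctness of the compilation. -/

variable {D : Device Q X} {inp : List ℕ}

theorem Runs.mono {pr : Prog Q} {M M' x x' T T'} (h : Runs D inp pr M x M' x' T) (hT : T ≤ T') :
    Runs D inp pr M x M' x' T' := by
  obtain ⟨t, ht, h⟩ := h
  exact ⟨t, ht.trans hT, h⟩

/-- `Runs` fixes the number of steps before the continuation `K`, so a run of `p` may be used with
`q` already waiting in `K`. The extra step unfolds `.seq`. -/
theorem Runs.seq {p q : Prog Q} {M M' M'' x x' x'' T T'} (h : Runs D inp p M x M' x' T)
    (h' : Runs D inp q M' x' M'' x'' T') : Runs D inp (.seq p q) M x M'' x'' (1 + T + T') := by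
  obtain ⟨t, ht, h⟩ := h
  obtain ⟨t', ht', h'⟩ := h'
  refine ⟨t' + (t + 1), by omega, fun K => ?_⟩
  rw [Function.iterate_add_apply, Function.iterate_add_apply, Function.iterate_one]
  exact (congrArg _ (h (q :: K))).trans (h' K)

theorem runs_const (x c M y) : Runs D inp (.const x c) M y (Function.update M x c) y 1 :=
  ⟨1, le_rfl, fun _ => rfl⟩

theorem runs_add (x y z M w) :
    Runs D inp (.add x y z) M w (Function.update M x (M y + M z)) w 1 :=
  ⟨1, le_rfl, fun _ => rfl⟩

theorem runs_sub (x y z M w) :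
    Runs D inp (.sub x y z) M w (Function.update M x (M y - M z)) w 1 :=
  ⟨1, le_rfl, fun _ => rfl⟩

theorem runs_half (x y M w) : Runs D inp (.half x y) M w (Function.update M x (M y / 2)) w 1 :=
  ⟨1, le_rfl, fun _ => rfl⟩

theorem runs_input (x y M w) :
    Runs D inp (.input x y) M w (Function.update M x (inp.getD (M y) 0)) w 1 :=
  ⟨1, le_rfl, fun _ => rfl⟩

theorem runs_load (x y M w) : Runs D inp (.load x y) M w (Function.update M x (M (M y))) w 1 :=
  ⟨1, le_rfl, fun _ => rfl⟩

theorem runs_store (x y M w) : Runs D inp (.store x y) M w (Function.update M (M x) (M y)) w 1 :=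
  ⟨1, le_rfl, fun _ => rfl⟩

theorem runs_ext (q M w) :
    Runs D inp (.ext q) M w (applyWrite (D.act q M w).1 M) (D.act q M w).2 1 :=
  ⟨1, le_rfl, fun _ => rfl⟩

theorem runs_ite {c : ℕ} {p q : Prog Q} {M M' x x' T}
    (h : Runs D inp (if M c ≠ 0 then p else q) M x M' x' T) :
    Runs D inp (.ite c p q) M x M' x' (1 + T) := by
  obtain ⟨t, ht, h⟩ := h
  refine ⟨t + 1, by omega, fun K => ?_⟩
  rw [Function.iterate_add_apply, Function.iterate_one]
  exact h K

theorem runs_loop_zero {c : ℕ} {p : Prog Q} {M x} (h : M c = 0) :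
    Runs D inp (.loop c p) M x M x 1 := by
  refine ⟨1, le_rfl, fun K => ?_⟩
  simp [mstep, Config.step, h]

theorem runs_loop_succ {c : ℕ} {p : Prog Q} {M M' M'' x x' x'' T T'} (h : M c ≠ 0)
    (h1 : Runs D inp p M x M' x' T) (h2 : Runs D inp (.loop c p) M' x' M'' x'' T') :
    Runs D inp (.loop c p) M x M'' x'' (1 + T + T') := by
  obtain ⟨t, ht, h1⟩ := h1
  obtain ⟨t', ht', h2⟩ := h2
  refine ⟨t' + (t + 1), by omega, fun K => ?_⟩
  rw [Function.iterate_add_apply, Function.iterate_add_apply, Function.iterate_one]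
  have : mstep D inp (⟨.loop c p :: K, M⟩, x) = (⟨p :: .loop c p :: K, M⟩, x) := by
    simp [mstep, Config.step, h]
  rw [this, h1, h2]

/-- The memory `M` represents the store `s`. -/
structure Represents (M : ℕ → ℕ) (s : Store X) : Prop where
  v : ∀ i, M (16 * i) = s.v i
  p : ∀ i, M (2 + 16 * i) = s.p i
  a : ∀ a i, a < 13 → M (3 + a + 16 * i) = s.a a i

/-- Addresses are sorted by residue mod 16: 0 for variables, 2 for parameters, 3 to 15 for the
thirteen arrays. Residue 1 is seen by none of them and serves for scratch cells and loop counters.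
-/
theorem Represents.hidden {M : ℕ → ℕ} {s : Store X} (h : Represents M s) (i c : ℕ) :
    Represents (Function.update M (1 + 16 * i) c) s := by
  refine ⟨fun j => ?_, fun j => ?_, fun a j ha => ?_⟩
  · rw [Function.update_of_ne (by omega), h.v]
  · rw [Function.update_of_ne (by omega), h.p]
  · rw [Function.update_of_ne (by omega), h.a a j ha]

theorem Represents.setv {M : ℕ → ℕ} {s : Store X} (h : Represents M s) (x c : ℕ) :
    Represents (Function.update M (16 * x) c) (s.setv x c) := by
  refine ⟨fun j => ?_, fun j => ?_, fun a j ha => ?_⟩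
  · by_cases hj : j = x
    · subst hj; simp [Store.setv]
    · rw [Function.update_of_ne (by omega), h.v]; simp [Store.setv, hj]
  · rw [Function.update_of_ne (by omega), h.p]; rfl
  · rw [Function.update_of_ne (by omega), h.a a j ha]; rfl

theorem Represents.setp {M : ℕ → ℕ} {s : Store X} (h : Represents M s) (x c : ℕ) :
    Represents (Function.update M (2 + 16 * x) c) (s.setp x c) := by
  refine ⟨fun j => ?_, fun j => ?_, fun a j ha => ?_⟩
  · rw [Function.update_of_ne (by omega), h.v]; rfl
  · by_cases hj : j = x
    · subst hj; simp [Store.setp]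
    · rw [Function.update_of_ne (by omega), h.p]; simp [Store.setp, hj]
  · rw [Function.update_of_ne (by omega), h.a a j ha]; rfl

theorem Represents.seta {M : ℕ → ℕ} {s : Store X} (h : Represents M s) (b x c : ℕ) (hb : b < 13) :
    Represents (Function.update M (3 + b + 16 * x) c) (s.seta b x c) := by
  refine ⟨fun j => ?_, fun j => ?_, fun a j ha => ?_⟩
  · rw [Function.update_of_ne (by omega), h.v]; rfl
  · rw [Function.update_of_ne (by omega), h.p]; rfl
  · by_cases hab : a = b
    · subst hab
      by_cases hj : j = x
      · subst hj; simp [Store.seta]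
      · rw [Function.update_of_ne (by omega), h.a a j ha]; simp [Store.seta, hj]
    · rw [Function.update_of_ne (by omega), h.a a j ha]; simp [Store.seta, hab]

theorem Represents.setx {M : ℕ → ℕ} {s : Store X} (h : Represents M s) (x : X) : Represents M { s with x := x } :=
  ⟨h.v, h.p, h.a⟩

/-- The machine has no multiplication, so 16 times the index is reached by four doublings. Scratch
is limited to cells 1 and 17, which have hidden indices 0 and 1; loop counters have hidden indices
from 2 on and survive. -/
theorem runs_idx (a y : ℕ) {M : ℕ → ℕ} {s : Store X} (h : Represents M s) (w : X) :
    ∃ M', Runs D inp (idxProg a y) M w M' w 11 ∧ Represents M' s ∧ M' 1 = 3 + a + 16 * s.v y ∧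
      ∀ i, 2 ≤ i → M' (1 + 16 * i) = M (1 + 16 * i) := by
  refine ⟨_, (runs_add _ _ _ _ _).seq <| (runs_add _ _ _ _ _).seq <| (runs_add _ _ _ _ _).seq <|
    (runs_add _ _ _ _ _).seq <| (runs_const _ _ _ _).seq (runs_add _ _ _ _ _), ?_, ?_, ?_⟩
  · exact (((((h.hidden 0 _).hidden 0 _).hidden 0 _).hidden 0 _).hidden 1 _).hidden 0 _
  · simp [h.v]; omega
  · intro i hi
    simp [Function.update_apply]
    split_ifs <;> omega

/-- Loop bounds are parameters, and no statement changes these. So the number of iterations, and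
with it `Stmt.cost`, is known from the initial store. -/
theorem Stmt.eval_p (p : Stmt Q) (s : Store X) : (p.eval D inp s).p = s.p := by
  induction p generalizing s with
  | seq p q hp hq => simp [Stmt.eval, hp, hq]
  | ite x p q hp hq => simp only [Stmt.eval]; split_ifs <;> simp [hp, hq]
  | loop x k p hp =>
    exact iter_inv (fun _ (s' : Store X) => s'.p = s.p) rfl fun i _ s' h => by rw [hp]; exact h
  | _ => rfl

/-- The third conjunct makes nesting work: a loop at depth `h` keeps its countdown and its index in
the hidden cells `2 + 2 * h` and `3 + 2 * h`, which a body compiled at depth `h + 1` preserves. As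
the index is kept apart from the variable `x`, the body may overwrite `x`. -/
theorem Stmt.comp_correct (p : Stmt Q) (hp : p.arrOK) (h : ℕ) {M : ℕ → ℕ} {s : Store X}
    (hM : Represents M s) :
    ∃ M', Runs D inp (p.comp D.relabel h) M s.x M' (p.eval D inp s).x (p.cost s.p) ∧
      Represents M' (p.eval D inp s) ∧
      ∀ i, 2 ≤ i → i < 2 + 2 * h → M' (1 + 16 * i) = M (1 + 16 * i) := by
  induction p generalizing h M s with
  | set x c =>
    exact ⟨_, (runs_const _ _ _ _).mono (by simp [cost]), hM.setv x c, fun i _ _ => by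
      rw [Function.update_of_ne (by omega)]⟩
  | mov x y =>
    refine ⟨_, ((runs_const _ _ _ _).seq (runs_add _ _ _ _ _)).mono (by simp [cost]), ?_,
      fun i _ _ => ?_⟩
    · have := (hM.hidden 0 0).setv x (s.v y)
      have e := (hM.hidden 0 0).v y
      simp only [mul_zero, add_zero] at e this
      rw [e, Function.update_self, add_zero]
      exact this
    · rw [Function.update_of_ne (by omega), Function.update_of_ne (by omega)]
  | add x y z =>
    refine ⟨_, (runs_add _ _ _ _ _).mono (by simp [cost]), ?_, fun i _ _ => by
      rw [Function.update_of_ne (by omega)]⟩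
    rw [hM.v, hM.v]; exact hM.setv x _
  | sub x y z =>
    refine ⟨_, (runs_sub _ _ _ _ _).mono (by simp [cost]), ?_, fun i _ _ => by
      rw [Function.update_of_ne (by omega)]⟩
    rw [hM.v, hM.v]; exact hM.setv x _
  | half x y =>
    refine ⟨_, (runs_half _ _ _ _).mono (by simp [cost]), ?_, fun i _ _ => by
      rw [Function.update_of_ne (by omega)]⟩
    rw [hM.v]; exact hM.setv x _
  | inp x y =>
    refine ⟨_, (runs_input _ _ _ _).mono (by simp [cost]), ?_, fun i _ _ => by
      rw [Function.update_of_ne (by omega)]⟩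
    rw [hM.v]; exact hM.setv x _
  | par x k =>
    refine ⟨_, ((runs_const _ _ _ _).seq (runs_add _ _ _ _ _)).mono (by simp [cost]), ?_,
      fun i _ _ => ?_⟩
    · have := (hM.hidden 0 0).setv x (s.p k)
      have e := (hM.hidden 0 0).p k
      simp only [mul_zero, add_zero] at e this
      rw [e, Function.update_self, add_zero]
      exact this
    · rw [Function.update_of_ne (by omega), Function.update_of_ne (by omega)]
  | rd x a y =>
    obtain ⟨M', h1, h2, h3, h4⟩ := runs_idx (D := D) (inp := inp) a y hM s.x
    refine ⟨_, (h1.seq (runs_load _ _ _ _)).mono (by simp [cost]), ?_, fun i hi _ => ?_⟩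
    · rw [h3, h2.a _ _ (by simpa [arrOK] using hp)]; exact h2.setv x _
    · rw [Function.update_of_ne (by omega), h4 i hi]
  | wr a x y =>
    obtain ⟨M', h1, h2, h3, h4⟩ := runs_idx (D := D) (inp := inp) a x hM s.x
    have ha : a < 13 := by simpa [arrOK] using hp
    refine ⟨_, (h1.seq (runs_store _ _ _ _)).mono (by simp [cost]), ?_, fun i hi _ => ?_⟩
    · rw [h3, h2.v]; exact h2.seta a _ _ ha
    · rw [h3, Function.update_of_ne (by omega), h4 i hi]
  | ext q =>
    have e : M ∘ (fun i => 16 * i) = s.v := funext hM.v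
    have hr := runs_ext (D := D) (inp := inp) (D.relabel (fun i => 16 * i) q) M s.x
    rw [D.act_relabel, e] at hr
    refine ⟨_, hr.mono (by simp [cost]), ?_, ?_⟩
    · simp only [eval]
      cases (D.act q s.v s.x).1 with
      | none => exact ⟨hM.v, hM.p, hM.a⟩
      | some w => exact (hM.setv w.1 w.2).setx _
    · intro i _ _
      cases (D.act q s.v s.x).1 with
      | none => rfl
      | some w =>
        simp only [Option.map_some, applyWrite]
        rw [Function.update_of_ne (by omega)]
  | seq p q ihp ihq =>
    simp only [arrOK, Bool.and_eq_true] at hp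
    obtain ⟨M1, r1, m1, k1⟩ := ihp hp.1 h hM
    obtain ⟨M2, r2, m2, k2⟩ := ihq hp.2 h m1
    rw [eval_p] at r2
    exact ⟨M2, r1.seq r2, m2, fun i h1 h2 => (k2 i h1 h2).trans (k1 i h1 h2)⟩
  | ite x p q ihp ihq =>
    simp only [arrOK, Bool.and_eq_true] at hp
    by_cases hx : s.v x ≠ 0
    · obtain ⟨M1, r1, m1, k1⟩ := ihp hp.1 h hM
      refine ⟨M1, (runs_ite (T := p.cost s.p) ?_).mono (by simp [cost]), ?_, k1⟩
      · rw [hM.v, if_pos hx]; simp only [eval, if_pos hx]; exact r1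
      · simp only [eval, if_pos hx]; exact m1
    · obtain ⟨M1, r1, m1, k1⟩ := ihq hp.2 h hM
      refine ⟨M1, (runs_ite (T := q.cost s.p) ?_).mono (by simp [cost]), ?_, k1⟩
      · rw [hM.v, if_neg hx]; simp only [eval, if_neg hx]; exact r1
      · simp only [eval, if_neg hx]; exact m1
  | loop x k p ihp =>
    set C := 1 + 16 * (2 + 2 * h) with hC
    set I := 1 + 16 * (3 + 2 * h) with hI
    set f : ℕ → Store X → Store X := fun i s => p.eval D inp (s.setv x i) with hf
    -- Induction on the number `j` of iterations that are left, which is the content of cell `C`.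
    have key : ∀ j i, i + j = s.p k → ∀ M : ℕ → ℕ, Represents M (iter f i s) → M C = j → M I = i →
        ∃ M', Runs D inp (.loop C <|
        .seq (.const 1 0) <| .seq (.add (16 * x) I 1) <|
        .seq (p.comp D.relabel (h + 1)) <| .seq (.const 17 1) <|
        .seq (.add I I 17) (.sub C C 17)) M (iter f i s).x M'
          (iter f (s.p k) s).x (1 + j * (15 + p.cost s.p)) ∧ Represents M' (iter f (s.p k) s) ∧
          ∀ i, 2 ≤ i → i < 2 + 2 * h → M' (1 + 16 * i) = M (1 + 16 * i) := by
      intro j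
      induction j with
      | zero =>
        intro i hi M hM hc _
        obtain rfl : i = s.p k := by omega
        exact ⟨M, (runs_loop_zero hc).mono (by simp), hM, fun _ _ _ => rfl⟩
      | succ j ih =>
        intro i hi M hM hc hi'
        have hM1 := (hM.hidden 0 0).setv x i
        simp only [mul_zero, add_zero] at hM1
        obtain ⟨M2, r2, m2, k2⟩ := ihp hp (h + 1) hM1
        have hps : ((iter f i s).setv x i).p = s.p :=
          iter_inv (fun _ (s' : Store X) => s'.p = s.p) rfl
            fun i _ s' h => by simp only [hf]; rw [eval_p]; exact h
        rw [hps] at r2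
        have c2 : M2 C = j + 1 := by
          rw [hC, k2 _ (by omega) (by omega), Function.update_of_ne (by omega),
            Function.update_of_ne (by omega)]
          exact hc
        have i2 : M2 I = i := by
          rw [hI, k2 _ (by omega) (by omega), Function.update_of_ne (by omega),
            Function.update_of_ne (by omega)]
          exact hi'
        have m3 := ((m2.hidden 1 1).hidden (3 + 2 * h) (i + 1)).hidden (2 + 2 * h) j
        rw [← hI, ← hC] at m3
        obtain ⟨M', r', m', k'⟩ := ih (i + 1) (by omega) _ m3 (by simp)
          (by rw [Function.update_of_ne (by omega)]; simp)
        refine ⟨M', ?_, m', ?_⟩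
        · refine (runs_loop_succ (T := 14 + p.cost s.p) (by omega) (Runs.mono
            ((runs_const _ _ _ _).seq <| (runs_add _ _ _ _ _).seq <| Runs.seq (x' := (iter f (i + 1) s).x)
              (M' := M2) ?_ <|
              (runs_const _ _ _ _).seq <| (runs_add _ _ _ _ _).seq (runs_sub _ _ _ _ _))
              (T := 1 + 1 + (1 + 1 + (1 + p.cost s.p + (1 + 1 + (1 + 1 + 1))))) (by omega)) ?_).mono
              (T := 1 + (14 + p.cost s.p) + (1 + j * (15 + p.cost s.p)))
              (by rw [Nat.succ_mul]; omega)
          · have e : (Function.update (Function.update M 1 0) (16 * x)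
                (Function.update M 1 0 I + Function.update M 1 0 1)) =
                Function.update (Function.update M 1 0) (16 * x) i := by
              rw [Function.update_of_ne (by omega), Function.update_self, hi']
              rfl
            rw [e]
            exact r2
          · have e1 : Function.update M2 17 1 I + Function.update M2 17 1 17 = i + 1 := by
              rw [Function.update_of_ne (by omega), Function.update_self, i2]
            rw [e1, Function.update_of_ne (show C ≠ I by omega),
              Function.update_of_ne (show C ≠ 17 by omega),
              Function.update_of_ne (show 17 ≠ I by omega), Function.update_self, c2]
            exact r'
        · intro l h1 h2
          rw [k' l h1 h2, Function.update_of_ne (by omega), Function.update_of_ne (by omega),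
            Function.update_of_ne (by omega), k2 l h1 (by omega), Function.update_of_ne (by omega),
            Function.update_of_ne (by omega)]
    have m0 := ((hM.hidden 0 0).hidden (2 + 2 * h) (s.p k)).hidden (3 + 2 * h) 0
    rw [← hI, ← hC] at m0
    simp only [mul_zero, add_zero] at m0
    obtain ⟨M', r', m', k'⟩ := key (s.p k) 0 (by omega) _ m0
      (by rw [Function.update_of_ne (by omega)]; simp) (by simp)
    refine ⟨M', Runs.mono ((runs_const _ _ _ _).seq <| (runs_add _ _ _ _ _).seq <|
      (runs_const _ _ _ _).seq ?_) (T := 1 + 1 + (1 + 1 + (1 + 1 +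
        (1 + s.p k * (15 + p.cost s.p))))) (by simp only [cost]; omega), m', ?_⟩
    · have e := (hM.hidden 0 0).p k
      simp only [mul_zero, add_zero] at e
      rw [e, Function.update_self, add_zero]
      exact r'
    · intro l h1 h2
      rw [k' l h1 h2, Function.update_of_ne (by omega), Function.update_of_ne (by omega),
        Function.update_of_ne (by omega)]

end PauliLearning

/-! ### Randomness as a tape of outcomes, and potentials for adaptive processes. -/

namespace PauliLearning
open scoped ENNReal

/-! ### Learning programs on a tape of measurement outcomes -/

/-- The state of the quantum part of a learning program together with the list of all the circuits
that have been measured. -/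
structure QState (n : ℕ) where
  circuit : List (Gate (n + n))
  outcome : Fin (n + n) → Bool
  copies : ℕ
  out : List Bool
  log : List (List (Gate (n + n)))

/-- The quantum instructions, where measurement number `k` has outcome `ω k`. -/
def tapeAct {n : ℕ} (ω : ℕ → Fin (n + n) → Bool) :
    LearnerInstr → (ℕ → ℕ) → QState n → Option (ℕ × ℕ) × QState n
  | .gateH x, M, q => (none, { q with circuit := q.circuit ++ gateH? (n + n) (M x) })
  | .gateS x, M, q => (none, { q with circuit := q.circuit ++ gateS? (n + n) (M x) })
  | .gateCNOT x y, M, q => (none, { q with circuit := q.circuit ++ gateCNOT? (n + n) (M x) (M y) })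
  | .measure, _, q => (none, ⟨[], ω q.log.length, q.copies + 2, q.out, q.log ++ [q.circuit]⟩)
  | .readout x y, M, q => (some (x, bitAt q.outcome (M y)), q)
  | .emit x, M, q => (none, { q with out := q.out ++ [decide (M x ≠ 0)] })

/-- Relabelling of the operands of an instruction. -/
def LearnerInstr.relabel (f : ℕ → ℕ) : LearnerInstr → LearnerInstr
  | .gateH x => .gateH (f x)
  | .gateS x => .gateS (f x)
  | .gateCNOT x y => .gateCNOT (f x) (f y)
  | .measure => .measure
  | .readout x y => .readout (f x) (f y)
  | .emit x => .emit (f x)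

def tapeDevice {n : ℕ} (ω : ℕ → Fin (n + n) → Bool) : Device LearnerInstr (QState n) where
  act := tapeAct ω
  relabel := LearnerInstr.relabel
  act_relabel := by intro f q M x; cases q <;> rfl
  target := fun q => match q with
    | .readout x _ => some x
    | _ => none
  act_target := by intro q M x; cases q <;> rfl

/-- Forget the list of measured circuits. -/
def toLConfig {n : ℕ} (y : Config LearnerInstr × QState n) : LConfig n :=
  ⟨y.1, y.2.circuit, y.2.outcome, y.2.copies, y.2.out⟩

/-- The next instruction is a measurement. -/
def AtMeasure {n : ℕ} (y : Config LearnerInstr × QState n) : Prop :=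
  ∃ K, y.1.todo = .ext .measure :: K

section

variable {n : ℕ} {ρ : DensityMatrix n} {inp : List ℕ} {y : Config LearnerInstr × QState n}
  {ω ω' : ℕ → Fin (n + n) → Bool}

/-- Sampling an outcome amounts to writing the sample into the one tape entry that the measurement
reads; its position is the number of measurements made so far. -/
theorem step_of_atMeasure (h : AtMeasure y) :
    LConfig.step ρ inp (toLConfig y) =
      (born ρ.twoCopies (circuitUnitary y.2.circuit)).map fun z =>
        toLConfig (mstep (tapeDevice (Function.update ω y.2.log.length z)) inp y) := by
  obtain ⟨⟨todo, M⟩, q⟩ := y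
  obtain ⟨K, hK⟩ := h
  simp only at hK
  subst hK
  simp [LConfig.step, toLConfig, mstep, tapeDevice, tapeAct, applyWrite]

theorem log_of_atMeasure (h : AtMeasure y) :
    (mstep (tapeDevice ω) inp y).2.log = y.2.log ++ [y.2.circuit] := by
  obtain ⟨⟨todo, M⟩, q⟩ := y
  obtain ⟨K, hK⟩ := h
  simp only at hK
  subst hK
  rfl

theorem step_of_not_atMeasure (h : ¬AtMeasure y) :
    LConfig.step ρ inp (toLConfig y) = PMF.pure (toLConfig (mstep (tapeDevice ω) inp y)) := by
  obtain ⟨⟨todo, M⟩, q⟩ := y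
  rcases todo with - | ⟨p, K⟩
  · rfl
  · cases p with
    | ext i =>
      cases i with
      | measure => exact absurd ⟨K, rfl⟩ h
      | _ => rfl
    | _ => rfl

theorem mstep_of_not_atMeasure (h : ¬AtMeasure y) :
    mstep (tapeDevice ω) inp y = mstep (tapeDevice ω') inp y := by
  obtain ⟨⟨todo, M⟩, q⟩ := y
  rcases todo with - | ⟨p, K⟩
  · rfl
  · cases p with
    | ext i =>
      cases i with
      | measure => exact absurd ⟨K, rfl⟩ h
      | _ => rfl
    | _ => rfl

theorem log_of_not_atMeasure (h : ¬AtMeasure y) :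
    (mstep (tapeDevice ω) inp y).2.log = y.2.log := by
  obtain ⟨⟨todo, M⟩, q⟩ := y
  rcases todo with - | ⟨p, K⟩
  · rfl
  · cases p with
    | ext i =>
      cases i with
      | measure => exact absurd ⟨K, rfl⟩ h
      | _ => rfl
    | _ => rfl

theorem mstep_congr_of_outcome (h : ω y.2.log.length = ω' y.2.log.length) :
    mstep (tapeDevice ω) inp y = mstep (tapeDevice ω') inp y := by
  by_cases hy : AtMeasure y
  · obtain ⟨⟨todo, M⟩, q⟩ := y
    obtain ⟨K, hK⟩ := hy
    simp only at hK
    subst hK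
    simp only at h
    simp [mstep, tapeDevice, tapeAct, h]
  · exact mstep_of_not_atMeasure hy

/-- The configuration after `t` steps on the tape `ω`. -/
def tapeRun (p : Prog LearnerInstr) (inp : List ℕ) (ω : ℕ → Fin (n + n) → Bool) (t : ℕ) :
    Config LearnerInstr × QState n :=
  (mstep (tapeDevice ω) inp)^[t] (⟨[p], fun _ => 0⟩, ⟨[], fun _ => false, 0, [], []⟩)

theorem tapeRun_succ (p : Prog LearnerInstr) (t : ℕ) :
    tapeRun p inp ω (t + 1) = mstep (tapeDevice ω) inp (tapeRun p inp ω t) :=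
  Function.iterate_succ_apply' ..

theorem log_prefix_mstep : y.2.log <+: (mstep (tapeDevice ω) inp y).2.log := by
  by_cases h : AtMeasure y
  · rw [log_of_atMeasure h]; exact List.prefix_append _ _
  · rw [log_of_not_atMeasure h]

theorem log_prefix (p : Prog LearnerInstr) {t t' : ℕ} (h : t ≤ t') :
    (tapeRun p inp ω t).2.log <+: (tapeRun p inp ω t').2.log := by
  induction t', h using Nat.le_induction with
  | base => exact List.prefix_rfl
  | succ m _ ih => rw [tapeRun_succ]; exact ih.trans log_prefix_mstep

theorem take_log_mstep {k : ℕ} (h : k < y.2.log.length) :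
    (mstep (tapeDevice ω) inp y).2.log.take (k + 1) = y.2.log.take (k + 1) := by
  obtain ⟨l, hl⟩ := log_prefix_mstep (ω := ω) (inp := inp) (y := y)
  rw [← hl, List.take_append_of_le_length (by omega)]

/-- Runs on tapes that agree up to `k` agree until measurement number `k` has been made. -/
theorem tapeRun_agree (p : Prog LearnerInstr) {k : ℕ} (h : ∀ i < k, ω i = ω' i) (t : ℕ) :
    tapeRun p inp ω t = tapeRun p inp ω' t ∨
      (k < (tapeRun p inp ω t).2.log.length ∧ k < (tapeRun p inp ω' t).2.log.length ∧
        (tapeRun p inp ω t).2.log.take (k + 1) = (tapeRun p inp ω' t).2.log.take (k + 1)) := by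
  induction t with
  | zero => exact Or.inl rfl
  | succ t ih =>
    rw [tapeRun_succ, tapeRun_succ]
    rcases ih with e | ⟨h1, h2, h3⟩
    · rw [← e]
      by_cases hk : (tapeRun p inp ω t).2.log.length < k
      · exact Or.inl (mstep_congr_of_outcome (h _ hk))
      · by_cases hm : AtMeasure (tapeRun p inp ω t)
        · right
          simp only [log_of_atMeasure hm]
          refine ⟨?_, ?_, trivial⟩ <;> simp <;> omega
        · exact Or.inl (mstep_of_not_atMeasure hm)
    · exact Or.inr ⟨h1.trans_le log_prefix_mstep.length_le, h2.trans_le log_prefix_mstep.length_le,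
        by rw [take_log_mstep h1, take_log_mstep h2, h3]⟩

/-- Causality: the choice of circuit number `i` depends only on the outcomes with smaller numbers.
-/
theorem log_getElem?_agree (p : Prog LearnerInstr) {k : ℕ} (h : ∀ i < k, ω i = ω' i) (t : ℕ)
    {i : ℕ} (hi : i ≤ k) :
    (tapeRun p inp ω t).2.log[i]? = (tapeRun p inp ω' t).2.log[i]? := by
  rcases tapeRun_agree (inp := inp) p h t with e | ⟨-, -, e⟩
  · rw [e]
  · rw [← List.getElem?_take_of_lt (show i < k + 1 by omega), e,
      List.getElem?_take_of_lt (show i < k + 1 by omega)]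

/-- The tape entry with number `log.length` is the next one to be read, and has not influenced
anything yet. -/
theorem tapeRun_update (p : Prog LearnerInstr) (t : ℕ) (z : Fin (n + n) → Bool) :
    tapeRun p inp (Function.update ω (tapeRun p inp ω t).2.log.length z) t = tapeRun p inp ω t := by
  rcases tapeRun_agree (inp := inp) (ω := ω)
    (ω' := Function.update ω (tapeRun p inp ω t).2.log.length z) p
    (k := (tapeRun p inp ω t).2.log.length) (fun i hi => by
      rw [Function.update_of_ne (by omega)]) t with e | ⟨h, -, -⟩
  · exact e.symm
  · exact absurd h (lt_irrefl _)

/-- Every possible configuration of a learning program comes from a tape of outcomes. -/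
theorem exists_tape (p : Prog LearnerInstr) (t : ℕ) {c : LConfig n}
    (hc : c ∈ (p.learn ρ t).support) : ∃ ω, c = toLConfig (tapeRun p [n] ω t) := by
  induction t generalizing c with
  | zero =>
    refine ⟨fun _ _ => false, ?_⟩
    simpa [Prog.learn, toLConfig, tapeRun] using hc
  | succ t ih =>
    rw [Prog.learn, PMF.mem_support_bind_iff] at hc
    obtain ⟨c', hc', hc⟩ := hc
    obtain ⟨ω, rfl⟩ := ih hc'
    by_cases hm : AtMeasure (tapeRun p [n] ω t)
    · rw [step_of_atMeasure (ω := ω) hm, PMF.mem_support_map_iff] at hc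
      obtain ⟨z, -, rfl⟩ := hc
      refine ⟨_, (congrArg _ (congrArg _ (tapeRun_update p t z))).symm.trans
        (congrArg _ (tapeRun_succ p t).symm)⟩
    · rw [step_of_not_atMeasure (ω := ω) hm, PMF.support_pure, Set.mem_singleton_iff] at hc
      exact ⟨ω, by rw [hc, tapeRun_succ]⟩

/-- The random configuration after `t` further steps. -/
noncomputable def stepsFrom (ρ : DensityMatrix n) (inp : List ℕ) : ℕ → LConfig n → PMF (LConfig n)
  | 0, c => PMF.pure c
  | t + 1, c => (LConfig.step ρ inp c).bind (stepsFrom ρ inp t)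

theorem learn_bind_stepsFrom (p : Prog LearnerInstr) (t i : ℕ) :
    (p.learn ρ t).bind (stepsFrom ρ [n] i) = p.learn ρ (t + i) := by
  induction i generalizing t with
  | zero => exact PMF.bind_pure _
  | succ i ih =>
    rw [show t + (i + 1) = t + 1 + i by ring, ← ih (t + 1), Prog.learn, PMF.bind_bind]
    rfl

/-- A potential that does not increase on average bounds the probability of a bad outcome. -/
theorem learn_le_potential (p : Prog LearnerInstr) (T : ℕ) (B : Set (LConfig n))
    (Φ : ℕ → (ℕ → Fin (n + n) → Bool) → ℝ≥0∞)
    (hB : ∀ ω, toLConfig (tapeRun p [n] ω T) ∈ B → 1 ≤ Φ (tapeRun p [n] ω T).2.log.length ω)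
    (hΦ : ∀ k ω circ, (tapeRun p [n] ω T).2.log[k]? = some circ →
      ∑ z, born ρ.twoCopies (circuitUnitary circ) z * Φ (k + 1) (Function.update ω k z) ≤ Φ k ω)
    (ω : ℕ → Fin (n + n) → Bool) :
    (p.learn ρ T).toOuterMeasure B ≤ Φ 0 ω := by
  -- Backward induction on the number `i` of remaining steps: from the configuration at time `t`,
  -- the probability of ending in `B` is at most the current potential. Only a measurement advances
  -- the index of the potential.
  have key : ∀ i t, t + i = T → ∀ ω,
      (stepsFrom ρ [n] i (toLConfig (tapeRun p [n] ω t))).toOuterMeasure B ≤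
        Φ (tapeRun p [n] ω t).2.log.length ω := by
    intro i
    induction i with
    | zero =>
      intro t ht ω
      obtain rfl : t = T := by omega
      rw [stepsFrom, PMF.toOuterMeasure_pure_apply]
      split_ifs with h
      · exact hB ω h
      · exact zero_le
    | succ i ih =>
      intro t ht ω
      rw [stepsFrom]
      by_cases hm : AtMeasure (tapeRun p [n] ω t)
      · set k := (tapeRun p [n] ω t).2.log.length with hk
        have hstep : ∀ z, mstep (tapeDevice (Function.update ω k z)) [n] (tapeRun p [n] ω t) =
            tapeRun p [n] (Function.update ω k z) (t + 1) := fun z => by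
          rw [tapeRun_succ, tapeRun_update]
        have hlen : ∀ ω', (tapeRun p [n] ω' t) = tapeRun p [n] ω t →
            (tapeRun p [n] ω' (t + 1)).2.log.length = k + 1 := fun ω' e => by
          rw [tapeRun_succ, e, log_of_atMeasure hm]; simp [hk]
        rw [step_of_atMeasure (ω := ω) hm, PMF.bind_map, PMF.toOuterMeasure_bind_apply,
          tsum_fintype]
        refine le_trans (Finset.sum_le_sum fun z _ => ?_) (hΦ k ω (tapeRun p [n] ω t).2.circuit ?_)
        · refine mul_le_mul_right ?_ _
          simp only [Function.comp]
          rw [hstep, ← hlen _ (tapeRun_update p t z)]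
          exact ih (t + 1) (by omega) _
        · have h1 := log_prefix (inp := [n]) (ω := ω) p (show t + 1 ≤ T by omega)
          rw [tapeRun_succ, log_of_atMeasure hm] at h1
          obtain ⟨l, hl⟩ := h1
          rw [← hl, hk]
          simp
      · rw [step_of_not_atMeasure (ω := ω) hm, PMF.pure_bind, ← tapeRun_succ]
        have := ih (t + 1) (by omega) ω
        rwa [show (tapeRun p [n] ω (t + 1)).2.log.length = (tapeRun p [n] ω t).2.log.length by
          rw [tapeRun_succ, log_of_not_atMeasure hm]] at this
  have := key T 0 (by omega) ω
  have e := learn_bind_stepsFrom (ρ := ρ) p 0 T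
  rw [zero_add] at e
  rw [← e, Prog.learn, PMF.pure_bind]
  exact this

theorem toOuterMeasure_compl_ge {α : Type} (μ : PMF α) (S : Set α) {δ : ℝ≥0∞}
    (h : μ.toOuterMeasure Sᶜ ≤ δ) : 1 - δ ≤ μ.toOuterMeasure S := by
  have : μ.toOuterMeasure S + μ.toOuterMeasure Sᶜ = 1 := by
    rw [PMF.toOuterMeasure_apply, PMF.toOuterMeasure_apply, ← ENNReal.tsum_add, ← μ.tsum_coe]
    exact tsum_congr fun a => by
      by_cases ha : a ∈ S <;> simp [ha]
  rw [← this]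
  exact tsub_le_iff_right.mpr (add_le_add_right h _)

end

end PauliLearning

/-! ### Clifford conjugation of Pauli operators, and their expectation values. -/

namespace PauliLearning
open scoped ComplexOrder

/-! ### Pauli operators and their conjugation by Clifford gates -/

/-- The sign `(-1)^a`. -/
noncomputable def sgn (a : ZMod 2) : ℂ := if a = 0 then 1 else -1

/-- The Pauli operator with the given bits. -/
def Pauli.ofBits (x z : ZMod 2) : Pauli :=
  if x = 0 then (if z = 0 then .I else .Z) else (if z = 0 then .X else .Y)

theorem ZMod.two_cases (a : ZMod 2) : a = 0 ∨ a = 1 := by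
  revert a; decide

theorem sgn_add (a b : ZMod 2) : sgn (a + b) = sgn a * sgn b := by
  rcases ZMod.two_cases a with rfl | rfl <;> rcases ZMod.two_cases b with rfl | rfl <;>
    simp [sgn, show (1 + 1 : ZMod 2) = 0 from rfl]

theorem sgn_sum {ι : Type*} (s : Finset ι) (f : ι → ZMod 2) :
    sgn (∑ i ∈ s, f i) = ∏ i ∈ s, sgn (f i) := by
  classical
  induction s using Finset.induction_on with
  | empty => simp [sgn]
  | insert a s ha ih => rw [Finset.sum_insert ha, Finset.prod_insert ha, sgn_add, ih]

noncomputable def pauliMat (x z : ZMod 2) : Matrix Bool Bool ℂ := (Pauli.ofBits x z).mat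

theorem pauliMat_star (x z : ZMod 2) : star (pauliMat x z) = pauliMat x z := by
  rcases ZMod.two_cases x with rfl | rfl <;> rcases ZMod.two_cases z with rfl | rfl <;>
    ext a b <;> cases a <;> cases b <;>
    simp [pauliMat, Pauli.ofBits, Pauli.mat, Matrix.star_apply]

theorem pauliMat_mul_self (x z : ZMod 2) : pauliMat x z * pauliMat x z = 1 := by
  rcases ZMod.two_cases x with rfl | rfl <;> rcases ZMod.two_cases z with rfl | rfl <;>
    ext a b <;> cases a <;> cases b <;>
    simp [pauliMat, Pauli.ofBits, Pauli.mat, Matrix.mul_apply]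

theorem pauliMat_comm (x z x' z' : ZMod 2) :
    pauliMat x z * pauliMat x' z' = sgn (x * z' + z * x') • (pauliMat x' z' * pauliMat x z) := by
  rcases ZMod.two_cases x with rfl | rfl <;> rcases ZMod.two_cases z with rfl | rfl <;>
  rcases ZMod.two_cases x' with rfl | rfl <;> rcases ZMod.two_cases z' with rfl | rfl <;>
    ext a b <;> cases a <;> cases b <;>
    simp [pauliMat, Pauli.ofBits, Pauli.mat, Matrix.mul_apply, sgn,
      show (1 + 1 : ZMod 2) = 0 from rfl]

/-- X and Z are exchanged and Y becomes -Y; `x * z` is 1 exactly for Y. -/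
theorem hadamard_conj (x z : ZMod 2) :
    hadamard * pauliMat x z * star hadamard = sgn (x * z) • pauliMat z x := by
  have h : ((Real.sqrt 2 : ℝ) : ℂ) * ((Real.sqrt 2 : ℝ) : ℂ) = 2 := by
    rw [← Complex.ofReal_mul, Real.mul_self_sqrt (by norm_num)]; norm_num
  have h' : ((Real.sqrt 2 : ℝ) : ℂ)⁻¹ * ((Real.sqrt 2 : ℝ) : ℂ)⁻¹ = 1 / 2 := by
    rw [← mul_inv, h]; norm_num
  have h2 : ∀ c : ℂ, ((Real.sqrt 2 : ℝ) : ℂ)⁻¹ * c * ((Real.sqrt 2 : ℝ) : ℂ)⁻¹ = c / 2 :=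
    fun c => by linear_combination c * h'
  rcases ZMod.two_cases x with rfl | rfl <;> rcases ZMod.two_cases z with rfl | rfl <;>
    ext a b <;> cases a <;> cases b <;>
    simp [pauliMat, Pauli.ofBits, Pauli.mat, Matrix.mul_apply, Matrix.star_apply, sgn, hadamard,
      h', h2] <;> ring

/-- X becomes Y, Y becomes -X, and Z is fixed. -/
theorem phase_conj (x z : ZMod 2) :
    phase * pauliMat x z * star phase = sgn (x * z) • pauliMat x (z + x) := by
  rcases ZMod.two_cases x with rfl | rfl <;> rcases ZMod.two_cases z with rfl | rfl <;>
    ext a b <;> cases a <;> cases b <;>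
    simp [pauliMat, Pauli.ofBits, Pauli.mat, Matrix.mul_apply, Matrix.star_apply, sgn, phase,
      show (1 + 1 : ZMod 2) = 0 from rfl]

/-- Stated for matrix entries because CNOT permutes the basis, so that conjugation is a substitution
of indices. The sign is -1 exactly for X⊗Z and Y⊗Y, which become -Y⊗Y and -X⊗Z. -/
theorem cnot_entry (xc zc xt zt : ZMod 2) (a b a' b' : Bool) :
    pauliMat xc zc a a' * pauliMat xt zt (xor b a) (xor b' a') =
      sgn (xc * zt * (xt + zc + 1)) *
        (pauliMat xc (zc + zt) a a' * pauliMat (xt + xc) zt b b') := by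
  rcases ZMod.two_cases xc with rfl | rfl <;> rcases ZMod.two_cases zc with rfl | rfl <;>
  rcases ZMod.two_cases xt with rfl | rfl <;> rcases ZMod.two_cases zt with rfl | rfl <;>
    cases a <;> cases a' <;> cases b <;> cases b' <;>
    simp [pauliMat, Pauli.ofBits, Pauli.mat, sgn, Matrix.one_apply,
      show (1 + 1 : ZMod 2) = 0 from rfl]

theorem tensor_smul {m : ℕ} (c : Fin m → ℂ) (A : Fin m → Matrix Bool Bool ℂ) :
    (tensor fun i => c i • A i) = (∏ i, c i) • tensor A := by
  ext x y
  simp [tensor, Finset.prod_mul_distrib]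

/-- The tensor product of the Pauli operators with bits `x i` and `z i`. -/
noncomputable def pauliTensor (m : ℕ) (x z : ℕ → ZMod 2) : QMat m :=
  tensor fun i => pauliMat (x i) (z i)

/-- The symplectic form. -/
def symp (m : ℕ) (x z x' z' : ℕ → ZMod 2) : ZMod 2 :=
  ∑ i ∈ Finset.range m, (x i * z' i + z i * x' i)

theorem pauliTensor_star (m : ℕ) (x z : ℕ → ZMod 2) :
    star (pauliTensor m x z) = pauliTensor m x z := by
  simp [pauliTensor, tensor_star, pauliMat_star]

theorem pauliTensor_mul_self (m : ℕ) (x z : ℕ → ZMod 2) :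
    pauliTensor m x z * pauliTensor m x z = 1 := by
  simp [pauliTensor, tensor_mul, pauliMat_mul_self, tensor_one]

theorem pauliTensor_comm (m : ℕ) (x z x' z' : ℕ → ZMod 2) :
    pauliTensor m x z * pauliTensor m x' z' =
      sgn (symp m x z x' z') • (pauliTensor m x' z' * pauliTensor m x z) := by
  simp only [pauliTensor, tensor_mul]
  rw [funext fun i : Fin m => pauliMat_comm (x i) (z i) (x' i) (z' i), tensor_smul, symp, sgn_sum,
    Fin.prod_univ_eq_prod_range (fun i => sgn (x i * z' i + z i * x' i))]

/-- A signed Pauli operator. -/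
@[ext] structure Tableau where
  x : ℕ → ZMod 2
  z : ℕ → ZMod 2
  s : ZMod 2

noncomputable def Tableau.op (m : ℕ) (τ : Tableau) : QMat m := sgn τ.s • pauliTensor m τ.x τ.z

/-- Gates on qubits that are given by their numbers. -/
inductive Op : Type
  | H (i : ℕ)
  | S (i : ℕ)
  | C (i j : ℕ)

/-- Conjugation of a signed Pauli operator. -/
def Op.act : Op → Tableau → Tableau
  | .H i, τ => ⟨Function.update τ.x i (τ.z i), Function.update τ.z i (τ.x i), τ.s + τ.x i * τ.z i⟩
  | .S i, τ => ⟨τ.x, Function.update τ.z i (τ.z i + τ.x i), τ.s + τ.x i * τ.z i⟩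
  | .C c t, τ => ⟨Function.update τ.x t (τ.x t + τ.x c), Function.update τ.z c (τ.z c + τ.z t),
      τ.s + τ.x c * τ.z t * (τ.x t + τ.z c + 1)⟩

/-- The gate acts on qubits with numbers less than `m`. -/
def Op.Ok (m : ℕ) : Op → Prop
  | .H i => i < m
  | .S i => i < m
  | .C i j => i < m ∧ j < m ∧ i ≠ j

def Op.gates (m : ℕ) : Op → List (Gate m)
  | .H i => gateH? m i
  | .S i => gateS? m i
  | .C i j => gateCNOT? m i j

theorem tensor_eq_smul {m : ℕ} (i : Fin m) (c : ℂ) {A B : Fin m → Matrix Bool Bool ℂ}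
    (hi : A i = c • B i) (h : ∀ j, j ≠ i → A j = B j) : tensor A = c • tensor B := by
  have : A = fun j => (if j = i then c else 1) • B j := by
    funext j
    by_cases hj : j = i
    · subst hj; simp [hi]
    · simp [hj, h j hj]
  rw [this, tensor_smul]
  simp

theorem hGate_conj {m : ℕ} (i : Fin m) (τ : Tableau) :
    (Gate.H i).mat * τ.op m * star (Gate.H i).mat = ((Op.H i).act τ).op m := by
  simp only [Gate.mat, Tableau.op, pauliTensor, tensor_star, Matrix.mul_smul, Matrix.smul_mul,
    tensor_mul, Op.act, sgn_add, mul_smul]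
  congr 1
  refine tensor_eq_smul i _ ?_ fun j hj => ?_
  · simp [hadamard_conj]
  · have : (j : ℕ) ≠ i := fun h => hj (Fin.ext h)
    simp [hj, this]

theorem sGate_conj {m : ℕ} (i : Fin m) (τ : Tableau) :
    (Gate.S i).mat * τ.op m * star (Gate.S i).mat = ((Op.S i).act τ).op m := by
  simp only [Gate.mat, Tableau.op, pauliTensor, tensor_star, Matrix.mul_smul, Matrix.smul_mul,
    tensor_mul, Op.act, sgn_add, mul_smul]
  congr 1
  refine tensor_eq_smul i _ ?_ fun j hj => ?_
  · simp [phase_conj]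
  · have : (j : ℕ) ≠ i := fun h => hj (Fin.ext h)
    simp [hj, this]

theorem cnotFun_eq_iff {m : ℕ} {c t : Fin m} (h : c ≠ t) (x y : Fin m → Bool) :
    x = cnotFun c t y ↔ y = cnotFun c t x :=
  ⟨fun e => by rw [e, cnotFun_cnotFun h], fun e => by rw [e, cnotFun_cnotFun h]⟩

theorem cnotGate_conj_apply {m : ℕ} {c t : Fin m} (h : c ≠ t) (A : QMat m) (x y) :
    ((Gate.CNOT c t h).mat * A * star (Gate.CNOT c t h).mat) x y =
      A (cnotFun c t x) (cnotFun c t y) := by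
  have hx : ∀ a, x = cnotFun c t a ↔ a = cnotFun c t x := fun a => cnotFun_eq_iff h x a
  have hy : ∀ a, y = cnotFun c t a ↔ a = cnotFun c t y := fun a => cnotFun_eq_iff h y a
  simp [Gate.mat, Matrix.mul_apply, Matrix.star_apply, hx, hy]

theorem cnotGate_conj {m : ℕ} {c t : Fin m} (h : c ≠ t) (τ : Tableau) :
    (Gate.CNOT c t h).mat * τ.op m * star (Gate.CNOT c t h).mat = ((Op.C c t).act τ).op m := by
  ext a b
  have hv : (c : ℕ) ≠ t := fun e => h (Fin.ext e)
  rw [cnotGate_conj_apply]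
  simp only [Tableau.op, pauliTensor, tensor, Matrix.smul_apply, Matrix.of_apply, Op.act, sgn_add,
    smul_eq_mul, mul_assoc]
  congr 1
  have split : ∀ f : Fin m → ℂ, ∏ i, f i = f c * f t * ∏ i ∈ (Finset.univ.erase c).erase t, f i := by
    intro f
    rw [mul_assoc, Finset.mul_prod_erase _ _ (by simp [h.symm]), Finset.mul_prod_erase _ _ (by simp)]
  rw [split, split]
  simp only [cnotFun, Function.update_self, Function.update_of_ne h, Function.update_of_ne hv,
    Function.update_of_ne hv.symm, cnot_entry, ← mul_assoc]
  congr 1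
  refine Finset.prod_congr rfl fun i hi => ?_
  simp only [Finset.mem_erase, Finset.mem_univ, and_true] at hi
  have h1 : (i : ℕ) ≠ t := fun e => hi.1 (Fin.ext e)
  have h2 : (i : ℕ) ≠ c := fun e => hi.2 (Fin.ext e)
  rw [Function.update_of_ne hi.1, Function.update_of_ne hi.1, Function.update_of_ne h1,
    Function.update_of_ne h2]

theorem circuitUnitary_append {m : ℕ} (l l' : List (Gate m)) :
    circuitUnitary (l ++ l') = circuitUnitary l' * circuitUnitary l := by
  induction l with
  | nil => simp [circuitUnitary]
  | cons g l ih => rw [List.cons_append, circuitUnitary, ih, circuitUnitary, mul_assoc]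

theorem Op.gates_conj {m : ℕ} {g : Op} (hg : g.Ok m) (τ : Tableau) :
    (circuitUnitary (g.gates m) : QMat m) * τ.op m * star (circuitUnitary (g.gates m) : QMat m) =
      (g.act τ).op m := by
  cases g with
  | H i =>
    simp only [Op.Ok] at hg
    simp only [Op.gates, gateH?, dif_pos hg, circuitUnitary, one_mul]
    exact hGate_conj ⟨i, hg⟩ τ
  | S i =>
    simp only [Op.Ok] at hg
    simp only [Op.gates, gateS?, dif_pos hg, circuitUnitary, one_mul]
    exact sGate_conj ⟨i, hg⟩ τ
  | C i j =>
    simp only [Op.Ok] at hg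
    simp only [Op.gates, gateCNOT?, dif_pos hg, circuitUnitary, one_mul]
    exact cnotGate_conj (c := ⟨i, hg.1⟩) (t := ⟨j, hg.2.1⟩) _ τ

/-- Conjugation by a list of gates. -/
def conjList (l : List Op) (τ : Tableau) : Tableau := l.foldl (fun τ g => g.act τ) τ

theorem circuitUnitary_conj {m : ℕ} {l : List Op} (hl : ∀ g ∈ l, g.Ok m) (τ : Tableau) :
    (circuitUnitary (l.flatMap (Op.gates m)) : QMat m) * τ.op m *
      star (circuitUnitary (l.flatMap (Op.gates m)) : QMat m) = (conjList l τ).op m := by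
  induction l generalizing τ with
  | nil => simp [circuitUnitary, conjList]
  | cons g l ih =>
    have h1 := ih (fun g' hg' => hl g' (List.mem_cons_of_mem _ hg')) (g.act τ)
    rw [← Op.gates_conj (hl g List.mem_cons_self)] at h1
    rw [List.flatMap_cons, circuitUnitary_append]
    simp only [Submonoid.coe_mul, star_mul]
    simp only [mul_assoc] at h1 ⊢
    exact h1

/-- A bit as an element of `ℤ/2`. -/
def bitF (b : Bool) : ZMod 2 := if b then 1 else 0

theorem pauliMat_zero_apply (z : ZMod 2) (a b : Bool) :
    pauliMat 0 z a b = if a = b then sgn (z * bitF a) else 0 := by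
  rcases ZMod.two_cases z with rfl | rfl <;> cases a <;> cases b <;>
    simp [pauliMat, Pauli.ofBits, Pauli.mat, sgn, bitF]

/-- Without X-bits every tensor factor is 𝟙 or Z, so a basis vector is multiplied by a sign whose
exponent is affine in its bits. -/
theorem op_eq_diagonal {m : ℕ} {τ : Tableau} (h : ∀ i < m, τ.x i = 0) :
    τ.op m = Matrix.diagonal fun b : Fin m → Bool => sgn (τ.s + ∑ i : Fin m, τ.z i * bitF (b i)) := by
  ext a b
  simp only [Tableau.op, pauliTensor, tensor, Matrix.smul_apply, Matrix.of_apply, smul_eq_mul,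
    Matrix.diagonal_apply, sgn_add, sgn_sum]
  have : ∀ i : Fin m, pauliMat (τ.x i) (τ.z i) (a i) (b i) =
      if a i = b i then sgn (τ.z i * bitF (a i)) else 0 := fun i => by
    rw [h i i.2, pauliMat_zero_apply]
  simp only [this]
  by_cases hab : a = b
  · simp [hab]
  · obtain ⟨i, hi⟩ := Function.ne_iff.mp hab
    rw [if_neg hab, Finset.prod_eq_zero (Finset.mem_univ i) (if_neg hi), mul_zero]

/-! ### Expectation values -/

theorem born_toReal {m : ℕ} (σ : DensityMatrix m) (U : Matrix.unitaryGroup (Fin m → Bool) ℂ)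
    (z : Fin m → Bool) :
    (born σ U z).toReal = (((U : QMat m) * σ.mat * star (U : QMat m)) z z).re := by
  rw [born, PMF.ofFintype_apply, ENNReal.toReal_ofReal]
  exact (Complex.le_def.mp ((conj_posSemidef σ U).diag_nonneg (i := z))).1

/-- Tr(σA) = Tr(UσU† · UAU†), and against a diagonal observable only the diagonal of UσU† counts,
which holds the outcome probabilities. -/
theorem born_mean {m : ℕ} (σ : DensityMatrix m) (U : Matrix.unitaryGroup (Fin m → Bool) ℂ)
    (A : QMat m) (d : (Fin m → Bool) → ℝ)
    (h : (U : QMat m) * A * star (U : QMat m) = Matrix.diagonal fun z => (d z : ℂ)) :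
    ∑ z, (born σ U z).toReal * d z = ((σ.mat * A).trace).re := by
  have hU : star (U : QMat m) * (U : QMat m) = 1 := Matrix.UnitaryGroup.star_mul_self U
  have e : (σ.mat * A).trace =
      (((U : QMat m) * σ.mat * star (U : QMat m)) * ((U : QMat m) * A * star (U : QMat m))).trace := by
    have : ((U : QMat m) * σ.mat * star (U : QMat m)) * ((U : QMat m) * A * star (U : QMat m)) =
        (U : QMat m) * (σ.mat * A * star (U : QMat m)) := by
      calc _ = (U : QMat m) * σ.mat * (star (U : QMat m) * (U : QMat m)) * A * star (U : QMat m) := by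
            simp only [mul_assoc]
        _ = _ := by rw [hU]; simp only [mul_assoc, one_mul]
    rw [this, Matrix.trace_mul_comm (U : QMat m), mul_assoc, hU, mul_one]
  rw [e, h, Matrix.trace, Complex.re_sum]
  refine Finset.sum_congr rfl fun z _ => ?_
  rw [born_toReal, Matrix.diag_apply, Matrix.mul_diagonal, Complex.re_mul_ofReal]

theorem trace_mul_hermitian_im {m : ℕ} (σ : DensityMatrix m) {A : QMat m} (hA : star A = A) :
    ((σ.mat * A).trace).im = 0 := by
  have hσ : star σ.mat = σ.mat := σ.posSemidef.isHermitian
  have : star (σ.mat * A).trace = (σ.mat * A).trace := by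
    have := Matrix.trace_conjTranspose (σ.mat * A)
    rw [← this, Matrix.conjTranspose_mul, ← Matrix.star_eq_conjTranspose,
      ← Matrix.star_eq_conjTranspose, hA, hσ, Matrix.trace_mul_comm]
  exact Complex.conj_eq_iff_im.mp this

theorem trace_sq_nonneg {m : ℕ} (σ : DensityMatrix m) {B : QMat m} (hB : star B = B) :
    0 ≤ ((σ.mat * (B * B)).trace).re := by
  have h := (σ.posSemidef.mul_mul_conjTranspose_same B).trace_nonneg
  rw [← Matrix.star_eq_conjTranspose, hB, Matrix.trace_mul_comm, ← mul_assoc,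
    Matrix.trace_mul_comm] at h
  exact (Complex.le_def.mp h).1

/-- Expectation values of pairwise anticommuting observables with square `1`. -/
theorem sum_sq_le_one {m : ℕ} (σ : DensityMatrix m) {ι : Type*} (S : Finset ι) (A : ι → QMat m)
    (hA : ∀ a ∈ S, star (A a) = A a) (hA2 : ∀ a ∈ S, A a * A a = 1)
    (hanti : ∀ a ∈ S, ∀ b ∈ S, a ≠ b → A a * A b = -(A b * A a)) :
    ∑ a ∈ S, (((σ.mat * A a).trace).re) ^ 2 ≤ 1 := by
  classical
  set c : ι → ℝ := fun a => ((σ.mat * A a).trace).re with hc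
  set s : ℝ := ∑ a ∈ S, c a ^ 2 with hs
  have hcA : ∀ a ∈ S, (σ.mat * A a).trace = (c a : ℂ) := fun a ha =>
    Complex.ext (by simp [hc]) (by simp [trace_mul_hermitian_im σ (hA a ha)])
  set B : QMat m := ∑ a ∈ S, (c a : ℂ) • A a with hBdef
  have hBstar : star B = B := by
    rw [hBdef, star_sum]
    refine Finset.sum_congr rfl fun a ha => ?_
    rw [star_smul, hA a ha, Complex.star_def, Complex.conj_ofReal]
  -- B² is added to the same double sum with the factors exchanged. Anticommutation cancels the
  -- off-diagonal terms, and the diagonal ones give 2s.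
  have hB2 : B * B = (s : ℂ) • (1 : QMat m) := by
    have h2 : B * B + B * B = (2 * s : ℂ) • (1 : QMat m) := by
      have e1 : B * B = ∑ a ∈ S, ∑ b ∈ S, ((c a * c b : ℝ) : ℂ) • (A a * A b) := by
        rw [hBdef, Finset.sum_mul_sum]
        refine Finset.sum_congr rfl fun a _ => Finset.sum_congr rfl fun b _ => ?_
        rw [smul_mul_smul_comm, Complex.ofReal_mul]
      have e2 : B * B = ∑ a ∈ S, ∑ b ∈ S, ((c a * c b : ℝ) : ℂ) • (A b * A a) := by
        rw [e1, Finset.sum_comm]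
        refine Finset.sum_congr rfl fun a _ => Finset.sum_congr rfl fun b _ => ?_
        rw [mul_comm (c b)]
      nth_rw 1 [e1]
      rw [e2, ← Finset.sum_add_distrib]
      have : ∀ a ∈ S, (∑ b ∈ S, ((c a * c b : ℝ) : ℂ) • (A a * A b) +
          ∑ b ∈ S, ((c a * c b : ℝ) : ℂ) • (A b * A a)) = (2 * (c a ^ 2 : ℝ) : ℂ) • (1 : QMat m) := by
        intro a ha
        rw [← Finset.sum_add_distrib, Finset.sum_eq_single_of_mem a ha]
        · rw [hA2 a ha, ← add_smul]; congr 1; push_cast; ring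
        · intro b hb hba
          rw [hanti a ha b hb hba.symm, smul_neg, neg_add_cancel]
      rw [Finset.sum_congr rfl this, ← Finset.sum_smul, ← Finset.mul_sum, hs]
      push_cast; rfl
    have h3 : (2 : ℂ) • (B * B) = (2 : ℂ) • ((s : ℂ) • (1 : QMat m)) := by
      rw [two_smul, h2, smul_smul]
    exact smul_right_injective _ (two_ne_zero' ℂ) h3
  have hBs : star (B - (s : ℂ) • (1 : QMat m)) = B - (s : ℂ) • (1 : QMat m) := by
    rw [star_sub, hBstar, star_smul, star_one, Complex.star_def, Complex.conj_ofReal]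
  have htr : (σ.mat * B).trace = (s : ℂ) := by
    rw [hBdef, Finset.mul_sum, Matrix.trace_sum, hs]
    push_cast
    refine Finset.sum_congr rfl fun a ha => ?_
    rw [Matrix.mul_smul, Matrix.trace_smul, hcA a ha, smul_eq_mul, sq]
  -- The expectation of (B - s)² is nonnegative and equals s - s², because B² = s and Tr(σB) = s.
  -- This forces s ≤ 1.
  have hpos := trace_sq_nonneg σ hBs
  have hexp : (B - (s : ℂ) • (1 : QMat m)) * (B - (s : ℂ) • (1 : QMat m)) =
      ((s : ℂ) + s ^ 2) • (1 : QMat m) - (2 * s : ℂ) • B := by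
    rw [sub_mul, mul_sub, mul_sub, hB2]
    simp only [smul_mul_assoc, one_mul, mul_smul_comm, mul_one, smul_smul]
    module
  rw [hexp, mul_sub, Matrix.trace_sub, Matrix.mul_smul, Matrix.trace_smul, Matrix.mul_smul,
    Matrix.trace_smul, mul_one, σ.trace_eq_one, htr] at hpos
  have hval : ((s : ℂ) + s ^ 2) • (1 : ℂ) - (2 * s : ℂ) • (s : ℂ) = ((s - s ^ 2 : ℝ) : ℂ) := by
    simp only [smul_eq_mul]; push_cast; ring
  rw [hval, Complex.ofReal_re] at hpos
  have hs0 : 0 ≤ s := Finset.sum_nonneg fun a _ => sq_nonneg _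
  by_contra hlt
  push Not at hlt
  nlinarith

/-- The trace factorizes over the two copies. Equal halves give the square of an expectation value,
for the Bell measurements; a trivial second half gives the value itself, for measurements of a
single copy. -/
theorem twoCopies_trace {n : ℕ} (ρ : DensityMatrix n) (x z : ℕ → ZMod 2) :
    (ρ.twoCopies.mat * pauliTensor (n + n) x z).trace =
      (ρ.mat * pauliTensor n x z).trace *
        (ρ.mat * pauliTensor n (fun i => x (n + i)) fun i => z (n + i)).trace := by
  simp only [Matrix.trace, Matrix.diag_apply, Matrix.mul_apply]
  rw [← Equiv.sum_comp (Fin.appendEquiv n n), Fintype.sum_prod_type, Finset.sum_mul_sum]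
  refine Finset.sum_congr rfl fun a _ => Finset.sum_congr rfl fun b _ => ?_
  rw [← Equiv.sum_comp (Fin.appendEquiv n n), Fintype.sum_prod_type, Finset.sum_mul_sum]
  refine Finset.sum_congr rfl fun a' _ => Finset.sum_congr rfl fun b' _ => ?_
  simp only [DensityMatrix.twoCopies, twoCopiesMat, Matrix.of_apply, Fin.appendEquiv,
    Equiv.coe_fn_mk, Fin.append_left, Fin.append_right, pauliTensor, tensor, Fin.prod_univ_add,
    Fin.val_castAdd, Fin.val_natAdd]
  ring

theorem pauliTensor_zero (m : ℕ) : pauliTensor m (fun _ => 0) (fun _ => 0) = 1 := by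
  have : pauliMat 0 0 = 1 := by simp [pauliMat, Pauli.ofBits, Pauli.mat]
  simp [pauliTensor, this, tensor_one]

theorem pauliTensor_congr {m : ℕ} {x z x' z' : ℕ → ZMod 2} (hx : ∀ i < m, x i = x' i)
    (hz : ∀ i < m, z i = z' i) : pauliTensor m x z = pauliTensor m x' z' := by
  unfold pauliTensor
  congr 1
  funext i
  rw [hx i i.2, hz i i.2]

end PauliLearning

/-! ### Symplectic linear algebra mod 2: diagonalization and covering by commuting families. -/

namespace PauliLearning

/-! ### Numbering of Pauli operators -/

/-- The `X`-bits of the Pauli operator with number `q`. -/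
def qx (q i : ℕ) : ZMod 2 := ((q / 4 ^ i : ℕ) : ZMod 2)

/-- The `Z`-bits of the Pauli operator with number `q`. -/
def qz (q i : ℕ) : ZMod 2 := ((q / 4 ^ i / 2 : ℕ) : ZMod 2)

def tabOf (q : ℕ) : Tableau := ⟨qx q, qz q, 0⟩

/-- Needed to the base 4, for the Pauli operator on each qubit, and to the base `2 * n + 1`, for
lists of marks. -/
theorem exists_digits (b : ℕ) (K : ℕ) (d : ℕ → ℕ) (hd : ∀ i, d i < b) :
    ∃ j < b ^ K, ∀ i < K, j / b ^ i % b = d i := by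
  induction K generalizing d with
  | zero => exact ⟨0, by simp⟩
  | succ K ih =>
    obtain ⟨j, hj, h⟩ := ih (fun i => d (i + 1)) fun i => hd _
    have hb : 0 < b := (Nat.zero_le _).trans_lt (hd 0)
    refine ⟨d 0 + b * j, ?_, fun i hi => ?_⟩
    · have := hd 0
      calc d 0 + b * j < b + b * j := by omega
        _ = b * (j + 1) := by ring
        _ ≤ b * b ^ K := Nat.mul_le_mul_left _ hj
        _ = b ^ (K + 1) := by ring
    · cases i with
      | zero => simp [Nat.mod_eq_of_lt (hd 0)]
      | succ i =>
        rw [pow_succ', ← Nat.div_div_eq_div_mul, Nat.add_mul_div_left _ _ hb,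
          Nat.div_eq_of_lt (hd 0), zero_add, h i (by omega)]

theorem exists_index (n : ℕ) (x z : ℕ → ZMod 2) :
    ∃ q < 4 ^ n, ∀ i < n, qx q i = x i ∧ qz q i = z i := by
  obtain ⟨q, hq, h⟩ := exists_digits 4 n (fun i => (x i).val + 2 * (z i).val) fun i => by
    have := (x i).val_lt; have := (z i).val_lt; omega
  refine ⟨q, hq, fun i hi => ?_⟩
  have h1 := h i hi
  have hx := (x i).val_lt
  have hz := (z i).val_lt
  constructor
  · have : q / 4 ^ i % 2 = (x i).val := by omega
    rw [qx, ← ZMod.natCast_mod, this, ZMod.natCast_zmod_val]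
  · have : q / 4 ^ i / 2 % 2 = (z i).val := by omega
    rw [qz, ← ZMod.natCast_mod, this, ZMod.natCast_zmod_val]

theorem qx_eq_zero {n q i : ℕ} (hq : q < 4 ^ n) (hi : n ≤ i) : qx q i = 0 := by
  rw [qx, Nat.div_eq_of_lt (hq.trans_le (Nat.pow_le_pow_right (by norm_num) hi)), Nat.cast_zero]

theorem qz_eq_zero {n q i : ℕ} (hq : q < 4 ^ n) (hi : n ≤ i) : qz q i = 0 := by
  rw [qz, Nat.div_eq_of_lt (hq.trans_le (Nat.pow_le_pow_right (by norm_num) hi)), Nat.zero_div,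
    Nat.cast_zero]

/-- The symplectic form of two numbered Pauli operators. -/
def sympQ (n q q' : ℕ) : ZMod 2 := symp n (qx q) (qz q) (qx q') (qz q')

theorem symp_comm (n : ℕ) (x z x' z' : ℕ → ZMod 2) : symp n x z x' z' = symp n x' z' x z :=
  Finset.sum_congr rfl fun i _ => by ring

theorem add_self_zmod2 (a : ZMod 2) : a + a = 0 := by revert a; decide

theorem symp_self (n : ℕ) (x z : ℕ → ZMod 2) : symp n x z x z = 0 :=
  Finset.sum_eq_zero fun i _ => by rw [mul_comm (z i)]; exact add_self_zmod2 _

/-! ### Linear structure -/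

/-- The space of Pauli operators up to phase. -/
abbrev PVec (n : ℕ) : Type := (Fin n → ZMod 2) × (Fin n → ZMod 2)

def PVec.tab {n : ℕ} (v : PVec n) : Tableau :=
  ⟨fun i => if h : i < n then v.1 ⟨i, h⟩ else 0, fun i => if h : i < n then v.2 ⟨i, h⟩ else 0, 0⟩

def vecOf (n q : ℕ) : PVec n := (fun i => qx q i, fun i => qz q i)

theorem vecOf_tab {n q : ℕ} (hq : q < 4 ^ n) : (vecOf n q).tab = tabOf q := by
  ext i
  · by_cases h : i < n
    · simp [PVec.tab, vecOf, tabOf, h]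
    · simp [PVec.tab, tabOf, h, qx_eq_zero hq (not_lt.mp h)]
  · by_cases h : i < n
    · simp [PVec.tab, vecOf, tabOf, h]
    · simp [PVec.tab, tabOf, h, qz_eq_zero hq (not_lt.mp h)]
  · rfl

/-- The bits of `τ` are the sums of the bits of `τ₁` and `τ₂`. -/
def Tableau.IsSum (τ τ₁ τ₂ : Tableau) : Prop :=
  (∀ i, τ.x i = τ₁.x i + τ₂.x i) ∧ ∀ i, τ.z i = τ₁.z i + τ₂.z i

theorem PVec.tab_add {n : ℕ} (v w : PVec n) : (v + w).tab.IsSum v.tab w.tab := by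
  constructor <;> intro i <;> by_cases h : i < n <;> simp [PVec.tab, h]

/-- The bits transform linearly. The sign does not, which is why `IsSum` leaves it out. -/
theorem Op.act_isSum (g : Op) {τ τ₁ τ₂ : Tableau} (h : τ.IsSum τ₁ τ₂) :
    (g.act τ).IsSum (g.act τ₁) (g.act τ₂) := by
  obtain ⟨hx, hz⟩ := h
  cases g <;> constructor <;> intro j <;> simp only [Op.act, Function.update_apply] <;>
    try split_ifs
  all_goals simp only [hx, hz]
  all_goals ring

theorem conjList_isSum (l : List Op) {τ τ₁ τ₂ : Tableau} (h : τ.IsSum τ₁ τ₂) :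
    (conjList l τ).IsSum (conjList l τ₁) (conjList l τ₂) := by
  induction l generalizing τ τ₁ τ₂ with
  | nil => exact h
  | cons g l ih => exact ih (g.act_isSum h)

/-- An `X`-bit after conjugation, as an additive function. -/
def conjBit (n : ℕ) (l : List Op) (i : ℕ) : PVec n →+ ZMod 2 :=
  AddMonoidHom.mk' (fun v => (conjList l v.tab).x i) fun v w =>
    (conjList_isSum l (v.tab_add w)).1 i

/-- The symplectic form with a fixed second argument. -/
def sympHom (n : ℕ) (x z : ℕ → ZMod 2) : PVec n →+ ZMod 2 :=
  AddMonoidHom.mk' (fun v => symp n v.tab.x v.tab.z x z) fun v w => by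
    rw [symp, symp, symp, ← Finset.sum_add_distrib]
    refine Finset.sum_congr rfl fun i _ => ?_
    rw [(v.tab_add w).1, (v.tab_add w).2]
    ring

/-- Each `v k` lies outside the span of its predecessors, as `f k` kills them but not `v k`. So the
spans grow strictly inside a space of dimension 2n. Both the number of circuit rounds and the number
of refinement steps are bounded in this way. -/
theorem triangular_le {n c : ℕ} (v : ℕ → PVec n) (f : ℕ → PVec n →+ ZMod 2)
    (h1 : ∀ j < c, f j (v j) ≠ 0) (h2 : ∀ j < c, ∀ i < j, f j (v i) = 0) : c ≤ 2 * n := by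
  have key : ∀ k ≤ c, k ≤ Module.finrank (ZMod 2) (Submodule.span (ZMod 2) (v '' Set.Iio k)) := by
    intro k
    induction k with
    | zero => intro _; exact Nat.zero_le _
    | succ k ih =>
      intro hk
      refine (ih (by omega)).trans_lt (Submodule.finrank_lt_finrank_of_lt ?_)
      refine lt_of_le_of_ne (Submodule.span_mono (Set.image_mono fun i hi => ?_)) fun e => ?_
      · exact Set.mem_Iio.mpr (lt_trans (Set.mem_Iio.mp hi) (Nat.lt_succ_self k))
      · have hv : v k ∈ Submodule.span (ZMod 2) (v '' Set.Iio k) := by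
          rw [e]
          exact Submodule.subset_span ⟨k, Nat.lt_succ_self k, rfl⟩
        have hle : Submodule.span (ZMod 2) (v '' Set.Iio k) ≤
            LinearMap.ker ((f k).toZModLinearMap 2) := by
          rw [Submodule.span_le]
          rintro _ ⟨i, hi, rfl⟩
          exact h2 k (by omega) i hi
        exact h1 k (by omega) (hle hv)
  refine (key c le_rfl).trans ((Submodule.finrank_le _).trans ?_)
  simp [two_mul]

/-! ### Diagonalizing circuits -/

/-- The symplectic form of two tableaux. -/
def Tableau.symp (n : ℕ) (τ τ' : Tableau) : ZMod 2 := PauliLearning.symp n τ.x τ.z τ'.x τ'.z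

/-- Conjugation preserves commutation relations; on the level of bits, the terms that a phase or
CNOT gate creates come in equal pairs, which cancel mod 2. -/
theorem Op.act_symp {n : ℕ} {g : Op} (hg : g.Ok n) (τ τ' : Tableau) :
    (g.act τ).symp n (g.act τ') = τ.symp n τ' := by
  cases g with
  | H i =>
    simp only [Tableau.symp, PauliLearning.symp]
    refine Finset.sum_congr rfl fun j _ => ?_
    simp only [Op.act, Function.update_apply]
    split_ifs with h
    · subst h; ring
    · rfl
  | S i =>
    simp only [Tableau.symp, PauliLearning.symp]
    refine Finset.sum_congr rfl fun j _ => ?_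
    simp only [Op.act, Function.update_apply]
    split_ifs with h
    · subst h
      linear_combination add_self_zmod2 (τ.x j * τ'.x j)
    · rfl
  | C c t =>
    obtain ⟨hc, ht, hct⟩ := hg
    simp only [Tableau.symp, PauliLearning.symp]
    have split : ∀ f : ℕ → ZMod 2, ∑ i ∈ Finset.range n, f i =
        f c + (f t + ∑ i ∈ ((Finset.range n).erase c).erase t, f i) := by
      intro f
      rw [Finset.add_sum_erase _ _ (by simp [ht, hct.symm]), Finset.add_sum_erase _ _ (by simp [hc])]
    rw [split, split]
    have e : ∑ i ∈ ((Finset.range n).erase c).erase t, (((Op.C c t).act τ).x i *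
        ((Op.C c t).act τ').z i + ((Op.C c t).act τ).z i * ((Op.C c t).act τ').x i) =
        ∑ i ∈ ((Finset.range n).erase c).erase t, (τ.x i * τ'.z i + τ.z i * τ'.x i) := by
      refine Finset.sum_congr rfl fun i hi => ?_
      simp only [Finset.mem_erase] at hi
      simp [Op.act, hi.1, hi.2.1]
    rw [e]
    simp only [Op.act, Function.update_self, Function.update_of_ne hct, Function.update_of_ne hct.symm]
    linear_combination add_self_zmod2 (τ.x c * τ'.z t) + add_self_zmod2 (τ.z t * τ'.x c)

theorem conjList_symp {n : ℕ} {l : List Op} (hl : ∀ g ∈ l, g.Ok n) (τ τ' : Tableau) :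
    (conjList l τ).symp n (conjList l τ') = τ.symp n τ' := by
  induction l generalizing τ τ' with
  | nil => rfl
  | cons g l ih =>
    refine (ih (fun g' hg' => hl g' (List.mem_cons_of_mem _ hg')) _ _).trans ?_
    exact Op.act_symp (hl g List.mem_cons_self) τ τ'

theorem conjList_append (l l' : List Op) (τ : Tableau) :
    conjList (l ++ l') τ = conjList l' (conjList l τ) := List.foldl_append ..

theorem conjList_singleton (g : Op) (τ : Tableau) : conjList [g] τ = g.act τ := rfl

/-- A conditional phase gate. -/
def phaseOp (b : Bool) (i : ℕ) : List Op := if b then [.S i] else []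

/-- The gates that concentrate the `X`-part of a Pauli operator with bits `gx`, `gz` on one of the
first `k` qubits; this qubit is the first component. -/
def concentrate (gx gz : ℕ → Bool) : ℕ → Option ℕ × List Op
  | 0 => (none, [])
  | i + 1 =>
    if gx i then
      match concentrate gx gz i with
      | (none, l) => (some i, l ++ phaseOp (gz i) i)
      | (some p, l) => (some p, l ++ phaseOp (gz i) i ++ [.C p i])
    else concentrate gx gz i

/-- The gates that map the Pauli operator with bits `gx`, `gz` to one without `X`-part. -/
def roundOps (n : ℕ) (gx gz : ℕ → Bool) : List Op :=
  match concentrate gx gz n with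
  | (none, l) => l
  | (some p, l) => l ++ [.H p]

/-- The circuit that is described by the first `R` rounds of `γ`. -/
def circOps (n : ℕ) (γ : ℕ → Bool) : ℕ → List Op
  | 0 => []
  | R + 1 => circOps n γ R ++
      roundOps n (fun i => γ (R * (2 * n) + 2 * i)) fun i => γ (R * (2 * n) + 2 * i + 1)

theorem concentrate_fst {gx gz : ℕ → Bool} {k p : ℕ} (h : (concentrate gx gz k).1 = some p) :
    p < k ∧ gx p = true := by
  induction k with
  | zero => simp [concentrate] at h
  | succ k ih =>
    rw [concentrate] at h
    by_cases hg : gx k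
    · rw [if_pos hg] at h
      rcases e : concentrate gx gz k with ⟨_ | p', l⟩
      · rw [e] at h
        simp only [Option.some.injEq] at h
        subst h
        exact ⟨Nat.lt_succ_self _, hg⟩
      · rw [e] at h ih
        have := ih h
        exact ⟨by omega, this.2⟩
    · rw [if_neg hg] at h
      have := ih h
      exact ⟨by omega, this.2⟩

theorem concentrate_ok {gx gz : ℕ → Bool} {n k : ℕ} (hk : k ≤ n) :
    ∀ g ∈ (concentrate gx gz k).2, g.Ok n := by
  induction k with
  | zero => simp [concentrate]
  | succ k ih =>
    have ih := ih (by omega)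
    have hS : ∀ g ∈ phaseOp (gz k) k, g.Ok n := by
      intro g hg
      rw [phaseOp] at hg
      split_ifs at hg
      · rw [List.mem_singleton] at hg; subst hg; exact hk
      · simp at hg
    rw [concentrate]
    by_cases hg : gx k
    · rw [if_pos hg]
      rcases e : concentrate gx gz k with ⟨_ | p, l⟩
      · rw [e] at ih
        intro g hg
        rcases List.mem_append.mp hg with h | h
        · exact ih g h
        · exact hS g h
      · have hp := (concentrate_fst (show (concentrate gx gz k).1 = some p by rw [e])).1
        rw [e] at ih
        intro g hg
        rcases List.mem_append.mp hg with h | h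
        · rcases List.mem_append.mp h with h | h
          · exact ih g h
          · exact hS g h
        · rw [List.mem_singleton] at h; subst h
          exact ⟨by omega, by omega, by omega⟩
    · rw [if_neg hg]; exact ih

theorem roundOps_ok (n : ℕ) (gx gz : ℕ → Bool) : ∀ g ∈ roundOps n gx gz, g.Ok n := by
  have h := concentrate_ok (gx := gx) (gz := gz) (le_refl n)
  rw [roundOps]
  rcases e : concentrate gx gz n with ⟨_ | p, l⟩
  · rw [e] at h; exact h
  · have hp := (concentrate_fst (show (concentrate gx gz n).1 = some p by rw [e])).1
    rw [e] at h
    intro g hg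
    rcases List.mem_append.mp hg with h' | h'
    · exact h g h'
    · rw [List.mem_singleton] at h'; subst h'; exact hp

theorem circOps_ok (n : ℕ) (γ : ℕ → Bool) (R : ℕ) : ∀ g ∈ circOps n γ R, g.Ok n := by
  induction R with
  | zero => simp [circOps]
  | succ R ih =>
    intro g hg
    rcases List.mem_append.mp hg with h | h
    · exact ih g h
    · exact roundOps_ok n _ _ g h

theorem Op.Ok.mono {n m : ℕ} (h : n ≤ m) {g : Op} (hg : g.Ok n) : g.Ok m := by
  cases g with
  | H i => exact lt_of_lt_of_le hg h
  | S i => exact lt_of_lt_of_le hg h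
  | C i j => exact ⟨hg.1.trans_le h, hg.2.1.trans_le h, hg.2.2⟩

theorem concentrate_congr {gx gz gx' gz' : ℕ → Bool} {k : ℕ} (hx : ∀ i < k, gx i = gx' i)
    (hz : ∀ i < k, gz i = gz' i) : concentrate gx gz k = concentrate gx' gz' k := by
  induction k with
  | zero => rfl
  | succ k ih =>
    rw [concentrate, concentrate, ih (fun i hi => hx i (by omega)) (fun i hi => hz i (by omega)),
      hx k (by omega), hz k (by omega)]

theorem roundOps_congr {n : ℕ} {gx gz gx' gz' : ℕ → Bool} (hx : ∀ i < n, gx i = gx' i)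
    (hz : ∀ i < n, gz i = gz' i) : roundOps n gx gz = roundOps n gx' gz' := by
  rw [roundOps, roundOps, concentrate_congr hx hz]

theorem concentrate_false {gx gz : ℕ → Bool} {k : ℕ} (h : ∀ i < k, gx i = false) :
    concentrate gx gz k = (none, []) := by
  induction k with
  | zero => rfl
  | succ k ih => rw [concentrate, h k (by omega), ih fun i hi => h i (by omega)]; rfl

theorem roundOps_false {n : ℕ} {gx gz : ℕ → Bool} (h : ∀ i < n, gx i = false) :
    roundOps n gx gz = [] := by
  rw [roundOps, concentrate_false h]

theorem circOps_congr {n : ℕ} {γ γ' : ℕ → Bool} {R : ℕ} (h : ∀ k < R * (2 * n), γ k = γ' k) :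
    circOps n γ R = circOps n γ' R := by
  induction R with
  | zero => rfl
  | succ R ih =>
    have hR : (R + 1) * (2 * n) = R * (2 * n) + 2 * n := by ring
    rw [circOps, circOps, ih fun k hk => h k (by omega)]
    congr 1
    exact roundOps_congr (fun i hi => h _ (by omega)) fun i hi => h _ (by omega)

theorem circOps_of_false {n : ℕ} {γ : ℕ → Bool} {c R : ℕ} (hcR : c ≤ R)
    (h : ∀ k, c * (2 * n) ≤ k → γ k = false) : circOps n γ R = circOps n γ c := by
  induction R, hcR using Nat.le_induction with
  | base => rfl
  | succ R hR ih =>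
    rw [circOps, ih, roundOps_false, List.append_nil]
    intro i _
    have := Nat.mul_le_mul_right (2 * n) hR
    exact h _ (by omega)

theorem zmod2_ne_zero {a : ZMod 2} (h : a ≠ 0) : a = 1 := (ZMod.two_cases a).resolve_left h

/-- The bits that describe a Pauli operator. -/
def Tableau.bx (τ : Tableau) (i : ℕ) : Bool := decide (τ.x i ≠ 0)

def Tableau.bz (τ : Tableau) (i : ℕ) : Bool := decide (τ.z i ≠ 0)

/-- The invariant of the elimination, applied to `g` itself. A phase gate turns each Y into X up to
sign, the first X met becomes the pivot, and a CNOT from the pivot removes each later one. The Z-bit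
of the pivot stays 0, because only Z-bits that were just cleared are added to it. -/
theorem concentrate_self (g : Tableau) (k : ℕ) :
    (∀ i, k ≤ i → (conjList (concentrate g.bx g.bz k).2 g).x i = g.x i ∧
      (conjList (concentrate g.bx g.bz k).2 g).z i = g.z i) ∧
    ∀ i < k, ((conjList (concentrate g.bx g.bz k).2 g).x i =
        if (concentrate g.bx g.bz k).1 = some i then 1 else 0) ∧
      (g.x i ≠ 0 → (conjList (concentrate g.bx g.bz k).2 g).z i = 0) := by
  induction k with
  | zero => simp [concentrate, conjList]
  | succ k ih =>
    obtain ⟨ih1, ih2⟩ := ih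
    rw [concentrate]
    by_cases hg : g.bx k
    · have hx : g.x k = 1 := zmod2_ne_zero (by simpa [Tableau.bx] using hg)
      rw [if_pos hg]
      rcases e : concentrate g.bx g.bz k with ⟨_ | p, l⟩
      · rw [e] at ih1 ih2
        simp only [conjList_append] at *
        set g' := conjList l g
        -- As the X-bit of qubit `k` is 1, the conditional phase gate clears the Z-bit in either
        -- case.
        have hS : conjList (phaseOp (g.bz k) k) g' =
            ⟨g'.x, Function.update g'.z k 0, (conjList (phaseOp (g.bz k) k) g').s⟩ := by
          by_cases hz : g.bz k
          · have hz1 : g.z k = 1 := zmod2_ne_zero (by simpa [Tableau.bz] using hz)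
            have := ih1 k le_rfl
            simp [phaseOp, hz, conjList, Op.act, this.1, this.2, hx, hz1, add_self_zmod2 1]
          · have hz1 : g'.z k = 0 := by
              rw [(ih1 k le_rfl).2]; simpa [Tableau.bz] using hz
            simp [phaseOp, hz, conjList, ← hz1]
        rw [hS]
        refine ⟨fun i hi => ?_, fun i hi => ?_⟩
        · simp only [Function.update_of_ne (show i ≠ k by omega)]
          exact ih1 i (by omega)
        · by_cases hik : i = k
          · subst hik
            simp [(ih1 i le_rfl).1, hx]
          · simp only [Function.update_of_ne hik]
            have := ih2 i (by omega)
            refine ⟨?_, fun h => ?_⟩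
            · rw [this.1]
              simp [Ne.symm hik]
            · exact this.2 h
      · have hp := concentrate_fst (show (concentrate g.bx g.bz k).1 = some p by rw [e])
        rw [e] at ih1 ih2
        simp only [conjList_append] at *
        set g' := conjList l g
        have hS : conjList (phaseOp (g.bz k) k) g' =
            ⟨g'.x, Function.update g'.z k 0, (conjList (phaseOp (g.bz k) k) g').s⟩ := by
          by_cases hz : g.bz k
          · have hz1 : g.z k = 1 := zmod2_ne_zero (by simpa [Tableau.bz] using hz)
            have := ih1 k le_rfl
            simp [phaseOp, hz, conjList, Op.act, this.1, this.2, hx, hz1, add_self_zmod2 1]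
          · have hz1 : g'.z k = 0 := by
              rw [(ih1 k le_rfl).2]; simpa [Tableau.bz] using hz
            simp [phaseOp, hz, conjList, ← hz1]
        rw [hS]
        have hpk : p ≠ k := by omega
        have hpx : g'.x p = 1 := by simpa using (ih2 p hp.1).1
        have hpz : g'.z p = 0 := (ih2 p hp.1).2 (by simpa [Tableau.bx] using hp.2)
        simp only [conjList_singleton, Op.act, Function.update_self,
          Function.update_of_ne hpk, hpx, hpz, (ih1 k le_rfl).1, hx]
        refine ⟨fun i hi => ?_, fun i hi => ?_⟩
        · simp only [Function.update_of_ne (show i ≠ k by omega),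
            Function.update_of_ne (show i ≠ p by omega)]
          exact ih1 i (by omega)
        · by_cases hik : i = k
          · subst hik
            simp [hpk, hpk.symm, add_self_zmod2 1]
          · simp only [Function.update_of_ne hik]
            have := ih2 i (by omega)
            refine ⟨this.1, fun h => ?_⟩
            by_cases hip : i = p
            · subst hip; simp
            · rw [Function.update_of_ne hip, Function.update_of_ne hik]; exact this.2 h
    · rw [if_neg hg]
      refine ⟨fun i hi => ih1 i (by omega), fun i hi => ?_⟩
      by_cases hik : i = k
      · subst hik
        have h0 : g.x i = 0 := by simpa [Tableau.bx] using hg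
        rw [(ih1 i le_rfl).1, h0]
        refine ⟨?_, fun h => absurd rfl h⟩
        rw [if_neg]
        intro h
        have := (concentrate_fst h).1
        omega
      · exact ih2 i (by omega)

/-- Phase and CNOT gates never make an X-bit out of Z-bits. -/
theorem concentrate_diag {n k : ℕ} (hk : k ≤ n) (gx gz : ℕ → Bool) {τ : Tableau}
    (h : ∀ i < n, τ.x i = 0) : ∀ i < n, (conjList (concentrate gx gz k).2 τ).x i = 0 := by
  induction k with
  | zero => exact h
  | succ k ih =>
    have ih := ih (by omega)
    have hS : ∀ τ' : Tableau, (conjList (phaseOp (gz k) k) τ').x = τ'.x := fun τ' => by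
      rw [phaseOp]; split_ifs <;> simp [conjList, Op.act]
    rw [concentrate]
    by_cases hg : gx k
    · rw [if_pos hg]
      rcases e : concentrate gx gz k with ⟨_ | p, l⟩
      · rw [e] at ih
        simp only [conjList_append, hS]
        exact ih
      · have hp := (concentrate_fst (show (concentrate gx gz k).1 = some p by rw [e])).1
        rw [e] at ih
        simp only [conjList_append]
        intro i hi
        simp only [conjList_singleton, Op.act, hS, Function.update_apply]
        split_ifs
        · rw [ih k (by omega), ih p (by omega), add_zero]
        · exact ih i hi
    · rw [if_neg hg]; exact ih

/-- Concentration leaves a single X-bit, at the pivot, where the Z-bit is 0; the Hadamard gate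
exchanges the two. -/
theorem roundOps_self {n : ℕ} (g : Tableau) : ∀ i < n, (conjList (roundOps n g.bx g.bz) g).x i = 0 := by
  obtain ⟨-, h⟩ := concentrate_self g n
  rw [roundOps]
  rcases e : concentrate g.bx g.bz n with ⟨_ | p, l⟩
  · rw [e] at h
    intro i hi
    simpa using (h i hi).1
  · have hp := concentrate_fst (show (concentrate g.bx g.bz n).1 = some p by rw [e])
    rw [e] at h
    intro i hi
    simp only [conjList_append]
    simp only [conjList_singleton, Op.act, Function.update_apply]
    split_ifs with hip
    · exact (h p hp.1).2 (by simpa [Tableau.bx] using hp.2)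
    · rw [(h i hi).1, if_neg]
      simp only [Option.some.injEq]
      exact fun h => hip h.symm

/-- A new round does not spoil what is already diagonal. Only the final Hadamard gate could create
an X-bit, namely the Z-bit at the pivot of the image of `τ`. The image of `g` has its only X-bit
there and that of `τ` has none, so this Z-bit is their symplectic form, which is invariant and hence
0. -/
theorem roundOps_diag {n : ℕ} (g τ : Tableau) (h : ∀ i < n, τ.x i = 0) (hc : g.symp n τ = 0) :
    ∀ i < n, (conjList (roundOps n g.bx g.bz) τ).x i = 0 := by
  obtain ⟨-, h1⟩ := concentrate_self g n
  have h2 := concentrate_diag le_rfl g.bx g.bz h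
  have hok := concentrate_ok (gx := g.bx) (gz := g.bz) (le_refl n)
  rw [roundOps]
  rcases e : concentrate g.bx g.bz n with ⟨_ | p, l⟩
  · rw [e] at h2; exact h2
  · have hp := (concentrate_fst (show (concentrate g.bx g.bz n).1 = some p by rw [e])).1
    rw [e] at h1 h2 hok
    rw [← conjList_symp hok] at hc
    have : (conjList l τ).z p = 0 := by
      rw [← hc, Tableau.symp, symp, Finset.sum_eq_single_of_mem p (Finset.mem_range.mpr hp)]
      · rw [(h1 p hp).1, h2 p hp]; simp
      · intro i hi hip
        have hi := Finset.mem_range.mp hi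
        rw [(h1 i hi).1, h2 i hi]
        simp [hip.symm]
    intro i hi
    simp only [conjList_append]
    simp only [conjList_singleton, Op.act, Function.update_apply]
    split_ifs
    · exact this
    · exact h2 i hi

/-! ### Construction of a diagonalizing circuit -/

/-- The members of `T` commute. -/
def Commuting (n : ℕ) (T : ℕ → Bool) : Prop :=
  ∀ q < 4 ^ n, ∀ q' < 4 ^ n, T q → T q' → sympQ n q q' = 0

/-- The Pauli operator with number `q` becomes diagonal under the circuit of `γ`. -/
def DiagBy (n : ℕ) (γ : ℕ → Bool) (q : ℕ) : Prop :=
  ∀ i < n, (conjList (circOps n γ (2 * n)) (tabOf q)).x i = 0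

/-- `γ` has `c` rounds, and these diagonalize the members of `T` with numbers less than `k`. -/
structure BasisInv (n : ℕ) (T : ℕ → Bool) (k : ℕ) (γ : ℕ → Bool) (c : ℕ) : Prop where
  zero : ∀ j, c * (2 * n) ≤ j → γ j = false
  diag : ∀ q < k, T q → DiagBy n γ q
  indep : ∃ (v : ℕ → PVec n) (f : ℕ → PVec n →+ ZMod 2), (∀ j < c, f j (v j) ≠ 0) ∧
    (∀ j < c, ∀ i < j, f j (v i) = 0) ∧ ∀ j < c, ∃ q < k, T q = true ∧ v j = vecOf n q

theorem BasisInv.init (n : ℕ) (T : ℕ → Bool) : BasisInv n T 0 (fun _ => false) 0 :=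
  ⟨fun _ _ => rfl, fun q hq => absurd hq (Nat.not_lt_zero q),
    fun _ => 0, fun _ => 0, by simp, by simp, by simp⟩

theorem BasisInv.skip {n : ℕ} {T : ℕ → Bool} {k : ℕ} {γ : ℕ → Bool} {c : ℕ}
    (h : BasisInv n T k γ c) (hk : T k → DiagBy n γ k) : BasisInv n T (k + 1) γ c := by
  refine ⟨h.zero, fun q hq hT => ?_, ?_⟩
  · rcases Nat.lt_succ_iff_lt_or_eq.mp hq with h' | rfl
    · exact h.diag q h' hT
    · exact hk hT
  · obtain ⟨v, f, h1, h2, h3⟩ := h.indep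
    exact ⟨v, f, h1, h2, fun j hj => by
      obtain ⟨q, hq, h⟩ := h3 j hj; exact ⟨q, by omega, h⟩⟩

/-- An operator that is not yet diagonalized is independent of those that contributed the earlier
rounds: the X-bit `i₀` after the current circuit vanishes on them but not on it. Earlier members of
`T` stay diagonal because they commute with operator `k`. -/
theorem BasisInv.push {n : ℕ} {T : ℕ → Bool} {k : ℕ} {γ γ' : ℕ → Bool} {c : ℕ} {τ : Tableau}
    (h : BasisInv n T k γ c) (hT : Commuting n T) (hk : k < 4 ^ n) (hTk : T k = true)
    (hτ : τ = conjList (circOps n γ (2 * n)) (tabOf k)) {i₀ : ℕ} (hi₀ : i₀ < n) (hx : τ.x i₀ ≠ 0)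
    (hγ : ∀ j < c * (2 * n), γ' j = γ j) (hγ' : ∀ j, (c + 1) * (2 * n) ≤ j → γ' j = false)
    (hx' : c + 1 ≤ 2 * n → ∀ i < n, γ' (c * (2 * n) + 2 * i) = τ.bx i)
    (hz' : c + 1 ≤ 2 * n → ∀ i < n, γ' (c * (2 * n) + 2 * i + 1) = τ.bz i) : BasisInv n T (k + 1) γ' (c + 1) := by
  obtain ⟨v, f, h1, h2, h3⟩ := h.indep
  have indep : ∃ (v : ℕ → PVec n) (f : ℕ → PVec n →+ ZMod 2), (∀ j < c + 1, f j (v j) ≠ 0) ∧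
      (∀ j < c + 1, ∀ i < j, f j (v i) = 0) ∧
      ∀ j < c + 1, ∃ q < k + 1, T q = true ∧ v j = vecOf n q := by
    refine ⟨Function.update v c (vecOf n k),
      Function.update f c (conjBit n (circOps n γ (2 * n)) i₀), fun j hj => ?_, fun j hj i hi => ?_,
      fun j hj => ?_⟩
    · rcases Nat.lt_succ_iff_lt_or_eq.mp hj with h' | rfl
      · rw [Function.update_of_ne h'.ne, Function.update_of_ne h'.ne]; exact h1 j h'
      · rw [Function.update_self, Function.update_self]
        change (conjList _ (vecOf n k).tab).x i₀ ≠ 0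
        rw [vecOf_tab hk, ← hτ]; exact hx
    · rw [Function.update_of_ne (show i ≠ c by omega)]
      rcases Nat.lt_succ_iff_lt_or_eq.mp hj with h' | rfl
      · rw [Function.update_of_ne h'.ne]; exact h2 j h' i hi
      · rw [Function.update_self]
        obtain ⟨q, hq, hTq, e⟩ := h3 i hi
        rw [e]
        change (conjList _ (vecOf n q).tab).x i₀ = 0
        rw [vecOf_tab (hq.trans hk)]
        exact h.diag q hq hTq i₀ hi₀
    · rcases Nat.lt_succ_iff_lt_or_eq.mp hj with h' | rfl
      · rw [Function.update_of_ne h'.ne]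
        obtain ⟨q, hq, h⟩ := h3 j h'
        exact ⟨q, by omega, h⟩
      · rw [Function.update_self]
        exact ⟨k, Nat.lt_succ_self k, hTk, rfl⟩
  refine ⟨hγ', ?_, indep⟩
  obtain ⟨v, f, h1, h2, -⟩ := indep
  -- Independence, with the new operator included, shows that there is room for another round; only
  -- then do `hx'` and `hz'` apply.
  have hc := triangular_le v f h1 h2
  have e1 : circOps n γ' (2 * n) = circOps n γ (2 * n) ++ roundOps n τ.bx τ.bz := by
    rw [circOps_of_false hc hγ', circOps, circOps_congr hγ,
      circOps_of_false (by omega : c ≤ 2 * n) h.zero, roundOps_congr (hx' hc) (hz' hc)]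
  intro q hq hTq
  rw [DiagBy, e1]
  simp only [conjList_append]
  rcases Nat.lt_succ_iff_lt_or_eq.mp hq with h' | rfl
  · refine roundOps_diag τ _ (h.diag q h' hTq) ?_
    rw [hτ, conjList_symp (circOps_ok n γ _)]
    exact hT k hk q (h'.trans hk) hTk hTq
  · rw [← hτ]
    exact roundOps_self τ

/-! ### Covering by commuting families -/

/-- The last `q < k` in `T` that anticommutes with a member of `T`. -/
def findAnti (n : ℕ) (T : ℕ → Bool) : ℕ → Option ℕ
  | 0 => none
  | q + 1 => if T q ∧ ∃ q' < 4 ^ n, T q' ∧ sympQ n q q' ≠ 0 then some q else findAnti n T q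

/-- Restrict `T` to the operators that have the same commutation relation with the operator found
by `findAnti`. -/
def refine (n : ℕ) (T : ℕ → Bool) (mk : Bool) : ℕ → Bool :=
  match findAnti n T (4 ^ n) with
  | none => T
  | some P => fun q => T q && decide (decide (sympQ n P q ≠ 0) = mk)

def refineSeq (n : ℕ) (T : ℕ → Bool) (marks : ℕ → Bool) : ℕ → ℕ → Bool
  | 0 => T
  | s + 1 => refine n (refineSeq n T marks s) (marks s)

theorem findAnti_some {n : ℕ} {T : ℕ → Bool} {k P : ℕ} (h : findAnti n T k = some P) :
    P < k ∧ T P = true ∧ ∃ q' < 4 ^ n, T q' = true ∧ sympQ n P q' ≠ 0 := by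
  induction k with
  | zero => simp [findAnti] at h
  | succ k ih =>
    rw [findAnti] at h
    split_ifs at h with hc
    · simp only [Option.some.injEq] at h
      subst h
      exact ⟨Nat.lt_succ_self _, hc⟩
    · have := ih h
      exact ⟨by omega, this.2⟩

theorem findAnti_none {n : ℕ} {T : ℕ → Bool} {k : ℕ} (h : findAnti n T k = none) :
    ∀ q < k, T q → ∀ q' < 4 ^ n, T q' → sympQ n q q' = 0 := by
  induction k with
  | zero => exact fun q hq => absurd hq (Nat.not_lt_zero q)
  | succ k ih =>
    rw [findAnti] at h
    split_ifs at h with hc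
    intro q hq hT q' hq' hT'
    rcases Nat.lt_succ_iff_lt_or_eq.mp hq with h' | rfl
    · exact ih h q h' hT q' hq' hT'
    · by_contra hne
      exact hc ⟨hT, q', hq', hT', hne⟩

/-- The marks that keep `q₀`. -/
def pathSet (n : ℕ) (T : ℕ → Bool) (q₀ : ℕ) : ℕ → ℕ → Bool
  | 0 => T
  | s + 1 => refine n (pathSet n T q₀ s)
      (match findAnti n (pathSet n T q₀ s) (4 ^ n) with
        | none => false
        | some P => decide (sympQ n P q₀ ≠ 0))

theorem eq_of_ne_zero_iff {a b : ZMod 2} (h : decide (a ≠ 0) = decide (b ≠ 0)) : a = b := by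
  revert a b; decide

section

variable {n : ℕ} {T : ℕ → Bool} {q₀ : ℕ}

theorem pathSet_succ_of_some {s P : ℕ} (h : findAnti n (pathSet n T q₀ s) (4 ^ n) = some P) (q : ℕ) :
    pathSet n T q₀ (s + 1) q = true ↔ pathSet n T q₀ s q = true ∧ sympQ n P q = sympQ n P q₀ := by
  rw [pathSet, refine, h]
  simp only [Bool.and_eq_true, decide_eq_true_eq]
  refine and_congr_right fun _ => ⟨fun h => eq_of_ne_zero_iff h, fun h => by rw [h]⟩

theorem pathSet_succ_of_none {s : ℕ} (h : findAnti n (pathSet n T q₀ s) (4 ^ n) = none) :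
    pathSet n T q₀ (s + 1) = pathSet n T q₀ s := by
  rw [pathSet, refine, h]

theorem pathSet_anti {s s' : ℕ} (h : s ≤ s') {q : ℕ} (hq : pathSet n T q₀ s' q = true) :
    pathSet n T q₀ s q = true := by
  induction s', h using Nat.le_induction with
  | base => exact hq
  | succ s' _ ih =>
    cases e : findAnti n (pathSet n T q₀ s') (4 ^ n) with
    | none => rw [pathSet_succ_of_none e] at hq; exact ih hq
    | some P => exact ih ((pathSet_succ_of_some e q).mp hq).1

theorem mem_pathSet (h : T q₀ = true) (s : ℕ) : pathSet n T q₀ s q₀ = true := by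
  induction s with
  | zero => exact h
  | succ s ih =>
    cases e : findAnti n (pathSet n T q₀ s) (4 ^ n) with
    | none => rw [pathSet_succ_of_none e]; exact ih
    | some P => exact (pathSet_succ_of_some e q₀).mpr ⟨ih, rfl⟩

theorem pathSet_symp {s s' P q : ℕ} (h : s < s')
    (hP : findAnti n (pathSet n T q₀ s) (4 ^ n) = some P) (hq : pathSet n T q₀ s' q = true) :
    sympQ n P q = sympQ n P q₀ :=
  ((pathSet_succ_of_some hP q).mp (pathSet_anti h hq)).2

/-- Suppose that 2n + 1 searches find operators `P s` with anticommuting partners `Q s`. For i < s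
both have survived step i, so they relate to `P i` as `q₀` does, and the functional ⟨·, Q s + P s⟩
vanishes on `P i`. It is nonzero on `P s`, which commutes with itself. This contradicts
`triangular_le`. -/
theorem exists_findAnti_none (n : ℕ) (T : ℕ → Bool) (q₀ : ℕ) :
    ∃ s ≤ 2 * n, findAnti n (pathSet n T q₀ s) (4 ^ n) = none := by
  by_contra hcon
  push Not at hcon
  have : ∀ s, ∃ P, s ≤ 2 * n → findAnti n (pathSet n T q₀ s) (4 ^ n) = some P := by
    intro s
    by_cases hs : s ≤ 2 * n
    · obtain ⟨P, hP⟩ := Option.ne_none_iff_exists'.mp (hcon s hs)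
      exact ⟨P, fun _ => hP⟩
    · exact ⟨0, fun h => absurd h hs⟩
  choose P hP using this
  have : ∀ s, ∃ Q, s ≤ 2 * n →
      Q < 4 ^ n ∧ pathSet n T q₀ s Q = true ∧ sympQ n (P s) Q ≠ 0 := by
    intro s
    by_cases hs : s ≤ 2 * n
    · obtain ⟨Q, hQ⟩ := (findAnti_some (hP s hs)).2.2
      exact ⟨Q, fun _ => hQ⟩
    · exact ⟨0, fun h => absurd h hs⟩
  choose Q hQ using this
  have hPlt : ∀ s ≤ 2 * n, P s < 4 ^ n := fun s hs => (findAnti_some (hP s hs)).1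
  have hval : ∀ i ≤ 2 * n, ∀ s, (sympHom n (qx (Q s)) (qz (Q s)) + sympHom n (qx (P s)) (qz (P s)))
      (vecOf n (P i)) = sympQ n (P i) (Q s) + sympQ n (P i) (P s) := by
    intro i hi s
    change symp n (vecOf n (P i)).tab.x (vecOf n (P i)).tab.z _ _ +
      symp n (vecOf n (P i)).tab.x (vecOf n (P i)).tab.z _ _ = _
    rw [vecOf_tab (hPlt i hi)]
    rfl
  have := triangular_le (c := 2 * n + 1) (fun s => vecOf n (P s))
    (fun s => sympHom n (qx (Q s)) (qz (Q s)) + sympHom n (qx (P s)) (qz (P s)))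
    (fun s hs => by
      rw [hval s (by omega), show sympQ n (P s) (P s) = 0 from symp_self _ _ _, add_zero]
      exact (hQ s (by omega)).2.2)
    (fun s hs i hi => by
      rw [hval i (by omega), pathSet_symp hi (hP i (by omega)) (hQ s (by omega)).2.1,
        pathSet_symp hi (hP i (by omega)) (findAnti_some (hP s (by omega))).2.1]
      exact add_self_zmod2 _)
  omega

/-- Once a search fails the set no longer changes, and a failed search means that the set commutes.
-/
theorem pathSet_commuting (n : ℕ) (T : ℕ → Bool) (q₀ : ℕ) : Commuting n (pathSet n T q₀ (2 * n)) := by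
  obtain ⟨s, hs, h⟩ := exists_findAnti_none n T q₀
  have : ∀ s' ≥ s, pathSet n T q₀ s' = pathSet n T q₀ s := by
    intro s' hs'
    induction s', hs' using Nat.le_induction with
    | base => rfl
    | succ s' _ ih => rw [pathSet_succ_of_none (by rw [ih]; exact h), ih]
  rw [this _ hs]
  intro q hq q' hq' hT hT'
  exact findAnti_none h q hq hT q' hq' hT'

/-- Every member of `T` lies in a commuting family that is specified by few marks, if there are no
large anticommuting sets. -/
theorem exists_marks {K : ℕ} (hK : ∀ S : Finset ℕ, (∀ q ∈ S, q < 4 ^ n ∧ T q = true) →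
      (∀ q ∈ S, ∀ q' ∈ S, q ≠ q' → sympQ n q q' ≠ 0) → S.card ≤ K) (h₀ : T q₀ = true) :
    ∃ I : Finset ℕ, I.card ≤ K ∧ (∀ s ∈ I, s < 2 * n) ∧
      ∀ marks : ℕ → Bool, (∀ s < 2 * n, marks s = decide (s ∈ I)) →
        refineSeq n T marks (2 * n) q₀ = true ∧ Commuting n (refineSeq n T marks (2 * n)) := by
  classical
  -- The marked steps are those at which `q₀` anticommutes with the operator found.
  let I := (Finset.range (2 * n)).filter fun s =>
    ∃ P, findAnti n (pathSet n T q₀ s) (4 ^ n) = some P ∧ sympQ n P q₀ ≠ 0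
  have hI : ∀ s ∈ I, ∃ P, findAnti n (pathSet n T q₀ s) (4 ^ n) = some P ∧ sympQ n P q₀ ≠ 0 :=
    fun s hs => (Finset.mem_filter.mp hs).2
  choose! P hP using hI
  -- `P s'` has survived step `s`, so it relates to `P s` as `q₀` does: it anticommutes. The
  -- operators found at marked steps thus form an anticommuting subset of `T`, to which `hK`
  -- applies.
  have hanti : ∀ s ∈ I, ∀ s' ∈ I, s < s' → sympQ n (P s) (P s') ≠ 0 := by
    intro s hs s' hs' hlt
    rw [pathSet_symp hlt (hP s hs).1 (findAnti_some (hP s' hs').1).2.1]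
    exact (hP s hs).2
  have hne : ∀ s ∈ I, ∀ s' ∈ I, s ≠ s' → sympQ n (P s) (P s') ≠ 0 := by
    intro s hs s' hs' hne
    rcases lt_or_gt_of_ne hne with h | h
    · exact hanti s hs s' hs' h
    · rw [sympQ, symp_comm]; exact hanti s' hs' s hs h
  refine ⟨I, ?_, fun s hs => Finset.mem_range.mp (Finset.mem_filter.mp hs).1, fun marks hm => ?_⟩
  · rw [← Finset.card_image_of_injOn (f := P) (s := I)]
    · refine hK _ (fun q hq => ?_) fun q hq q' hq' hqq => ?_
      · obtain ⟨s, hs, rfl⟩ := Finset.mem_image.mp hq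
        have := findAnti_some (hP s hs).1
        exact ⟨this.1, pathSet_anti (Nat.zero_le s) this.2.1⟩
      · obtain ⟨s, hs, rfl⟩ := Finset.mem_image.mp hq
        obtain ⟨s', hs', rfl⟩ := Finset.mem_image.mp hq'
        exact hne s hs s' hs' fun e => hqq (by rw [e])
    · intro s hs s' hs' e
      by_contra h
      have := hne s hs s' hs' h
      rw [e] at this
      exact this (symp_self _ _ _)
  · have : ∀ s ≤ 2 * n, refineSeq n T marks s = pathSet n T q₀ s := by
      intro s
      induction s with
      | zero => intro _; rfl
      | succ s ih =>
        intro hs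
        rw [refineSeq, pathSet, ih (by omega)]
        cases e : findAnti n (pathSet n T q₀ s) (4 ^ n) with
        | none => simp only [refine, e]
        | some P =>
          congr 1
          rw [hm s (by omega)]
          refine decide_eq_decide.mpr ?_
          simp only [I, Finset.mem_filter, Finset.mem_range, show s < 2 * n by omega, true_and, e,
            Option.some.injEq, exists_eq_left']
    rw [this _ le_rfl]
    exact ⟨mem_pathSet h₀ _, pathSet_commuting n T q₀⟩

end

/-- The marks that are encoded by the digits of `j` to the base `2 n + 1`. -/
def marksOf (n K j s : ℕ) : Bool := decide (∃ i < K, j / (2 * n + 1) ^ i % (2 * n + 1) = s)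

/-- The elements of `I` are listed and padded to `K` digits by `2 * n`, which is not the number of
any step and so marks nothing. -/
theorem exists_marksOf {n K : ℕ} (I : Finset ℕ) (hI : I.card ≤ K) (hI' : ∀ s ∈ I, s < 2 * n) :
    ∃ j < (2 * n + 1) ^ K, ∀ s < 2 * n, marksOf n K j s = decide (s ∈ I) := by
  have hd : ∀ i, I.toList.getD i (2 * n) < 2 * n + 1 := by
    intro i
    by_cases h : i < I.toList.length
    · rw [List.getD_eq_getElem _ _ h]
      have := hI' _ (Finset.mem_toList.mp (List.getElem_mem h))
      omega
    · rw [List.getD_eq_default _ _ (not_lt.mp h)]; omega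
  obtain ⟨j, hj, h⟩ := exists_digits (2 * n + 1) K (fun i => I.toList.getD i (2 * n)) hd
  refine ⟨j, hj, fun s hs => decide_eq_decide.mpr ⟨?_, fun hsI => ?_⟩⟩
  · rintro ⟨i, hi, e⟩
    rw [h i hi] at e
    by_cases hl : i < I.toList.length
    · rw [List.getD_eq_getElem _ _ hl] at e
      rw [← e]
      exact Finset.mem_toList.mp (List.getElem_mem hl)
    · rw [List.getD_eq_default _ _ (not_lt.mp hl)] at e
      omega
  · obtain ⟨i, hi, e⟩ := List.getElem_of_mem (Finset.mem_toList.mpr hsI)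
    have hiK : i < K := by rw [Finset.length_toList] at hi; omega
    refine ⟨i, hiK, ?_⟩
    rw [h i hiK, List.getD_eq_getElem _ _ hi, e]

end PauliLearning

/-! ### An exponential supermartingale for adaptive measurements. -/

namespace PauliLearning
open scoped ENNReal

/-! ### Concentration of adaptive measurements -/

/-- For |y| ≤ 1 one has exp y ≤ 1 + y + y², and the linear term averages to 0. -/
theorem sum_mul_exp_le {ι : Type*} (s : Finset ι) (w y : ι → ℝ) {v : ℝ} (hw : ∀ i ∈ s, 0 ≤ w i)
    (hw1 : ∑ i ∈ s, w i = 1) (hy : ∀ i ∈ s, |y i| ≤ 1) (hv : ∀ i ∈ s, y i ^ 2 ≤ v)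
    (h0 : ∑ i ∈ s, w i * y i = 0) : ∑ i ∈ s, w i * Real.exp (y i) ≤ Real.exp v := by
  calc ∑ i ∈ s, w i * Real.exp (y i) ≤ ∑ i ∈ s, (w i * (1 + v) + w i * y i) := by
        refine Finset.sum_le_sum fun i hi => ?_
        rw [← mul_add]
        refine mul_le_mul_of_nonneg_left ?_ (hw i hi)
        have := (abs_le.mp (Real.abs_exp_sub_one_sub_id_le (hy i hi))).2
        have := hv i hi
        linarith
    _ = 1 + v := by rw [Finset.sum_add_distrib, ← Finset.sum_mul, hw1, h0, one_mul, add_zero]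
    _ ≤ Real.exp v := by linarith [Real.add_one_le_exp v]

/-- The circuit turns the observable `A` into a diagonal one with entries in `[-1, 1]`. -/
def Diagonalizes {m : ℕ} (circ : List (Gate m)) (A : QMat m) : Prop :=
  ∃ d : (Fin m → Bool) → ℝ, (∀ z, |d z| ≤ 1) ∧
    (circuitUnitary circ : QMat m) * A * star (circuitUnitary circ : QMat m) =
      Matrix.diagonal fun z => (d z : ℂ)

open Classical in
/-- The deviation of a measured value of `A` from its mean. -/
noncomputable def deviation {m : ℕ} (σ : DensityMatrix m) (circ : List (Gate m)) (A : QMat m)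
    (z : Fin m → Bool) : ℝ :=
  if h : Diagonalizes circ A then h.choose z - ((σ.mat * A).trace).re else 0

/-- The choice of `d` in `deviation` does not matter: the conjugated operator determines its
diagonal. -/
theorem deviation_eq {m : ℕ} (σ : DensityMatrix m) {circ : List (Gate m)} {A : QMat m}
    (d : (Fin m → Bool) → ℝ) (hd : ∀ z, |d z| ≤ 1)
    (h : (circuitUnitary circ : QMat m) * A * star (circuitUnitary circ : QMat m) =
      Matrix.diagonal fun z => (d z : ℂ)) (z : Fin m → Bool) :
    deviation σ circ A z = d z - ((σ.mat * A).trace).re := by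
  have hex : Diagonalizes circ A := ⟨d, hd, h⟩
  rw [deviation, dif_pos hex]
  have := h.symm.trans hex.choose_spec.2
  have := congrFun (Matrix.diagonal_injective this) z
  rw [← Complex.ofReal_injective this]

theorem born_sum_toReal {m : ℕ} (σ : DensityMatrix m) (U : Matrix.unitaryGroup (Fin m → Bool) ℂ) :
    ∑ z, (born σ U z).toReal = 1 := by
  rw [← ENNReal.toReal_sum fun z _ => (born σ U).apply_ne_top z, ← tsum_fintype (L := .unconditional _),
    (born σ U).tsum_coe, ENNReal.toReal_one]

/-- The mean is 0 for every circuit, because one that does not diagonalize `A` has deviation 0 by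
convention. This allows a fixed family of observables to be tested against adaptively chosen
circuits. -/
theorem deviation_mean {m : ℕ} (σ : DensityMatrix m) (circ : List (Gate m)) (A : QMat m) :
    ∑ z, (born σ (circuitUnitary circ) z).toReal * deviation σ circ A z = 0 := by
  by_cases h : Diagonalizes circ A
  · obtain ⟨d, hd, he⟩ := h
    simp only [deviation_eq σ d hd he, mul_sub, Finset.sum_sub_distrib, ← Finset.sum_mul]
    rw [born_sum_toReal, born_mean σ _ A d he, one_mul, sub_self]
  · simp [deviation, h]

theorem abs_deviation_le {m : ℕ} (σ : DensityMatrix m) (circ : List (Gate m)) (A : QMat m)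
    (z : Fin m → Bool) : |deviation σ circ A z| ≤ 2 := by
  by_cases h : Diagonalizes circ A
  · obtain ⟨d, hd, he⟩ := h
    rw [deviation_eq σ d hd he]
    have : |((σ.mat * A).trace).re| ≤ 1 := by
      rw [← born_mean σ _ A d he]
      refine (Finset.abs_sum_le_sum_abs _ _).trans ?_
      rw [← born_sum_toReal σ (circuitUnitary circ)]
      refine Finset.sum_le_sum fun z _ => ?_
      rw [abs_mul, abs_of_nonneg ENNReal.toReal_nonneg]
      exact mul_le_of_le_one_right ENNReal.toReal_nonneg (hd z)
    have h1 := abs_le.mp this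
    have h2 := abs_le.mp (hd z)
    exact abs_le.mpr ⟨by linarith [h1.2, h2.1], by linarith [h1.1, h2.2]⟩
  · simp [deviation, h]

section

variable {n : ℕ} (ρ : DensityMatrix n) (p : Prog LearnerInstr) (T m : ℕ)

/-- The circuit of measurement number `k` on the tape `ω`. -/
def tapeCircuit (ω : ℕ → Fin (n + n) → Bool) (k : ℕ) : List (Gate (n + n)) :=
  (tapeRun p [n] ω T).2.log.getD k []

/-- The deviation in measurement number `k`, if it belongs to block `b`. -/
noncomputable def blockDeviation (A : QMat (n + n)) (b : ℕ) (ω : ℕ → Fin (n + n) → Bool) (k : ℕ) :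
    ℝ :=
  if k / m = b then deviation ρ.twoCopies (tapeCircuit p T ω k) A (ω k) else 0

/-- How many of the measurements with numbers from `k` to `N - 1` belong to block `b`. -/
def remaining (N b k : ℕ) : ℕ := ((Finset.Ico k N).filter fun i => i / m = b).card

theorem remaining_succ {N b k : ℕ} (h : k < N) :
    remaining m N b k = remaining m N b (k + 1) + if k / m = b then 1 else 0 := by
  rw [remaining, remaining, ← Finset.insert_Ico_add_one_left_eq_Ico h, Finset.filter_insert]
  split_ifs with hk
  · rw [Finset.card_insert_of_notMem (by simp)]
  · rfl

theorem remaining_zero_le {N b : ℕ} (hm : 0 < m) : remaining m N b 0 ≤ m := by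
  have : ((Finset.Ico 0 N).filter fun i => i / m = b) ⊆ Finset.Ico (b * m) (b * m + m) := by
    intro i hi
    have := (Finset.mem_filter.mp hi).2
    rw [Nat.div_eq_iff hm] at this
    rw [Finset.mem_Ico]
    omega
  exact (Finset.card_le_card this).trans (by simp)

variable {ι : Type} (A : ι → QMat (n + n)) (blk : ι → ℕ) {η : ℝ} {N : ℕ}

/-- The sign that belongs to a bit. -/
noncomputable def bsign (b : Bool) : ℝ := if b then 1 else -1

theorem bsign_sq (b : Bool) : bsign b ^ 2 = 1 := by cases b <;> simp [bsign]

/-- One summand of the potential. -/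
noncomputable def potentialTerm (η : ℝ) (N : ℕ) (j : ι × Bool) (k : ℕ)
    (ω : ℕ → Fin (n + n) → Bool) : ℝ :=
  Real.exp (bsign j.2 * (η / 8) * (∑ i ∈ Finset.range k, blockDeviation ρ p T m (A j.1) (blk j.1) ω i)
    - η / 8 * m * η + 4 * (η / 8) ^ 2 * remaining m N (blk j.1) k)

/-- The supermartingale property. A measurement in the block multiplies the mean of the exponential
by at most exp(4 (η/8)²), which is paid for by the drop of `remaining`; any other measurement
changes nothing. -/
theorem potentialTerm_step (hη0 : 0 < η) (hη1 : η ≤ 1) (j : ι × Bool) {k : ℕ} (hk : k < N)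
    (ω : ℕ → Fin (n + n) → Bool) :
    ∑ z, (born ρ.twoCopies (circuitUnitary (tapeCircuit p T ω k)) z).toReal *
        potentialTerm ρ p T m A blk η N j (k + 1) (Function.update ω k z) ≤
      potentialTerm ρ p T m A blk η N j k ω := by
  -- By causality the new outcome affects neither the current circuit nor the earlier ones.
  have hcirc : ∀ z, ∀ i ≤ k, tapeCircuit p T (Function.update ω k z) i = tapeCircuit p T ω i := by
    intro z i hi
    rw [tapeCircuit, tapeCircuit, List.getD_eq_getElem?_getD, List.getD_eq_getElem?_getD,
      log_getElem?_agree p (k := k) (fun l hl => Function.update_of_ne hl.ne _ _) T hi]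
  have hsum : ∀ z, ∑ i ∈ Finset.range (k + 1),
      blockDeviation ρ p T m (A j.1) (blk j.1) (Function.update ω k z) i =
      ∑ i ∈ Finset.range k, blockDeviation ρ p T m (A j.1) (blk j.1) ω i +
        if k / m = blk j.1 then deviation ρ.twoCopies (tapeCircuit p T ω k) (A j.1) z else 0 := by
    intro z
    rw [Finset.sum_range_succ]
    congr 1
    · refine Finset.sum_congr rfl fun i hi => ?_
      have hi := Finset.mem_range.mp hi
      rw [blockDeviation, blockDeviation, hcirc z i hi.le, Function.update_of_ne hi.ne]
    · rw [blockDeviation, hcirc z k le_rfl, Function.update_self]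
  have hrem := remaining_succ m (b := blk j.1) hk
  set S := ∑ i ∈ Finset.range k, blockDeviation ρ p T m (A j.1) (blk j.1) ω i
  have hw1 := born_sum_toReal ρ.twoCopies (circuitUnitary (tapeCircuit p T ω k))
  simp only [potentialTerm, hsum]
  by_cases hb : k / m = blk j.1
  · simp only [if_pos hb] at hrem ⊢
    rw [hrem]
    have hsq := bsign_sq j.2
    have habs : |bsign j.2| = 1 := by
      rcases Bool.eq_false_or_eq_true j.2 with h | h <;> simp [bsign, h]
    -- Deviations are at most 2 in absolute value, so the exponents are at most η/4 ≤ 1, and their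
    -- squares at most 4 (η/8)².
    have key := sum_mul_exp_le Finset.univ
      (fun z => (born ρ.twoCopies (circuitUnitary (tapeCircuit p T ω k)) z).toReal)
      (fun z => bsign j.2 * (η / 8) * deviation ρ.twoCopies (tapeCircuit p T ω k) (A j.1) z)
      (v := 4 * (η / 8) ^ 2) (fun _ _ => ENNReal.toReal_nonneg) hw1
      (fun z _ => by
        rw [abs_mul, abs_mul, habs, abs_of_pos (by positivity)]
        have := abs_deviation_le ρ.twoCopies (tapeCircuit p T ω k) (A j.1) z
        nlinarith)
      (fun z _ => by
        have := abs_deviation_le ρ.twoCopies (tapeCircuit p T ω k) (A j.1) z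
        rw [mul_pow, mul_pow, hsq, one_mul, mul_comm 4]
        refine mul_le_mul_of_nonneg_left ?_ (sq_nonneg _)
        rw [← sq_abs]
        nlinarith [abs_nonneg (deviation ρ.twoCopies (tapeCircuit p T ω k) (A j.1) z)])
      (by
        simp only [mul_left_comm _ (bsign j.2 * (η / 8)), ← Finset.mul_sum, deviation_mean, mul_zero])
    calc _ = Real.exp (bsign j.2 * (η / 8) * S - η / 8 * m * η +
            4 * (η / 8) ^ 2 * remaining m N (blk j.1) (k + 1)) *
          ∑ z, (born ρ.twoCopies (circuitUnitary (tapeCircuit p T ω k)) z).toReal *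
            Real.exp (bsign j.2 * (η / 8) *
              deviation ρ.twoCopies (tapeCircuit p T ω k) (A j.1) z) := by
          rw [Finset.mul_sum]
          refine Finset.sum_congr rfl fun z _ => ?_
          rw [mul_left_comm, ← Real.exp_add]
          congr 2
          ring
      _ ≤ _ := mul_le_mul_of_nonneg_left key (Real.exp_pos _).le
      _ = _ := by
          rw [← Real.exp_add]
          congr 1
          push_cast
          ring
  · simp only [if_neg hb, add_zero] at hrem ⊢
    rw [← Finset.sum_mul, hw1, one_mul, hrem]

/-- If the deviations in all the blocks are small, except with small probability. -/
theorem learn_bad_le [Fintype ι] (hη0 : 0 < η) (hη1 : η ≤ 1) (hm : 0 < m)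
    (hlen : ∀ ω : ℕ → Fin (n + n) → Bool, (tapeRun p [n] ω T).2.log.length = N) (S : Set (LConfig n))
    (hS : ∀ ω, (∀ j, |∑ k ∈ Finset.range N, blockDeviation ρ p T m (A j) (blk j) ω k| ≤ m * η) →
      toLConfig (tapeRun p [n] ω T) ∈ S) :
    (p.learn ρ T).toOuterMeasure Sᶜ ≤
      ENNReal.ofReal (2 * Fintype.card ι * Real.exp (-(m * η ^ 2 / 16))) := by
  have hpos : ∀ k ω, 0 ≤ ∑ j, potentialTerm ρ p T m A blk η N j k ω := fun k ω =>
    Finset.sum_nonneg fun j _ => (Real.exp_pos _).le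
  refine (learn_le_potential p T Sᶜ
    (fun k ω => ENNReal.ofReal (∑ j, potentialTerm ρ p T m A blk η N j k ω)) ?_ ?_
    (fun _ _ => false)).trans ?_
  · intro ω hω
    rw [hlen]
    have : ∃ j, m * η < |∑ k ∈ Finset.range N, blockDeviation ρ p T m (A j) (blk j) ω k| := by
      by_contra hcon
      push Not at hcon
      exact hω (hS ω hcon)
    obtain ⟨j, hj⟩ := this
    rw [← ENNReal.ofReal_one]
    refine ENNReal.ofReal_le_ofReal ?_
    -- The sign reduces a two-sided bound to a one-sided one and accounts for the factor 2 in the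
    -- result.
    obtain ⟨b, hb⟩ : ∃ b, bsign b * (∑ k ∈ Finset.range N, blockDeviation ρ p T m (A j) (blk j) ω k) =
        |∑ k ∈ Finset.range N, blockDeviation ρ p T m (A j) (blk j) ω k| := by
      rcases abs_choice (∑ k ∈ Finset.range N, blockDeviation ρ p T m (A j) (blk j) ω k) with h | h
      · exact ⟨true, by rw [h]; simp [bsign]⟩
      · exact ⟨false, by rw [h]; simp [bsign]⟩
    refine le_trans ?_ (Finset.single_le_sum
      (f := fun j => potentialTerm ρ p T m A blk η N j N ω)
      (fun j _ => (Real.exp_pos _).le) (Finset.mem_univ (j, b)))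
    rw [← Real.exp_zero]
    refine Real.exp_le_exp.mpr ?_
    simp only [remaining, Finset.Ico_self, Finset.filter_empty, Finset.card_empty, Nat.cast_zero,
      mul_zero, add_zero]
    have e : bsign b * (η / 8) * (∑ k ∈ Finset.range N, blockDeviation ρ p T m (A j) (blk j) ω k) =
        η / 8 * |∑ k ∈ Finset.range N, blockDeviation ρ p T m (A j) (blk j) ω k| := by
      rw [← hb]; ring
    rw [e]
    nlinarith
  · intro k ω circ hc
    have hk : k < N := by
      rw [← hlen ω]
      by_contra hcon
      rw [List.getElem?_eq_none (not_lt.mp hcon)] at hc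
      exact absurd hc (by simp)
    have hcirc : circ = tapeCircuit p T ω k := by
      rw [tapeCircuit, List.getD_eq_getElem?_getD, hc]; rfl
    subst hcirc
    calc _ = ENNReal.ofReal (∑ z,
          (born ρ.twoCopies (circuitUnitary (tapeCircuit p T ω k)) z).toReal *
            ∑ j, potentialTerm ρ p T m A blk η N j (k + 1) (Function.update ω k z)) := by
          rw [ENNReal.ofReal_sum_of_nonneg fun z _ => mul_nonneg ENNReal.toReal_nonneg (hpos _ _)]
          refine Finset.sum_congr rfl fun z _ => ?_
          rw [ENNReal.ofReal_mul ENNReal.toReal_nonneg, ENNReal.ofReal_toReal (PMF.apply_ne_top _ _)]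
      _ ≤ _ := by
          refine ENNReal.ofReal_le_ofReal ?_
          simp only [Finset.mul_sum]
          rw [Finset.sum_comm]
          exact Finset.sum_le_sum fun j _ => potentialTerm_step ρ p T m A blk hη0 hη1 j hk ω
  · refine ENNReal.ofReal_le_ofReal ?_
    -- The initial exponent is at most -(η/8) m η + 4 (η/8)² m = -m η²/16; the slope η/8 is the
    -- optimal one.
    refine (Finset.sum_le_sum fun j _ => (?_ : _ ≤ Real.exp (-(m * η ^ 2 / 16)))).trans ?_
    · refine Real.exp_le_exp.mpr ?_
      have h1 : (remaining m N (blk j.1) 0 : ℝ) ≤ m := by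
        exact_mod_cast remaining_zero_le m hm
      simp only [Finset.range_zero, Finset.sum_empty, mul_zero, zero_sub]
      nlinarith [sq_nonneg η]
    · simp [Finset.sum_const, mul_comm]

end

end PauliLearning

/-! ### Loop programs for Pauli arithmetic. -/

namespace PauliLearning

/-! ### Subprograms -/

section

variable {Q X : Type} {D : Device Q X} {inp : List ℕ}

/-- The statement assigns to the variable `y`. -/
def Stmt.assigns (D : Device Q X) : Stmt Q → ℕ → Bool
  | .set x _, y => x == y
  | .mov x _, y => x == y
  | .add x _ _, y => x == y
  | .sub x _ _, y => x == y
  | .half x _, y => x == y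
  | .inp x _, y => x == y
  | .par x _, y => x == y
  | .rd x _ _, y => x == y
  | .wr _ _ _, _ => false
  | .ext q, y => D.target q == some y
  | .seq p q, y => p.assigns D y || q.assigns D y
  | .ite _ p q, y => p.assigns D y || q.assigns D y
  | .loop x _ p, y => x == y || p.assigns D y

/-- The statement writes to the array `b`. -/
def Stmt.touches : Stmt Q → ℕ → Bool
  | .wr a _ _, b => a == b
  | .seq p q, b => p.touches b || q.touches b
  | .ite _ p q, b => p.touches b || q.touches b
  | .loop _ _ p, b => p.touches b
  | _, _ => false

/-- The statement has no additional instructions. -/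
def Stmt.classical : Stmt Q → Bool
  | .ext _ => false
  | .seq p q => p.classical && q.classical
  | .ite _ p q => p.classical && q.classical
  | .loop _ _ p => p.classical
  | _ => true

/-- Frame rule: `assigns` is computed from the syntax, so for concrete statements the hypothesis
holds by `rfl`. -/
theorem Stmt.eval_v (p : Stmt Q) (y : ℕ) (h : p.assigns D y = false) (s : Store X) :
    (p.eval D inp s).v y = s.v y := by
  induction p generalizing s with
  | ext q =>
    simp only [assigns, beq_eq_false_iff_ne, ne_eq] at h
    have := D.act_target q s.v s.x
    simp only [eval]
    rcases e : (D.act q s.v s.x).1 with - | w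
    · rfl
    · rw [e] at this
      refine Function.update_of_ne (fun hw => h ?_) _ _
      rw [← this, hw]
      rfl
  | seq p q hp hq =>
    simp only [assigns, Bool.or_eq_false_iff] at h
    simp only [eval]
    rw [hq h.2, hp h.1]
  | ite x p q hp hq =>
    simp only [assigns, Bool.or_eq_false_iff] at h
    simp only [eval]
    split_ifs
    · exact hp h.1 s
    · exact hq h.2 s
  | loop x k p hp =>
    simp only [assigns, Bool.or_eq_false_iff, beq_eq_false_iff_ne, ne_eq] at h
    refine iter_inv (fun _ (s' : Store X) => s'.v y = s.v y) rfl fun i _ s' hs => ?_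
    rw [hp h.2, ← hs]
    exact Function.update_of_ne (Ne.symm h.1) _ _
  | wr a x z => rfl
  | _ =>
    simp only [assigns, beq_eq_false_iff_ne, ne_eq] at h
    exact Function.update_of_ne (Ne.symm h) _ _

theorem Stmt.eval_a (p : Stmt Q) (b : ℕ) (h : p.touches b = false) (s : Store X) :
    (p.eval D inp s).a b = s.a b := by
  induction p generalizing s with
  | seq p q hp hq =>
    simp only [touches, Bool.or_eq_false_iff] at h
    simp only [eval]
    rw [hq h.2, hp h.1]
  | ite x p q hp hq =>
    simp only [touches, Bool.or_eq_false_iff] at h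
    simp only [eval]
    split_ifs
    · exact hp h.1 s
    · exact hq h.2 s
  | loop x k p hp =>
    refine iter_inv (fun _ (s' : Store X) => s'.a b = s.a b) rfl fun i _ s' hs => ?_
    rw [hp h, ← hs]
    rfl
  | wr a x z =>
    simp only [touches, beq_eq_false_iff_ne, ne_eq] at h
    exact Function.update_of_ne (Ne.symm h) _ _
  | _ => rfl

theorem Stmt.eval_x (p : Stmt Q) (h : p.classical = true) (s : Store X) :
    (p.eval D inp s).x = s.x := by
  induction p generalizing s with
  | ext q => simp [classical] at h
  | seq p q hp hq =>
    simp only [classical, Bool.and_eq_true] at h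
    simp only [eval]
    rw [hq h.2, hp h.1]
  | ite x p q hp hq =>
    simp only [classical, Bool.and_eq_true] at h
    simp only [eval]
    split_ifs
    · exact hp h.1 s
    · exact hq h.2 s
  | loop x k p hp =>
    refine iter_inv (fun _ (s' : Store X) => s'.x = s.x) rfl fun i _ s' hs => ?_
    rw [hp h, ← hs]
    rfl
  | _ => rfl

section

variable (s : Store X) (x y z c k a : ℕ) (p q : Stmt Q)

@[simp] theorem Store.setv_v : (s.setv x c).v = Function.update s.v x c := rfl
@[simp] theorem Store.setv_a : (s.setv x c).a = s.a := rfl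
@[simp] theorem Store.setv_p : (s.setv x c).p = s.p := rfl
@[simp] theorem Store.setv_x : (s.setv x c).x = s.x := rfl
@[simp] theorem Store.seta_v : (s.seta a x c).v = s.v := rfl
@[simp] theorem Store.seta_a :
    (s.seta a x c).a = Function.update s.a a (Function.update (s.a a) x c) := rfl
@[simp] theorem Store.seta_p : (s.seta a x c).p = s.p := rfl
@[simp] theorem Store.seta_x : (s.seta a x c).x = s.x := rfl
@[simp] theorem Stmt.eval_set : (Stmt.set x c : Stmt Q).eval D inp s = s.setv x c := rfl
@[simp] theorem Stmt.eval_mov : (Stmt.mov x y : Stmt Q).eval D inp s = s.setv x (s.v y) := rfl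
@[simp] theorem Stmt.eval_add :
    (Stmt.add x y z : Stmt Q).eval D inp s = s.setv x (s.v y + s.v z) := rfl
@[simp] theorem Stmt.eval_sub :
    (Stmt.sub x y z : Stmt Q).eval D inp s = s.setv x (s.v y - s.v z) := rfl
@[simp] theorem Stmt.eval_half : (Stmt.half x y : Stmt Q).eval D inp s = s.setv x (s.v y / 2) := rfl
@[simp] theorem Stmt.eval_inp :
    (Stmt.inp x y : Stmt Q).eval D inp s = s.setv x (inp.getD (s.v y) 0) := rfl
@[simp] theorem Stmt.eval_par : (Stmt.par x k : Stmt Q).eval D inp s = s.setv x (s.p k) := rfl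
@[simp] theorem Stmt.eval_rd : (Stmt.rd x a y : Stmt Q).eval D inp s = s.setv x (s.a a (s.v y)) := rfl
@[simp] theorem Stmt.eval_wr : (Stmt.wr a x y : Stmt Q).eval D inp s = s.seta a (s.v x) (s.v y) := rfl
@[simp] theorem Stmt.eval_seq : (p ;; q).eval D inp s = q.eval D inp (p.eval D inp s) := rfl
@[simp] theorem Stmt.eval_ite : (Stmt.ite x p q).eval D inp s =
    if s.v x ≠ 0 then p.eval D inp s else q.eval D inp s := rfl

end

/-- Since parameters are constant, each iteration may use `s'.p = s.p` without making it part of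
`I`. -/
theorem Stmt.loop_inv {x k : ℕ} {p : Stmt Q} {s : Store X} {N : ℕ} (I : ℕ → Store X → Prop)
    (hN : s.p k = N) (h0 : I 0 s)
    (hs : ∀ i < N, ∀ s', s'.p = s.p → I i s' → I (i + 1) (p.eval D inp (s'.setv x i))) :
    I N ((Stmt.loop x k p).eval D inp s) := by
  subst hN
  exact (iter_inv (fun i s' => s'.p = s.p ∧ I i s') ⟨rfl, h0⟩ fun i hi s' h =>
    ⟨by rw [Stmt.eval_p]; exact h.1, hs i hi s' h.1 h.2⟩).2

/-- Variable `19` is never read. -/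
def nop : Stmt Q := .set 19 0

@[simp] theorem eval_nop (s : Store X) : (nop : Stmt Q).eval D inp s = s.setv 19 0 := rfl

/-- Flip the bit in variable `p` if variables `x` and `y` are nonzero. Variable `17` holds `1`. -/
def toggle (p x y : ℕ) : Stmt Q := .ite x (.ite y (.sub p 17 p) nop) nop

theorem val_add_mul (π a b : ZMod 2) :
    (π + a * b).val = if a.val ≠ 0 then if b.val ≠ 0 then 1 - π.val else π.val else π.val := by
  revert π a b; decide

theorem toggle_spec {p x y : ℕ} {s : Store X} {π a b : ZMod 2} (hp19 : p ≠ 19) (h17 : s.v 17 = 1)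
    (hp : s.v p = π.val) (hx : s.v x = a.val) (hy : s.v y = b.val) :
    ((toggle p x y).eval D inp s).v p = (π + a * b).val := by
  rw [val_add_mul]
  simp only [toggle, nop, Stmt.eval, hx, hy]
  split_ifs <;> simp [Store.setv, h17, hp, hp19]

/-- Write the bits of the Pauli operator with number `q` to the arrays `ax` and `az`. -/
def unpack (q ax az : ℕ) : Stmt Q :=
  .mov 10 q ;; .loop 13 0 (.half 11 10 ;; .add 12 11 11 ;; .sub 12 10 12 ;; .wr ax 13 12 ;;
    .mov 10 11 ;; .half 11 10 ;; .add 12 11 11 ;; .sub 12 10 12 ;; .wr az 13 12 ;; .mov 10 11)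

/-- The first `n` entries of the array represent the bits `x`. -/
def Bits (n : ℕ) (f : ℕ → ℕ) (x : ℕ → ZMod 2) : Prop := ∀ i < n, f i = (x i).val

/-- Two halvings per qubit read off a base 4 digit, whose lower bit is the X-bit and whose upper bit
is the Z-bit. -/
theorem unpack_spec {q ax az n : ℕ} {s : Store X} (hn : s.p 0 = n) (hne : ax ≠ az) :
    Bits n (((unpack q ax az).eval D inp s).a ax) (qx (s.v q)) ∧
      Bits n (((unpack q ax az).eval D inp s).a az) (qz (s.v q)) := by
  simp only [unpack, Stmt.eval]
  have e : (s.setv 10 (s.v q)).p 0 = n := hn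
  rw [e]
  refine (iter_inv (fun i (s' : Store X) => Bits i (s'.a ax) (qx (s.v q)) ∧
    Bits i (s'.a az) (qz (s.v q)) ∧ s'.v 10 = s.v q / 4 ^ i) ?_ ?_).imp_right And.left
  · refine ⟨fun i hi => absurd hi (Nat.not_lt_zero i), fun i hi => absurd hi (Nat.not_lt_zero i), ?_⟩
    simp [Store.setv]
  · rintro i hi s' ⟨h1, h2, h3⟩
    have hd : ∀ t : ℕ, t - (t / 2 + t / 2) = t % 2 := fun t => by omega
    refine ⟨fun j hj => ?_, fun j hj => ?_, ?_⟩
    · by_cases hji : j = i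
      · subst hji
        simp [Store.setv, Store.seta, hne, h3, qx, ZMod.val_natCast, hd]
      · have := h1 j (by omega)
        simp [Store.setv, Store.seta, hne, hji, this]
    · by_cases hji : j = i
      · subst hji
        simp [Store.setv, Store.seta, h3, qz, ZMod.val_natCast, hd]
      · have := h2 j (by omega)
        simp [Store.setv, Store.seta, hne.symm, hji, this]
    · simp [Store.setv, Store.seta, h3, Nat.div_div_eq_div_mul, pow_succ, mul_assoc]

/-- Variable `14` becomes the symplectic form of the arrays `0, 1` and `2, 3`. -/
def commute : Stmt Q :=
  .set 14 0 ;; .set 17 1 ;; .loop 13 0 (.rd 15 0 13 ;; .rd 16 3 13 ;; toggle 14 15 16 ;;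
    .rd 15 1 13 ;; .rd 16 2 13 ;; toggle 14 15 16)

theorem commute_spec {n : ℕ} {s : Store X} {x z x' z' : ℕ → ZMod 2} (hn : s.p 0 = n)
    (hx : Bits n (s.a 0) x) (hz : Bits n (s.a 1) z) (hx' : Bits n (s.a 2) x')
    (hz' : Bits n (s.a 3) z') :
    (commute.eval D inp s).v 14 = (symp n x z x' z').val := by
  simp only [commute, Stmt.eval]
  have e : ((s.setv 14 0).setv 17 1).p 0 = n := hn
  rw [e]
  refine (iter_inv (fun i (s' : Store X) => s'.v 14 = (symp i x z x' z').val ∧ s'.v 17 = 1 ∧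
    s'.a = s.a) ?_ ?_).1
  · simp [Store.setv, symp]
  · rintro i hi s' ⟨h1, h2, h3⟩
    have a1 : ∀ b s, ((toggle 14 15 16 : Stmt Q).eval D inp s).a b = s.a b := fun b s =>
      Stmt.eval_a _ _ rfl _
    have v13 : ∀ s, ((toggle 14 15 16 : Stmt Q).eval D inp s).v 13 = s.v 13 := fun s =>
      Stmt.eval_v _ _ rfl _
    have v17 : ∀ s, ((toggle 14 15 16 : Stmt Q).eval D inp s).v 17 = s.v 17 := fun s =>
      Stmt.eval_v _ _ rfl _
    refine ⟨?_, ?_, ?_⟩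
    · rw [symp, Finset.sum_range_succ, ← add_assoc]
      refine toggle_spec (by decide) ?_ ?_ ?_ ?_
      · simp [Store.setv, v17, h2]
      · simp only [Store.setv]
        refine toggle_spec (by decide) ?_ ?_ ?_ ?_
        · simp [h2]
        · simpa [symp] using h1
        · simp [h3, hx i hi]
        · simp [h3, hz' i hi]
      · simp [Store.setv, a1, v13, h3, hz i hi]
      · simp [Store.setv, a1, v13, h3, hx' i hi]
    · simp [Store.setv, v17, h2]
    · funext b
      simp [Store.setv, a1, h3]

end

end PauliLearning

namespace PauliLearning

section

variable {Q X : Type} {D : Device Q X} {inp : List ℕ}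

/-! ### Rounds of gates -/

/-- Go through the `2 n` rounds that are stored in array `4`, and run `sG`, `cG`, `hG` for the phase
gate on qubit `v 13`, the CNOT gate with control `v 24` and target `v 13`, and the Hadamard gate on
qubit `v 24`. -/
def roundsLoop (sG cG hG : Stmt Q) : Stmt Q :=
  .set 17 1 ;; .set 21 0 ;; .loop 22 2 (.set 23 0 ;; .set 24 0 ;; .loop 13 0 (
    .rd 25 4 21 ;; .add 21 21 17 ;; .rd 26 4 21 ;; .add 21 21 17 ;;
      .ite 25 (.ite 26 sG nop ;; .ite 23 cG (.set 23 1 ;; .mov 24 13)) nop) ;;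
    .ite 23 hG nop)

/-- The control variables of `roundsLoop`. -/
def roundVars : List ℕ := [13, 17, 19, 21, 22, 23, 24, 25, 26]

/-- The statement does not interfere with `roundsLoop`. -/
def Stmt.Harmless (D : Device Q X) (p : Stmt Q) : Prop :=
  (∀ y ∈ roundVars, y ≠ 19 → p.assigns D y = false) ∧ p.touches 4 = false

/-- The bits that are stored in an array. -/
def bitsOf (f : ℕ → ℕ) (k : ℕ) : Bool := decide (f k ≠ 0)

/-- What `concentrate` knows about the pivot is stored in variables `23` and `24`. -/
def PivotRep (s : Store X) : Option ℕ → Prop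
  | none => s.v 23 = 0
  | some p => s.v 23 = 1 ∧ s.v 24 = p

/-- The walk through a stored circuit is verified once, for an arbitrary invariant `I` of the gates
done so far. One instance updates a stored tableau, another applies gates to the quantum register.
Both follow the list `circOps`, so the classical prediction fits the circuit that is measured. -/
theorem roundsLoop_spec {sG cG hG : Stmt Q} {n : ℕ} (I : List Op → Store X → Prop)
    (hIc : ∀ l s s', s'.a = s.a → s'.x = s.x → s'.p = s.p → (∀ y ∉ roundVars, s'.v y = s.v y) →
      I l s → I l s')
    (hsG : sG.Harmless D) (hcG : cG.Harmless D) (hhG : hG.Harmless D)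
    (hS : ∀ l s i, s.p 0 = n → s.v 13 = i → i < n → s.v 17 = 1 → I l s →
      I (l ++ [.S i]) (sG.eval D inp s))
    (hC : ∀ l s i j, s.p 0 = n → s.v 24 = i → s.v 13 = j → i < j → j < n → s.v 17 = 1 → I l s →
      I (l ++ [.C i j]) (cG.eval D inp s))
    (hH : ∀ l s i, s.p 0 = n → s.v 24 = i → i < n → s.v 17 = 1 → I l s →
      I (l ++ [.H i]) (hG.eval D inp s))
    {s : Store X} (hn : s.p 0 = n) (hn2 : s.p 2 = 2 * n) (h0 : I [] s) :
    I (circOps n (bitsOf (s.a 4)) (2 * n)) ((roundsLoop sG cG hG).eval D inp s) := by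
  set γ := bitsOf (s.a 4) with hγ
  simp only [roundsLoop, Stmt.eval_seq, Stmt.eval_set]
  refine (Stmt.loop_inv (N := 2 * n) (fun R (s' : Store X) => I (circOps n γ R) s' ∧ s'.v 17 = 1 ∧
    s'.v 21 = R * (2 * n) ∧ s'.a 4 = s.a 4)
    (s := (s.setv 17 1).setv 21 0) (by simpa using hn2) ?_ ?_).1
  · refine ⟨hIc _ s _ rfl rfl rfl (fun y hy => ?_) h0, ?_, ?_, rfl⟩
    · simp only [roundVars, List.mem_cons, not_or] at hy
      simp [hy]
    · simp 
    · simp 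
  · rintro R hR s₁ hp ⟨hI, h17, h21, ha⟩
    replace hp : s₁.p = s.p := hp
    set gx : ℕ → Bool := fun i => γ (R * (2 * n) + 2 * i) with hgx
    set gz : ℕ → Bool := fun i => γ (R * (2 * n) + 2 * i + 1) with hgz
    simp only [Stmt.eval_seq, Stmt.eval_set]
    -- The inner loop unrolls `concentrate`, with the pivot in variables 23 and 24. Variable 21 is
    -- the reading position in array 4, which has two bits per qubit.
    have inner := Stmt.loop_inv (D := D) (inp := inp) (x := 13) (k := 0)
      (p := .rd 25 4 21 ;; .add 21 21 17 ;; .rd 26 4 21 ;; .add 21 21 17 ;;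
        .ite 25 (.ite 26 sG nop ;; .ite 23 cG (.set 23 1 ;; .mov 24 13)) nop)
      (fun i (s' : Store X) => I (circOps n γ R ++ (concentrate gx gz i).2) s' ∧ s'.v 17 = 1 ∧
        s'.v 21 = R * (2 * n) + 2 * i ∧ s'.a 4 = s.a 4 ∧ s'.p = s.p ∧
        PivotRep s' (concentrate gx gz i).1)
      (s := ((s₁.setv 22 R).setv 23 0).setv 24 0) (N := n) (by simp [hp, hn]) ?_ ?_
    · generalize (Stmt.loop 13 0 _).eval D inp _ = s₂ at inner ⊢
      rw [Stmt.eval_ite]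
      obtain ⟨hI2, h172, h212, ha2, hp2, hpiv⟩ := inner
      have hne : ∀ y ∈ roundVars, y ≠ 19 → ((nop : Stmt Q).eval D inp s₂).v y = s₂.v y :=
        fun y _ hy => by simp [hy]
      rw [circOps, roundOps]
      rcases e : concentrate gx gz n with ⟨_ | p, l⟩
      · rw [e] at hpiv hI2
        simp only [PivotRep] at hpiv
        rw [if_neg (by simpa using hpiv)]
        refine ⟨hIc _ s₂ _ rfl rfl rfl (fun y hy => ?_) hI2, ?_, ?_, ha2⟩
        · simp only [roundVars, List.mem_cons, not_or] at hy
          simp [hy]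
        · rw [hne 17 (by decide) (by decide), h172]
        · rw [hne 21 (by decide) (by decide), h212]; ring
      · have hpn := (concentrate_fst (show (concentrate gx gz n).1 = some p by rw [e])).1
        rw [e] at hpiv hI2
        simp only [PivotRep] at hpiv
        rw [if_pos (by rw [hpiv.1]; decide)]
        refine ⟨?_, ?_, ?_, ?_⟩
        · rw [← List.append_assoc]
          exact hH _ _ _ (by rw [hp2, hn]) hpiv.2 hpn h172 hI2
        · rw [Stmt.eval_v _ _ (hhG.1 17 (by decide) (by decide)), h172]
        · rw [Stmt.eval_v _ _ (hhG.1 21 (by decide) (by decide)), h212]; ring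
        · rw [Stmt.eval_a _ _ hhG.2, ha2]
    · refine ⟨?_, ?_, ?_, ha, hp, ?_⟩
      · rw [concentrate, List.append_nil]
        refine hIc _ s₁ _ rfl rfl rfl (fun y hy => ?_) hI
        simp only [roundVars, List.mem_cons, not_or] at hy
        simp [hy]
      · simpa  using h17
      · simpa  using h21
      · simp [concentrate, PivotRep, Store.setv]
    · rintro i hi s₂ - ⟨hI2, h172, h212, ha2, hp2, hpiv⟩
      simp only [Stmt.eval_seq, Stmt.eval_rd, Stmt.eval_add, Stmt.eval_ite, Stmt.eval_mov, Stmt.eval_set]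
      set s₃ := ((((s₂.setv 13 i).setv 25 ((s₂.setv 13 i).a 4 ((s₂.setv 13 i).v 21))).setv 21
        (((s₂.setv 13 i).setv 25 ((s₂.setv 13 i).a 4 ((s₂.setv 13 i).v 21))).v 21 +
        ((s₂.setv 13 i).setv 25 ((s₂.setv 13 i).a 4 ((s₂.setv 13 i).v 21))).v 17))) with hs₃
      set s₄ := (s₃.setv 26 (s₃.a 4 (s₃.v 21))).setv 21
        ((s₃.setv 26 (s₃.a 4 (s₃.v 21))).v 21 + (s₃.setv 26 (s₃.a 4 (s₃.v 21))).v 17) with hs₄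
      have v25 : s₄.v 25 = s.a 4 (R * (2 * n) + 2 * i) := by
        simp [hs₄, hs₃, h212, ha2]
      have v26 : s₄.v 26 = s.a 4 (R * (2 * n) + 2 * i + 1) := by
        simp [hs₄, hs₃, h212, ha2, h172]
      have v21 : s₄.v 21 = R * (2 * n) + 2 * (i + 1) := by
        simp [hs₄, hs₃, h212, h172]; ring
      have v17 : s₄.v 17 = 1 := by simp [hs₄, hs₃, h172]
      have v13 : s₄.v 13 = i := by simp [hs₄, hs₃, Store.setv]
      have v23 : s₄.v 23 = s₂.v 23 := by simp [hs₄, hs₃, Store.setv]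
      have v24 : s₄.v 24 = s₂.v 24 := by simp [hs₄, hs₃, Store.setv]
      have a4 : s₄.a 4 = s.a 4 := ha2
      have p4 : s₄.p = s.p := hp2
      have I4 : I (circOps n γ R ++ (concentrate gx gz i).2) s₄ := by
        refine hIc _ s₂ _ rfl rfl rfl (fun y hy => ?_) hI2
        simp only [roundVars, List.mem_cons, not_or] at hy
        simp [hs₄, hs₃, hy]
      clear_value s₄
      clear hs₄ hs₃
      have hpiv4 : PivotRep s₄ (concentrate gx gz i).1 := by
        revert hpiv
        cases (concentrate gx gz i).1 <;> simp [PivotRep, v23, v24]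
      by_cases hg : gx i = true
      · have hne : s₄.v 25 ≠ 0 := by
          rw [v25]; simpa [hgx, hγ, bitsOf] using hg
        rw [if_pos hne]
        obtain ⟨s₅, hs₅, I5, v5, a5, p5⟩ : ∃ s₅, s₅ =
            (if s₄.v 26 ≠ 0 then sG.eval D inp s₄ else (nop : Stmt Q).eval D inp s₄) ∧
            I (circOps n γ R ++ ((concentrate gx gz i).2 ++ phaseOp (gz i) i)) s₅ ∧
            (∀ y ∈ roundVars, y ≠ 19 → s₅.v y = s₄.v y) ∧ s₅.a 4 = s.a 4 ∧ s₅.p = s.p := by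
          refine ⟨_, rfl, ?_⟩
          by_cases hz : gz i = true
          · have hne : s₄.v 26 ≠ 0 := by
              rw [v26]; simpa [hgz, hγ, bitsOf] using hz
            rw [if_pos hne, hz, phaseOp, if_pos rfl, ← List.append_assoc]
            exact ⟨hS _ _ _ (by rw [p4, hn]) v13 hi v17 I4,
              fun y hy h19 => Stmt.eval_v _ _ (hsG.1 y hy h19) _,
              by rw [Stmt.eval_a _ _ hsG.2, a4], by rw [Stmt.eval_p, p4]⟩
          · have hne : ¬ s₄.v 26 ≠ 0 := by
              rw [v26]; simpa [hgz, hγ, bitsOf] using hz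
            rw [if_neg hne, show gz i = false by simpa using hz, phaseOp, if_neg (by simp), List.append_nil]
            refine ⟨hIc _ s₄ _ rfl rfl rfl (fun y hy => ?_) I4, fun y _ h19 => ?_, a4, p4⟩
            · simp only [roundVars, List.mem_cons, not_or] at hy
              simp [hy]
            · simp [h19]
        rw [← hs₅]
        clear hs₅
        have w17 := (v5 17 (by decide) (by decide)).trans v17
        have w13 := (v5 13 (by decide) (by decide)).trans v13
        have w21 := (v5 21 (by decide) (by decide)).trans v21
        have w23 := v5 23 (by decide) (by decide)
        have w24 := v5 24 (by decide) (by decide)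
        rw [concentrate, if_pos hg]
        rcases e : concentrate gx gz i with ⟨_ | p, l⟩
        · rw [e] at I5 hpiv4
          simp only [PivotRep] at hpiv4
          rw [if_neg (by rw [w23]; simpa using hpiv4)]
          refine ⟨hIc _ s₅ _ rfl rfl rfl (fun y hy => ?_) I5, ?_, ?_, a5, p5, ?_⟩
          · simp only [roundVars, List.mem_cons, not_or] at hy
            simp [hy]
          · simpa  using w17
          · simpa  using w21
          · simp [PivotRep, w13]
        · have hpi := (concentrate_fst (show (concentrate gx gz i).1 = some p by rw [e])).1
          rw [e] at I5 hpiv4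
          simp only [PivotRep] at hpiv4
          rw [if_pos (by rw [w23, hpiv4.1]; decide)]
          refine ⟨?_, ?_, ?_, ?_, ?_, ?_, ?_⟩
          · rw [← List.append_assoc]
            exact hC _ _ _ _ (by rw [p5, hn]) (by rw [w24, hpiv4.2]) w13 hpi hi w17 I5
          · rw [Stmt.eval_v _ _ (hcG.1 17 (by decide) (by decide)), w17]
          · rw [Stmt.eval_v _ _ (hcG.1 21 (by decide) (by decide)), w21]
          · rw [Stmt.eval_a _ _ hcG.2, a5]
          · rw [Stmt.eval_p, p5]
          · rw [Stmt.eval_v _ _ (hcG.1 23 (by decide) (by decide)), w23, hpiv4.1]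
          · rw [Stmt.eval_v _ _ (hcG.1 24 (by decide) (by decide)), w24, hpiv4.2]
      · have hne : ¬ s₄.v 25 ≠ 0 := by
          rw [v25]; simpa [hgx, hγ, bitsOf] using hg
        rw [if_neg hne, concentrate, if_neg hg]
        refine ⟨hIc _ s₄ _ rfl rfl rfl (fun y hy => ?_) I4, ?_, ?_, a4, p4, ?_⟩
        · simp only [roundVars, List.mem_cons, not_or] at hy
          simp [hy]
        · simpa  using v17
        · simpa  using v21
        · rcases e : (concentrate gx gz i).1 with - | p
          · rw [e] at hpiv4
            simpa [PivotRep, Store.setv] using hpiv4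
          · rw [e] at hpiv4
            simpa [PivotRep, Store.setv] using hpiv4

/-- Arrays `0`, `1` and variable `20` hold the tableau. -/
structure TabRep (n : ℕ) (s : Store X) (τ : Tableau) : Prop where
  x : Bits n (s.a 0) τ.x
  z : Bits n (s.a 1) τ.z
  s : s.v 20 = τ.s.val

/-- The phase gate on qubit `v 13` of the stored tableau. -/
def sStmt : Stmt Q :=
  .rd 27 0 13 ;; .ite 27 (.rd 28 1 13 ;; .ite 28 (.sub 20 17 20 ;; .set 28 0 ;; .wr 1 13 28)
    (.wr 1 13 17)) nop

/-- The CNOT gate with control `v 24` and target `v 13` on the stored tableau. -/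
def cStmt : Stmt Q :=
  .rd 27 0 24 ;; .rd 28 1 24 ;; .rd 29 0 13 ;; .rd 30 1 13 ;;
    .ite 27 (.ite 30 (.ite 29 (.ite 28 (.sub 20 17 20) nop) (.ite 28 nop (.sub 20 17 20))) nop ;;
      .sub 29 17 29 ;; .wr 0 13 29) nop ;;
    .ite 30 (.sub 28 17 28 ;; .wr 1 24 28) nop

/-- The Hadamard gate on qubit `v 24` of the stored tableau. -/
def hStmt : Stmt Q :=
  .rd 27 0 24 ;; .rd 28 1 24 ;; .wr 0 24 28 ;; .wr 1 24 27 ;;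
    .ite 27 (.ite 28 (.sub 20 17 20) nop) nop

theorem val_succ_zmod2 (a : ZMod 2) : (a + 1).val = 1 - a.val := by revert a; decide

theorem Bits.update {n : ℕ} {f : ℕ → ℕ} {x : ℕ → ZMod 2} (h : Bits n f x) (i : ℕ) {a : ℕ}
    {b : ZMod 2} (hab : a = b.val) : Bits n (Function.update f i a) (Function.update x i b) := by
  intro j hj
  by_cases hji : j = i
  · subst hji; simp [hab]
  · simp [hji, h j hj]

theorem val_one_zmod2 : (1 : ZMod 2).val = 1 := rfl

theorem sStmt_spec {n i : ℕ} {s : Store X} {τ : Tableau} (h13 : s.v 13 = i) (hi : i < n)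
    (h17 : s.v 17 = 1) (h : TabRep n s τ) :
    TabRep n (sStmt.eval D inp s) ((Op.S i).act τ) := by
  have hx := h.x i hi
  have hz := h.z i hi
  rcases ZMod.two_cases (τ.x i) with ex | ex
  · rw [ex] at hx
    simp only [sStmt, Op.act, ex, zero_mul, add_zero,
      Function.update_eq_self]
    simp [h13, hx]
    exact ⟨h.x, h.z, by simpa using h.s⟩
  · rw [ex] at hx
    rcases ZMod.two_cases (τ.z i) with ez | ez
    · rw [ez] at hz
      simp only [sStmt, Op.act, ex, ez, mul_zero, zero_add, add_zero]
      simp [h13, hx, hz, val_one_zmod2, h17]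
      exact ⟨by simpa using h.x, by simpa using h.z.update i val_one_zmod2.symm, by simpa using h.s⟩
    · rw [ez] at hz
      simp only [sStmt, Op.act, ex, ez, mul_one, add_self_zmod2]
      simp [h13, hx, hz, val_one_zmod2, h17]
      refine ⟨by simpa using h.x, by simpa using h.z.update i (ZMod.val_zero).symm, ?_⟩
      simp [h.s, val_succ_zmod2]

theorem hStmt_spec {n i : ℕ} {s : Store X} {τ : Tableau} (h24 : s.v 24 = i) (hi : i < n)
    (h17 : s.v 17 = 1) (h : TabRep n s τ) :
    TabRep n (hStmt.eval D inp s) ((Op.H i).act τ) := by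
  have hx := h.x i hi
  have hz := h.z i hi
  have a0 := h.x.update i hz
  have a1 := h.z.update i hx
  rcases ZMod.two_cases (τ.x i) with e1 | e1 <;> rcases ZMod.two_cases (τ.z i) with e2 | e2 <;>
    rw [e1] at hx a1 <;> rw [e2] at hz a0 <;>
    simp [hStmt, h24, hx, hz, val_one_zmod2, h17, Op.act, e1, e2] <;>
    refine ⟨by simpa [hx, hz, val_one_zmod2] using a0,
      by simpa [hx, hz, val_one_zmod2] using a1, ?_⟩ <;>
    simp [h.s, val_succ_zmod2]

theorem cStmt_spec {n i j : ℕ} {s : Store X} {τ : Tableau} (h24 : s.v 24 = i) (h13 : s.v 13 = j)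
    (hij : i < j) (hj : j < n) (h17 : s.v 17 = 1) (h : TabRep n s τ) :
    TabRep n (cStmt.eval D inp s) ((Op.C i j).act τ) := by
  have hxc := h.x i (hij.trans hj)
  have hzc := h.z i (hij.trans hj)
  have hxt := h.x j hj
  have hzt := h.z j hj
  have hs := h.s
  have ux : ∀ a b, a = b.val → Bits n (Function.update (s.a 0) j a) (Function.update τ.x j b) :=
    fun a b hab => h.x.update j hab
  have uz : ∀ a b, a = b.val → Bits n (Function.update (s.a 1) i a) (Function.update τ.z i b) :=
    fun a b hab => h.z.update i hab
  have ux0 : τ.x i = 0 → Function.update τ.x j (τ.x j + τ.x i) = τ.x := fun e => by simp [e]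
  have uz0 : τ.z j = 0 → Function.update τ.z i (τ.z i + τ.z j) = τ.z := fun e => by simp [e]
  rcases ZMod.two_cases (τ.x i) with e1 | e1 <;> rcases ZMod.two_cases (τ.z j) with e2 | e2
  · rw [e1] at hxc; rw [e2] at hzt
    simp only [Op.act, e1, uz0 e2]
    simp [cStmt, h24, h13, hxc, hzt]
    exact ⟨by simpa using h.x, by simpa using h.z, by simpa using hs⟩
  · rw [e1] at hxc; rw [e2] at hzt
    simp only [Op.act, e1, e2]
    simp [cStmt, h24, h13, hxc, hzt, val_one_zmod2, h17]
    refine ⟨by simpa using h.x, ?_, by simpa using hs⟩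
    simpa using uz _ _ (by rw [val_succ_zmod2, hzc])
  · rw [e1] at hxc; rw [e2] at hzt
    simp only [Op.act, e1, e2]
    simp [cStmt, h24, h13, hxc, hzt, val_one_zmod2, h17]
    refine ⟨?_, by simpa using h.z, by simpa using hs⟩
    simpa using ux _ _ (by rw [val_succ_zmod2, hxt])
  · rw [e1] at hxc; rw [e2] at hzt
    have tx := ux (1 - s.a 0 j) (τ.x j + 1) (by rw [val_succ_zmod2, hxt])
    have tz := uz (1 - s.a 1 i) (τ.z i + 1) (by rw [val_succ_zmod2, hzc])
    simp only [Op.act, e1, e2]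
    rcases ZMod.two_cases (τ.x j) with e3 | e3 <;> rcases ZMod.two_cases (τ.z i) with e4 | e4 <;>
      rw [e3] at hxt tx <;> rw [e4] at hzc tz <;>
      simp [cStmt, h24, h13, hxc, hzt, hxt, hzc,
        val_one_zmod2, h17, e3, e4] <;>
      refine ⟨by simpa [hxt, hzc, val_one_zmod2] using tx,
        by simpa [hxt, hzc, val_one_zmod2] using tz, ?_⟩ <;>
      simp [hs, val_succ_zmod2, show (1 + 1 : ZMod 2) = 0 from rfl]

/-- Conjugate the stored tableau by the circuit in array `4`. -/
def conjStmt : Stmt Q := roundsLoop sStmt cStmt hStmt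

theorem conjStmt_spec {n : ℕ} {s : Store X} {τ : Tableau} (hn : s.p 0 = n) (hn2 : s.p 2 = 2 * n)
    (h : TabRep n s τ) :
    TabRep n (conjStmt.eval D inp s) (conjList (circOps n (bitsOf (s.a 4)) (2 * n)) τ) := by
  have hh : ∀ p ∈ [(sStmt : Stmt Q), cStmt, hStmt], p.Harmless D := by
    intro p hp
    simp only [List.mem_cons, List.not_mem_nil, or_false] at hp
    rcases hp with rfl | rfl | rfl <;> refine ⟨fun y hy h19 => ?_, rfl⟩ <;>
      · simp only [roundVars, List.mem_cons, List.not_mem_nil, or_false] at hy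
        rcases hy with rfl | rfl | rfl | rfl | rfl | rfl | rfl | rfl | rfl <;> first | rfl | exact absurd rfl h19
  refine roundsLoop_spec (D := D) (inp := inp) (fun l s => TabRep n s (conjList l τ)) ?_
    (hh _ (by simp)) (hh _ (by simp)) (hh _ (by simp)) ?_ ?_ ?_ hn hn2 h
  · intro l s s' ha _ _ hv h
    exact ⟨by rw [ha]; exact h.x, by rw [ha]; exact h.z, by rw [hv 20 (by decide)]; exact h.s⟩
  · intro l s i _ h13 hi h17 h
    rw [conjList_append]
    exact sStmt_spec h13 hi h17 h
  · intro l s i j _ h24 h13 hij hj h17 h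
    rw [conjList_append]
    exact cStmt_spec h24 h13 hij hj h17 h
  · intro l s i _ h24 hi h17 h
    rw [conjList_append]
    exact hStmt_spec h24 hi h17 h

end

end PauliLearning

namespace PauliLearning

section

variable {Q X : Type} {D : Device Q X} {inp : List ℕ}

/-! ### Refining a set of Pauli operators -/

/-- Variable `14` becomes nonzero if the Pauli operator in arrays `0, 1` anticommutes with the one
whose number is in variable `4`. -/
def antiTest : Stmt Q := unpack 4 2 3 ;; commute

theorem antiTest_spec {n q q' : ℕ} {s : Store X} (hn : s.p 0 = n) (hx : Bits n (s.a 0) (qx q))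
    (hz : Bits n (s.a 1) (qz q)) (h4 : s.v 4 = q') :
    (antiTest.eval D inp s).v 14 ≠ 0 ↔ sympQ n q q' ≠ 0 := by
  subst h4
  obtain ⟨h2, h3⟩ := unpack_spec (D := D) (inp := inp) (q := 4) (ax := 2) (az := 3) hn (by decide)
  rw [antiTest, Stmt.eval_seq, commute_spec (n := n) (x := qx q) (z := qz q) (x' := qx (s.v 4))
    (z' := qz (s.v 4)) (by rw [Stmt.eval_p, hn]) _ _ h2 h3, sympQ, ZMod.val_ne_zero]
  · rwa [Stmt.eval_a _ _ rfl]
  · rwa [Stmt.eval_a _ _ rfl]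

/-- Array `5` is the indicator function of `T`. -/
def SetRep (n : ℕ) (s : Store X) (T : ℕ → Bool) : Prop := ∀ q < 4 ^ n, bitsOf (s.a 5) q = T q

/-- Variables `45` and `46` hold the result of `findAnti`. -/
def FindRep (s : Store X) : Option ℕ → Prop
  | none => s.v 45 = 0
  | some q => s.v 45 = 1 ∧ s.v 46 = q

/-- Search for partners of the operator with number `v 3`. -/
def findPartner : Stmt Q :=
  unpack 3 0 1 ;; .loop 4 4 (.rd 37 5 4 ;; .ite 37 (antiTest ;;
    .ite 14 (.set 45 1 ;; .mov 46 3) nop) nop)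

def findStmt : Stmt Q :=
  .set 45 0 ;; .set 46 0 ;; .loop 3 4 (.rd 37 5 3 ;; .ite 37 findPartner nop)

theorem findPartner_spec {n q : ℕ} {s : Store X} {T : ℕ → Bool} {o : Option ℕ} (hn : s.p 0 = n)
    (hW : s.p 4 = 4 ^ n) (hT : SetRep n s T) (h3 : s.v 3 = q) (ho : FindRep s o) :
    FindRep (findPartner.eval D inp s)
      (if ∃ q' < 4 ^ n, T q' ∧ sympQ n q q' ≠ 0 then some q else o) := by
  classical
  obtain ⟨hx, hz⟩ := unpack_spec (D := D) (inp := inp) (q := 3) (ax := 0) (az := 1) hn (by decide)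
  rw [findPartner, Stmt.eval_seq]
  rw [h3] at hx hz
  refine (Stmt.loop_inv (N := 4 ^ n) (s := (unpack 3 0 1).eval D inp s)
    (fun k (s' : Store X) => FindRep s' (if ∃ q' < k, T q' ∧ sympQ n q q' ≠ 0 then some q else o) ∧
      s'.v 3 = q ∧ Bits n (s'.a 0) (qx q) ∧ Bits n (s'.a 1) (qz q) ∧ s'.a 5 = s.a 5)
    (by rw [Stmt.eval_p, hW]) ?_ ?_).1
  · refine ⟨?_, ?_, hx, hz, ?_⟩
    · revert ho
      cases o <;> simp (disch := first | exact id rfl | decide) [FindRep, Stmt.eval_v]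
    · simp (disch := first | exact id rfl | decide) [Stmt.eval_v, h3]
    · simp (disch := first | exact id rfl | decide) [Stmt.eval_a]
  · rintro k hk s' hp ⟨ho', h3', hx', hz', h5⟩
    have hk' : (∃ q' < k + 1, T q' ∧ sympQ n q q' ≠ 0) ↔
        (∃ q' < k, T q' ∧ sympQ n q q' ≠ 0) ∨ (T k ∧ sympQ n q k ≠ 0) := by
      simp only [Nat.lt_succ_iff_lt_or_eq, or_and_right, exists_or, exists_eq_left]
    have hTk := hT k hk
    simp only [Stmt.eval_seq, Stmt.eval_rd, Stmt.eval_ite, eval_nop, Stmt.eval_set, Stmt.eval_mov]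
    have h14 := antiTest_spec (D := D) (inp := inp) (n := n) (q := q) (q' := k)
      (s := (s'.setv 4 k).setv 37 (s.a 5 k)) (by rw [← hn]; simp [hp, Stmt.eval_p]) hx' hz' (by simp)
    have e37 : ((s'.setv 4 k).setv 37 ((s'.setv 4 k).a 5 ((s'.setv 4 k).v 4))) =
        (s'.setv 4 k).setv 37 (s.a 5 k) := by simp [h5]
    rw [e37]
    have hFR : ∀ o (s₁ : Store X), s₁.v 45 = s'.v 45 → s₁.v 46 = s'.v 46 → FindRep s' o →
        FindRep s₁ o := by
      intro o s₁ h1 h2 h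
      cases o <;> simpa [FindRep, h1, h2] using h
    by_cases hT' : T k = true
    · rw [if_pos (by simpa [bitsOf, hT'] using hTk)]
      by_cases hs : sympQ n q k ≠ 0
      · rw [if_pos (h14.mpr hs), if_pos (hk'.mpr (Or.inr ⟨hT', hs⟩))]
        refine ⟨?_, ?_, ?_, ?_, ?_⟩ <;>
          simp (disch := first | exact id rfl | decide) [Stmt.eval_v, Stmt.eval_a, FindRep, h3', hx', hz', h5]
      · rw [if_neg (fun h => hs (h14.mp h))]
        have : (∃ q' < k + 1, T q' ∧ sympQ n q q' ≠ 0) = (∃ q' < k, T q' ∧ sympQ n q q' ≠ 0) := by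
          rw [hk']; simp [hs]
        simp only [this]
        refine ⟨hFR _ _ ?_ ?_ ho', ?_, ?_, ?_, ?_⟩ <;>
          simp (disch := first | exact id rfl | decide) [Stmt.eval_v, Stmt.eval_a, h3', hx', hz', h5]
    · rw [if_neg (by simpa [bitsOf, hT'] using hTk)]
      have : (∃ q' < k + 1, T q' ∧ sympQ n q q' ≠ 0) = (∃ q' < k, T q' ∧ sympQ n q q' ≠ 0) := by
        rw [hk']; simp [hT']
      simp only [this]
      refine ⟨hFR _ _ ?_ ?_ ho', ?_, ?_, ?_, ?_⟩ <;>
        simp (disch := first | exact id rfl | decide) [h3', hx', hz', h5]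

/-- There is no early exit: later finds overwrite earlier ones. This agrees with `findAnti`, which
prefers the largest number. -/
theorem findStmt_spec {n : ℕ} {s : Store X} {T : ℕ → Bool} (hn : s.p 0 = n)
    (hW : s.p 4 = 4 ^ n) (hT : SetRep n s T) :
    FindRep (findStmt.eval D inp s) (findAnti n T (4 ^ n)) := by
  simp only [findStmt, Stmt.eval_seq, Stmt.eval_set]
  refine (Stmt.loop_inv (N := 4 ^ n) (s := (s.setv 45 0).setv 46 0)
    (fun k (s' : Store X) => FindRep s' (findAnti n T k) ∧ s'.a 5 = s.a 5) (by simpa using hW)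
    ?_ ?_).1
  · simp [FindRep, findAnti]
  · rintro k hk s' hp ⟨ho, h5⟩
    have hTk := hT k hk
    simp only [Stmt.eval_seq, Stmt.eval_rd, Stmt.eval_ite, eval_nop]
    rw [findAnti]
    have hFR : ∀ o (s₁ : Store X), s₁.v 45 = s'.v 45 → s₁.v 46 = s'.v 46 → FindRep s' o →
        FindRep s₁ o := by
      intro o s₁ h1 h2 h
      cases o <;> simpa [FindRep, h1, h2] using h
    by_cases hT' : T k = true
    · rw [if_pos (by simpa [bitsOf, hT', h5] using hTk)]
      refine ⟨?_, by simp (disch := first | exact id rfl | decide) [Stmt.eval_a, h5]⟩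
      simp only [hT', true_and]
      refine findPartner_spec (by simpa [hp] using hn) (by simpa [hp] using hW) ?_ (by simp)
        (hFR _ _ (by simp) (by simp) ho)
      intro q hq
      simpa [h5] using hT q hq
    · rw [if_neg (by simpa [bitsOf, hT', h5] using hTk), if_neg (by simp [hT'])]
      exact ⟨hFR _ _ (by simp) (by simp) ho, by simpa using h5⟩

/-- Remove from array `5` what is not related to the operator with number `v 46` as prescribed by
the mark in variable `47`. -/
def filterStmt : Stmt Q :=
  unpack 46 0 1 ;; .rd 47 8 44 ;; .set 48 0 ;; .loop 4 4 (antiTest ;;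
    .ite 14 (.ite 47 nop (.wr 5 4 48)) (.ite 47 (.wr 5 4 48) nop))

def refineStmt : Stmt Q := findStmt ;; .ite 45 filterStmt nop

/-- Filtering in place is safe, because each test compares with the operator kept in arrays 0 and 1
and does not consult the set. -/
theorem filterStmt_spec {n P i : ℕ} {s : Store X} {T : ℕ → Bool} {mk : Bool} (hn : s.p 0 = n)
    (hW : s.p 4 = 4 ^ n) (hT : SetRep n s T) (hP : s.v 46 = P) (hi : s.v 44 = i)
    (hmk : bitsOf (s.a 8) i = mk) :
    SetRep n (filterStmt.eval D inp s)
      (fun q => T q && decide (decide (sympQ n P q ≠ 0) = mk)) := by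
  obtain ⟨hx, hz⟩ := unpack_spec (D := D) (inp := inp) (q := 46) (ax := 0) (az := 1) hn (by decide)
  rw [hP] at hx hz
  simp only [filterStmt, Stmt.eval_seq, Stmt.eval_rd, Stmt.eval_set]
  set s₀ := (unpack 46 0 1).eval D inp s with hs₀
  have e47 : s₀.a 8 (s₀.v 44) = s.a 8 i := by
    simp (disch := first | exact id rfl | decide) [hs₀, Stmt.eval_v, Stmt.eval_a, hi]
  have e5 : s₀.a 5 = s.a 5 := by
    simp (disch := first | exact id rfl | decide) [hs₀, Stmt.eval_a]
  have ep : s₀.p = s.p := Stmt.eval_p _ _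
  have := (Stmt.loop_inv (D := D) (inp := inp) (x := 4) (k := 4)
    (p := antiTest ;; .ite 14 (.ite 47 nop (.wr 5 4 48)) (.ite 47 (.wr 5 4 48) nop)) (N := 4 ^ n)
    (s := (s₀.setv 47 (s₀.a 8 (s₀.v 44))).setv 48 0)
    (fun k (s' : Store X) => (∀ q < 4 ^ n, bitsOf (s'.a 5) q =
        if q < k then T q && decide (decide (sympQ n P q ≠ 0) = mk) else T q) ∧
      s'.v 47 = s.a 8 i ∧ s'.v 48 = 0 ∧ Bits n (s'.a 0) (qx P) ∧ Bits n (s'.a 1) (qz P))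
    (by simpa [ep] using hW) ?_ ?_).1
  · intro q hq
    rw [this q hq, if_pos hq]
  · refine ⟨fun q hq => ?_, ?_, ?_, hx, hz⟩
    · simpa [e5] using hT q hq
    · simpa using e47
    · simp
  · rintro k hk s' hp ⟨h5, h47, h48, hx', hz'⟩
    have h14 := antiTest_spec (D := D) (inp := inp) (n := n) (q := P) (q' := k)
      (s := (s'.setv 4 k)) (by rw [← hn]; simp [hp, ep]) hx' hz' (by simp)
    simp only [Stmt.eval_seq, Stmt.eval_ite, Stmt.eval_wr, eval_nop]
    set s₁ := antiTest.eval D inp (s'.setv 4 k) with hs₁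
    have a1 : s₁.a 0 = s'.a 0 ∧ s₁.a 1 = s'.a 1 ∧ s₁.a 5 = s'.a 5 ∧ s₁.v 47 = s.a 8 i ∧
        s₁.v 48 = 0 ∧ s₁.v 4 = k := by
      simp (disch := first | exact id rfl | decide) [hs₁, Stmt.eval_v, Stmt.eval_a, h47, h48]
    clear_value s₁
    obtain ⟨a10, a11, a15, a147, a148, a14⟩ := a1
    rw [a147]
    have hmk' : s.a 8 i ≠ 0 ↔ mk = true := by rw [← hmk]; simp [bitsOf]
    have keep : (decide (sympQ n P k ≠ 0) = mk) → ∀ q < 4 ^ n, bitsOf (s'.a 5) q =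
        if q < k + 1 then T q && decide (decide (sympQ n P q ≠ 0) = mk) else T q := by
      intro hc q hq
      rw [h5 q hq]
      rcases lt_trichotomy q k with h | h | h
      · rw [if_pos h, if_pos (by omega)]
      · subst h; rw [if_neg (by omega), if_pos (by omega), decide_eq_true hc, Bool.and_true]
      · rw [if_neg (by omega), if_neg (by omega)]
    have del : ¬ (decide (sympQ n P k ≠ 0) = mk) → ∀ q < 4 ^ n,
        bitsOf (Function.update (s'.a 5) k 0) q =
        if q < k + 1 then T q && decide (decide (sympQ n P q ≠ 0) = mk) else T q := by
      intro hc q hq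
      rcases lt_trichotomy q k with h | h | h
      · rw [bitsOf, Function.update_of_ne h.ne, ← bitsOf, h5 q hq, if_pos h, if_pos (by omega)]
      · subst h; rw [if_pos (by omega), decide_eq_false hc]; simp [bitsOf]
      · rw [bitsOf, Function.update_of_ne h.ne', ← bitsOf, h5 q hq, if_neg (by omega),
          if_neg (by omega)]
    by_cases hs : sympQ n P k ≠ 0 <;> by_cases hm : mk = true
    · rw [if_pos (h14.mpr hs), if_pos (hmk'.mpr hm)]
      exact ⟨by simpa [a15] using keep (by simp [hs, hm]), by simpa using a147, by simpa using a148,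
        by simpa [a10] using hx', by simpa [a11] using hz'⟩
    · rw [if_pos (h14.mpr hs), if_neg (fun h => hm (hmk'.mp h))]
      exact ⟨by simpa [a15, a14, a148] using del (by simp [hs, hm]), by simpa using a147,
        by simpa using a148, by simpa [a10] using hx', by simpa [a11] using hz'⟩
    · rw [if_neg (fun h => hs (h14.mp h)), if_pos (hmk'.mpr hm)]
      exact ⟨by simpa [a15, a14, a148] using del (by simp [hs, hm]), by simpa using a147,
        by simpa using a148, by simpa [a10] using hx', by simpa [a11] using hz'⟩
    · rw [if_neg (fun h => hs (h14.mp h)), if_neg (fun h => hm (hmk'.mp h))]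
      exact ⟨by simpa [a15] using keep (by simp [hs, hm]), by simpa using a147, by simpa using a148,
        by simpa [a10] using hx', by simpa [a11] using hz'⟩

theorem refineStmt_spec {n i : ℕ} {s : Store X} {T : ℕ → Bool} {mk : Bool} (hn : s.p 0 = n)
    (hW : s.p 4 = 4 ^ n) (hT : SetRep n s T) (hi : s.v 44 = i) (hmk : bitsOf (s.a 8) i = mk) :
    SetRep n (refineStmt.eval D inp s) (refine n T mk) := by
  have hf := findStmt_spec (D := D) (inp := inp) hn hW hT
  have hT' : SetRep n (findStmt.eval D inp s) T := by
    intro q hq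
    rw [Stmt.eval_a _ _ rfl]
    exact hT q hq
  rw [refineStmt, Stmt.eval_seq, Stmt.eval_ite, refine]
  cases e : findAnti n T (4 ^ n) with
  | none =>
    rw [e] at hf
    rw [if_neg (by simpa [FindRep] using hf)]
    exact hT'
  | some P =>
    rw [e] at hf
    simp only [FindRep] at hf
    rw [if_pos (by rw [hf.1]; decide)]
    refine filterStmt_spec (by rwa [Stmt.eval_p]) (by rwa [Stmt.eval_p]) hT' hf.2 (i := i) ?_ ?_
    · rwa [Stmt.eval_v _ _ rfl]
    · rwa [Stmt.eval_a _ _ rfl]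

def refineLoop : Stmt Q := .loop 44 2 refineStmt

theorem refineLoop_spec {n : ℕ} {s : Store X} {T : ℕ → Bool} (hn : s.p 0 = n) (hn2 : s.p 2 = 2 * n)
    (hW : s.p 4 = 4 ^ n) (hT : SetRep n s T) :
    SetRep n (refineLoop.eval D inp s) (refineSeq n T (bitsOf (s.a 8)) (2 * n)) := by
  refine (Stmt.loop_inv (fun k (s' : Store X) => SetRep n s' (refineSeq n T (bitsOf (s.a 8)) k) ∧
    s'.a 8 = s.a 8) hn2 ⟨hT, rfl⟩ ?_).1
  rintro k hk s' hp ⟨h5, h8⟩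
  refine ⟨?_, by rw [Stmt.eval_a _ _ rfl]; exact h8⟩
  exact refineStmt_spec (i := k) (by simpa [hp] using hn) (by simpa [hp] using hW) h5 (by simp)
    (by simp [h8])

end

end PauliLearning

namespace PauliLearning

section

variable {Q X : Type} {D : Device Q X} {inp : List ℕ}

/-! ### Diagonalizing a commuting set -/

/-- Variable `50` becomes nonzero if array `0` has a nonzero entry. -/
def anyX : Stmt Q := .set 50 0 ;; .loop 13 0 (.rd 15 0 13 ;; .add 50 50 15)

theorem anyX_spec {n : ℕ} {s : Store X} {x : ℕ → ZMod 2} (hn : s.p 0 = n)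
    (hx : Bits n (s.a 0) x) : (anyX.eval D inp s).v 50 = 0 ↔ ∀ i < n, x i = 0 := by
  simp only [anyX, Stmt.eval_seq, Stmt.eval_set]
  refine (Stmt.loop_inv (N := n) (s := s.setv 50 0)
    (fun k (s' : Store X) => (s'.v 50 = 0 ↔ ∀ i < k, x i = 0) ∧ s'.a 0 = s.a 0)
    (by simpa using hn) (by simp) ?_).1
  rintro k hk s' - ⟨h, ha⟩
  have := hx k hk
  refine ⟨?_, by simpa using ha⟩
  rw [Nat.forall_lt_succ_right]
  simp [h, ha, this]

/-- Append arrays `0` and `1` to array `4`, interleaved, at position `v 49`. -/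
def appendStmt : Stmt Q :=
  .set 17 1 ;; .loop 13 0 (.rd 15 0 13 ;; .wr 4 49 15 ;; .add 49 49 17 ;; .rd 15 1 13 ;;
    .wr 4 49 15 ;; .add 49 49 17)

theorem appendStmt_spec {n g : ℕ} {s : Store X} (hn : s.p 0 = n) (hg : s.v 49 = g) :
    (∀ i < n, (appendStmt.eval D inp s).a 4 (g + 2 * i) = s.a 0 i ∧
        (appendStmt.eval D inp s).a 4 (g + 2 * i + 1) = s.a 1 i) ∧
      (∀ j, j < g ∨ g + 2 * n ≤ j → (appendStmt.eval D inp s).a 4 j = s.a 4 j) ∧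
      (appendStmt.eval D inp s).v 49 = g + 2 * n := by
  simp only [appendStmt, Stmt.eval_seq, Stmt.eval_set]
  have := Stmt.loop_inv (D := D) (inp := inp) (x := 13) (k := 0)
    (p := .rd 15 0 13 ;; .wr 4 49 15 ;; .add 49 49 17 ;; .rd 15 1 13 ;;
      .wr 4 49 15 ;; .add 49 49 17) (N := n) (s := s.setv 17 1)
    (fun k (s' : Store X) => (∀ i < k, s'.a 4 (g + 2 * i) = s.a 0 i ∧
        s'.a 4 (g + 2 * i + 1) = s.a 1 i) ∧
      (∀ j, j < g ∨ g + 2 * k ≤ j → s'.a 4 j = s.a 4 j) ∧ s'.v 49 = g + 2 * k ∧ s'.v 17 = 1 ∧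
      s'.a 0 = s.a 0 ∧ s'.a 1 = s.a 1)
    (by simpa using hn) (by simp [hg]) ?_
  · exact ⟨this.1, this.2.1, this.2.2.1⟩
  rintro k hk s' - ⟨h1, h2, h3, h17, ha0, ha1⟩
  refine ⟨fun i hi => ?_, fun j hj => ?_, ?_, ?_, ?_, ?_⟩
  · rcases Nat.lt_succ_iff_lt_or_eq.mp hi with h | rfl
    · have e1 : g + 2 * i ≠ g + 2 * k + 1 := by omega
      have e3 : g + 2 * i + 1 ≠ g + 2 * k := by omega
      simp [h3, h17, e1, e3, h1 i h, h.ne]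
    · simp [h3, h17, ha0, ha1]
  · have e1 : j ≠ g + 2 * k + 1 := by omega
    have e2 : j ≠ g + 2 * k := by omega
    simp [h3, h17, e1, e2]
    exact h2 j (by omega)
  · simp [h3, h17]; ring
  · simpa using h17
  · simpa using ha0
  · simpa using ha1

def clearStmt : Stmt Q := .set 48 0 ;; .loop 13 6 (.wr 4 13 48)

theorem clearStmt_spec {N : ℕ} {s : Store X} (hN : s.p 6 = N) :
    ∀ k < N, (clearStmt.eval D inp s).a 4 k = 0 := by
  simp only [clearStmt, Stmt.eval_seq, Stmt.eval_set]
  refine (Stmt.loop_inv (N := N) (s := s.setv 48 0)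
    (fun k (s' : Store X) => (∀ i < k, s'.a 4 i = 0) ∧ s'.v 48 = 0)
    (by simpa using hN) (by simp) ?_).1
  rintro k hk s' - ⟨h, h48⟩
  refine ⟨fun i hi => ?_, by simpa using h48⟩
  by_cases hik : i = k
  · simp [hik, h48]
  · simpa [hik] using h i (by omega)

/-- Load the operator with number `v 3`, conjugate it, and look for `X`-bits. -/
def imageStmt : Stmt Q := unpack 3 0 1 ;; .set 20 0 ;; conjStmt

/-- Extend the circuit in array `4` by the operator with number `v 3`. -/
def extendStmt : Stmt Q := imageStmt ;; anyX ;; .ite 50 appendStmt nop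

def basisStmt : Stmt Q :=
  clearStmt ;; .set 49 0 ;; .loop 3 4 (.rd 37 5 3 ;; .ite 37 extendStmt nop)

theorem imageStmt_spec {n q : ℕ} {s : Store X} (hn : s.p 0 = n) (hn2 : s.p 2 = 2 * n)
    (hq : s.v 3 = q) :
    TabRep n (imageStmt.eval D inp s) (conjList (circOps n (bitsOf (s.a 4)) (2 * n)) (tabOf q)) := by
  obtain ⟨hx, hz⟩ := unpack_spec (D := D) (inp := inp) (q := 3) (ax := 0) (az := 1) hn (by decide)
  simp only [imageStmt, Stmt.eval_seq, Stmt.eval_set]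
  have h4 : (((unpack 3 0 1).eval D inp s).setv 20 0).a 4 = s.a 4 := by
    simp (disch := first | exact id rfl | decide) [Stmt.eval_a]
  rw [← h4]
  refine conjStmt_spec (by simpa [Stmt.eval_p] using hn) (by simpa [Stmt.eval_p] using hn2)
    ⟨?_, ?_, ?_⟩
  · simpa [tabOf, hq] using hx
  · simpa [tabOf, hq] using hz
  · simp [tabOf]

/-- The first `N` bits of an array. -/
def truncBits (N : ℕ) (f : ℕ → ℕ) (k : ℕ) : Bool := decide (k < N) && bitsOf f k

/-- The circuit reads only 2n rounds of 2n bits. Truncation provides the zeros that `BasisInv`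
demands, whatever array 4 contains further out. -/
theorem circOps_truncBits (n : ℕ) (f : ℕ → ℕ) :
    circOps n (truncBits (4 * n ^ 2) f) (2 * n) = circOps n (bitsOf f) (2 * n) := by
  refine circOps_congr fun k hk => ?_
  rw [truncBits, decide_eq_true (by nlinarith), Bool.true_and]

theorem extendStmt_spec {n q c : ℕ} {s : Store X} {T : ℕ → Bool} (hn : s.p 0 = n)
    (hn2 : s.p 2 = 2 * n) (hq : s.v 3 = q) (hqn : q < 4 ^ n) (h49 : s.v 49 = c * (2 * n))
    (hT : Commuting n T) (hTq : T q = true)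
    (h : BasisInv n T q (truncBits (4 * n ^ 2) (s.a 4)) c) :
    ∃ c', BasisInv n T (q + 1) (truncBits (4 * n ^ 2) ((extendStmt.eval D inp s).a 4)) c' ∧
      (extendStmt.eval D inp s).v 49 = c' * (2 * n) := by
  have hτ := imageStmt_spec (D := D) (inp := inp) hn hn2 hq
  simp only [extendStmt, Stmt.eval_seq, Stmt.eval_ite, eval_nop]
  set s₁ := imageStmt.eval D inp s with hs₁
  have p1 : s₁.p = s.p := Stmt.eval_p _ _
  have f1 : s₁.a 4 = s.a 4 ∧ s₁.v 49 = s.v 49 := by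
    simp (disch := first | exact id rfl | decide) [hs₁, Stmt.eval_a, Stmt.eval_v]
  clear_value s₁
  have h50 := anyX_spec (D := D) (inp := inp) (by rw [p1, hn]) hτ.x
  set s₂ := anyX.eval D inp s₁ with hs₂
  have p2 : s₂.p = s.p := (Stmt.eval_p _ _).trans p1
  have f2 : s₂.a 4 = s.a 4 ∧ s₂.v 49 = c * (2 * n) ∧ s₂.a 0 = s₁.a 0 ∧ s₂.a 1 = s₁.a 1 := by
    simp (disch := first | exact id rfl | decide) [hs₂, Stmt.eval_a, Stmt.eval_v, f1, h49]
  clear_value s₂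
  rw [← circOps_truncBits] at hτ h50
  set τ := conjList (circOps n (truncBits (4 * n ^ 2) (s.a 4)) (2 * n)) (tabOf q) with hτdef
  by_cases hd : ∀ i < n, τ.x i = 0
  · rw [if_neg (by simpa using h50.mpr hd)]
    exact ⟨c, by simpa [f2] using h.skip fun _ => hd, by simpa using f2.2.1⟩
  · rw [if_pos (by simpa using fun e => hd (h50.mp e))]
    obtain ⟨i₀, hi₀, hx⟩ : ∃ i < n, τ.x i ≠ 0 := by push Not at hd; exact hd
    obtain ⟨a1, a2, a3⟩ := appendStmt_spec (D := D) (inp := inp) (by rw [p2, hn]) f2.2.1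
    refine ⟨c + 1, h.push hT hqn hTq hτdef hi₀ hx ?_ ?_ ?_ ?_, by rw [a3]; ring⟩
    · intro j hj
      rw [truncBits, truncBits, bitsOf, bitsOf, a2 j (Or.inl hj), f2.1]
    · intro j hj
      have hj' : c * (2 * n) + 2 * n ≤ j := by rw [← Nat.succ_mul]; exact hj
      have := h.zero j (by omega)
      rw [truncBits, bitsOf] at this ⊢
      rwa [a2 j (Or.inr hj'), f2.1]
    · intro hc i hi
      have hlt : c * (2 * n) + 2 * i < 4 * n ^ 2 := by
        have : (c + 1) * (2 * n) ≤ 2 * n * (2 * n) := Nat.mul_le_mul_right _ hc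
        nlinarith
      rw [truncBits, decide_eq_true hlt, Bool.true_and, bitsOf, (a1 i hi).1, f2.2.2.1, hτ.x i hi]
      simp [Tableau.bx]
    · intro hc i hi
      have hlt : c * (2 * n) + 2 * i + 1 < 4 * n ^ 2 := by
        have : (c + 1) * (2 * n) ≤ 2 * n * (2 * n) := Nat.mul_le_mul_right _ hc
        nlinarith
      rw [truncBits, decide_eq_true hlt, Bool.true_and, bitsOf, (a1 i hi).2, f2.2.2.2, hτ.z i hi]
      simp [Tableau.bz]

theorem basisStmt_spec {n : ℕ} {s : Store X} {T : ℕ → Bool} (hn : s.p 0 = n)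
    (hn2 : s.p 2 = 2 * n) (hW : s.p 4 = 4 ^ n) (h6 : s.p 6 = 4 * n ^ 2) (hT : SetRep n s T)
    (hc : Commuting n T) :
    ∀ q < 4 ^ n, T q = true → DiagBy n (bitsOf ((basisStmt.eval D inp s).a 4)) q := by
  have h0 := clearStmt_spec (D := D) (inp := inp) h6
  simp only [basisStmt, Stmt.eval_seq, Stmt.eval_set]
  set s₀ := clearStmt.eval D inp s with hs₀
  have p0 : s₀.p = s.p := Stmt.eval_p _ _
  have f0 : s₀.a 5 = s.a 5 := Stmt.eval_a _ _ rfl _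
  have := Stmt.loop_inv (D := D) (inp := inp) (x := 3) (k := 4)
    (p := .rd 37 5 3 ;; .ite 37 extendStmt nop) (N := 4 ^ n) (s := s₀.setv 49 0)
    (fun k (s' : Store X) => (∃ c, BasisInv n T k (truncBits (4 * n ^ 2) (s'.a 4)) c ∧
      s'.v 49 = c * (2 * n)) ∧ s'.a 5 = s.a 5) (by simpa [p0] using hW) ?_ ?_
  · obtain ⟨⟨c, h, -⟩, -⟩ := this
    intro q hq hTq
    have := h.diag q hq hTq
    rwa [DiagBy, circOps_truncBits] at this
  · refine ⟨⟨0, ?_, by simp⟩, by simpa using f0⟩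
    have e : truncBits (4 * n ^ 2) ((s₀.setv 49 0).a 4) = fun _ => false := by
      funext k
      by_cases hk : k < 4 * n ^ 2
      · simp [truncBits, bitsOf, h0 k hk]
      · simp [truncBits, hk]
    rw [e]
    exact BasisInv.init n T
  · rintro k hk s' hp ⟨⟨c, h, h49⟩, h5⟩
    have hp' : s'.p = s.p := hp.trans p0
    have hTk := hT k hk
    simp only [Stmt.eval_seq, Stmt.eval_rd, Stmt.eval_ite, eval_nop]
    by_cases hT' : T k = true
    · rw [if_pos (by simpa [bitsOf, hT', h5] using hTk)]
      refine ⟨extendStmt_spec (by simpa [hp'] using hn) (by simpa [hp'] using hn2) (by simp) hk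
        (by simpa using h49) hc hT' (by simpa using h), ?_⟩
      simpa (disch := first | exact id rfl | decide) [Stmt.eval_a] using h5
    · rw [if_neg (by simpa [bitsOf, hT', h5] using hTk)]
      exact ⟨⟨c, h.skip fun hTk => absurd hTk hT', by simpa using h49⟩, by simpa using h5⟩

end

end PauliLearning

namespace PauliLearning

section

variable {Q X : Type} {D : Device Q X} {inp : List ℕ}

/-! ### Marks -/

/-- Divide variable `39` by parameter `3`; the quotient goes to variable `41`. -/
def divStmt : Stmt Q :=
  .set 17 1 ;; .set 41 0 ;; .loop 13 7 (.par 42 3 ;; .add 43 39 17 ;; .sub 43 43 42 ;;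
    .ite 43 (.sub 39 39 42 ;; .add 41 41 17) nop)

/-- Division by repeated subtraction. The number of rounds has to be a parameter; `L` rounds suffice
because J < L. -/
theorem divStmt_spec {b L J : ℕ} {s : Store X} (hb : s.p 3 = b) (hb0 : 0 < b) (hL : s.p 7 = L)
    (hJ : J < L) (h39 : s.v 39 = J) :
    (divStmt.eval D inp s).v 39 = J % b ∧ (divStmt.eval D inp s).v 41 = J / b ∧
      (divStmt.eval D inp s).v 17 = 1 := by
  simp only [divStmt, Stmt.eval_seq, Stmt.eval_set]
  have := Stmt.loop_inv (D := D) (inp := inp) (x := 13) (k := 7)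
    (p := .par 42 3 ;; .add 43 39 17 ;; .sub 43 43 42 ;;
      .ite 43 (.sub 39 39 42 ;; .add 41 41 17) nop) (N := L) (s := (s.setv 17 1).setv 41 0)
    (fun k (s' : Store X) => s'.v 39 + b * s'.v 41 = J ∧ s'.v 17 = 1 ∧ (s'.v 39 < b ∨ s'.v 41 = k))
    (by simpa using hL) (by simp [h39]) ?_
  · obtain ⟨h1, h2, h3⟩ := this
    generalize (Stmt.loop 13 7 _).eval D inp _ = s' at h1 h2 h3 ⊢
    have h4 : s'.v 39 < b := by
      rcases h3 with h3 | h3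
      · exact h3
      -- If no round was idle, then b · L ≤ J < L, which is absurd.
      · rw [h3] at h1
        nlinarith
    rw [← h1]
    refine ⟨?_, ?_, h2⟩
    · rw [Nat.add_mul_mod_self_left, Nat.mod_eq_of_lt h4]
    · rw [Nat.add_mul_div_left _ _ hb0, Nat.div_eq_of_lt h4, zero_add]
  · rintro k hk s' hp ⟨h1, h2, h3⟩
    have hb' : s'.p 3 = b := by simpa [hp] using hb
    simp only [Stmt.eval_seq, Stmt.eval_ite, Stmt.eval_par, Stmt.eval_add, Stmt.eval_sub, eval_nop]
    by_cases h : b ≤ s'.v 39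
    · rw [if_pos (by simp [hb', h2]; omega)]
      simp [hb', h2]
      refine ⟨?_, Or.inr (by omega)⟩
      rw [← h1, mul_add]
      omega
    · rw [if_neg (by simp [hb', h2]; omega)]
      simp [h2, h1]
      omega

def clearMarks : Stmt Q := .set 38 0 ;; .loop 13 3 (.wr 8 13 38)

theorem clearMarks_spec {N : ℕ} {s : Store X} (hN : s.p 3 = N) :
    ∀ k < N, (clearMarks.eval D inp s).a 8 k = 0 := by
  simp only [clearMarks, Stmt.eval_seq, Stmt.eval_set]
  refine (Stmt.loop_inv (N := N) (s := s.setv 38 0)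
    (fun k (s' : Store X) => (∀ i < k, s'.a 8 i = 0) ∧ s'.v 38 = 0)
    (by simpa using hN) (by simp) ?_).1
  rintro k hk s' - ⟨h, h48⟩
  refine ⟨fun i hi => ?_, by simpa using h48⟩
  by_cases hik : i = k
  · simp [hik, h48]
  · simpa [hik] using h i (by omega)

/-- Write the marks with number `v 40` to array `8`. -/
def marksStmt : Stmt Q :=
  clearMarks ;; .mov 39 40 ;; .loop 22 1 (divStmt ;; .wr 8 39 17 ;; .mov 39 41)

/-- Repeated division peels off the digits. The padding digit `2 * n` writes to a cell that the 2n
refinement steps never consult. -/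
theorem marksStmt_spec {n K L j : ℕ} {s : Store X} (hK : s.p 1 = K) (hb : s.p 3 = 2 * n + 1)
    (hL : s.p 7 = L) (hj : s.v 40 = j) (hjL : j < L) :
    ∀ i < 2 * n, bitsOf ((marksStmt.eval D inp s).a 8) i = marksOf n K j i := by
  have h0 := clearMarks_spec (D := D) (inp := inp) hb
  simp only [marksStmt, Stmt.eval_seq, Stmt.eval_mov]
  set s₀ := clearMarks.eval D inp s with hs₀
  have p0 : s₀.p = s.p := Stmt.eval_p _ _
  have f0 : s₀.v 40 = j := by rw [← hj]; exact Stmt.eval_v _ _ rfl _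
  clear_value s₀
  intro i hi
  refine (Stmt.loop_inv (D := D) (inp := inp) (x := 22) (k := 1)
    (p := divStmt ;; .wr 8 39 17 ;; .mov 39 41) (N := K) (s := s₀.setv 39 (s₀.v 40))
    (fun k (s' : Store X) => (∀ i < 2 * n + 1, bitsOf (s'.a 8) i =
        decide (∃ i' < k, j / (2 * n + 1) ^ i' % (2 * n + 1) = i)) ∧
      s'.v 39 = j / (2 * n + 1) ^ k)
    (by simpa [p0] using hK) ?_ ?_).1 i (by omega)
  · refine ⟨fun i hi => ?_, by simp [f0]⟩
    simp [bitsOf, h0 i hi]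
  · rintro k hk s' hp ⟨h1, h2⟩
    have hp' : s'.p = s.p := hp.trans p0
    obtain ⟨d1, d2, d3⟩ := divStmt_spec (D := D) (inp := inp) (s := s'.setv 22 k) (b := 2 * n + 1)
      (by simpa [hp'] using hb) (by omega) (by simpa [hp'] using hL)
      ((Nat.div_le_self j ((2 * n + 1) ^ k)).trans_lt hjL) (by simpa using h2)
    have d4 : (divStmt.eval D inp (s'.setv 22 k)).a 8 = s'.a 8 := Stmt.eval_a _ _ rfl _
    simp only [Stmt.eval_seq, Stmt.eval_wr, Stmt.eval_mov]
    refine ⟨fun i hi => ?_, ?_⟩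
    · simp only [Nat.lt_succ_iff_lt_or_eq, or_and_right, exists_or, exists_eq_left]
      by_cases hik : j / (2 * n + 1) ^ k % (2 * n + 1) = i
      · simp [bitsOf, d1, d3, hik]
      · have := h1 i hi
        simp only [bitsOf] at this
        simpa [bitsOf, d1, d4, hik, Ne.symm hik] using this
    · simp [d2, Nat.div_div_eq_div_mul, pow_succ]

/-! ### Thresholds -/

/-- The eigenvalue of the Pauli operator with bits `x`, `z` on two copies, after a Bell measurement
with outcome `β`. -/
def bellParity (n : ℕ) (x z β : ℕ → ZMod 2) : ZMod 2 :=
  ∑ i ∈ Finset.range n, (x i * z i + x i * β i + z i * β (n + i))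

/-- Process one measurement outcome, stored in array `7` at position `v 31`. -/
def bellParityStmt : Stmt Q :=
  .set 17 1 ;; .set 14 0 ;; .loop 13 0 (.rd 15 0 13 ;; .rd 16 1 13 ;; toggle 14 15 16 ;;
    .rd 36 7 31 ;; toggle 14 15 36 ;; .par 37 0 ;; .add 37 37 31 ;; .rd 36 7 37 ;;
    toggle 14 16 36 ;; .add 31 31 17) ;; .par 37 0 ;; .add 31 31 37

theorem bellParityStmt_spec {n g : ℕ} {s : Store X} {x z β : ℕ → ZMod 2} (hn : s.p 0 = n)
    (hx : Bits n (s.a 0) x) (hz : Bits n (s.a 1) z) (hg : s.v 31 = g)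
    (hβ : ∀ i < 2 * n, s.a 7 (g + i) = (β i).val) :
    (bellParityStmt.eval D inp s).v 14 = (bellParity n x z β).val ∧
      (bellParityStmt.eval D inp s).v 31 = g + 2 * n ∧ (bellParityStmt.eval D inp s).v 17 = 1 := by
  simp only [bellParityStmt, Stmt.eval_seq, Stmt.eval_set, Stmt.eval_par, Stmt.eval_add]
  have := Stmt.loop_inv (D := D) (inp := inp) (x := 13) (k := 0)
    (p := .rd 15 0 13 ;; .rd 16 1 13 ;; toggle 14 15 16 ;;
      .rd 36 7 31 ;; toggle 14 15 36 ;; .par 37 0 ;; .add 37 37 31 ;; .rd 36 7 37 ;;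
      toggle 14 16 36 ;; .add 31 31 17) (N := n) (s := (s.setv 17 1).setv 14 0)
    (fun k (s' : Store X) => s'.v 14 =
        (∑ i ∈ Finset.range k, (x i * z i + x i * β i + z i * β (n + i))).val ∧
      s'.v 31 = g + k ∧ s'.v 17 = 1 ∧ s'.a = s.a) (by simpa using hn) (by simp [hg]) ?_
  · obtain ⟨h1, h2, h3, -⟩ := this
    set s' := Stmt.eval D inp (Stmt.loop 13 0 _) _ with hs'
    have p' : s'.p = s.p := Stmt.eval_p _ _
    clear_value s'
    refine ⟨?_, ?_, ?_⟩
    · simpa [bellParity] using h1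
    · simp [p', hn, h2]; ring
    · simpa using h3
  · rintro k hk s' hp ⟨h1, h2, h3, h4⟩
    have fa : ∀ b (s₁ : Store X) p x y, ((toggle p x y).eval D inp s₁).a b = s₁.a b :=
      fun b s₁ p x y => Stmt.eval_a _ _ rfl _
    have fp : ∀ (s₁ : Store X) p x y, ((toggle p x y).eval D inp s₁).p = s₁.p :=
      fun s₁ p x y => Stmt.eval_p _ _
    have fv : ∀ (s₁ : Store X) x y z, z ≠ 19 → z ≠ 14 →
        ((toggle 14 x y).eval D inp s₁).v z = s₁.v z := by
      intro s₁ x y z h19 h14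
      refine Stmt.eval_v _ _ ?_ _
      simp [toggle, nop, Stmt.assigns, h19.symm, h14.symm]
    have hβ1 := hβ k (by omega)
    have hβ2 := hβ (n + k) (by omega)
    have e : n + (g + k) = g + (n + k) := by omega
    have hn' : s'.p 0 = n := by simpa [hp] using hn
    simp only [Stmt.eval_seq, Stmt.eval_rd, Stmt.eval_par, Stmt.eval_add]
    refine ⟨?_, ?_, ?_, ?_⟩
    · rw [Finset.sum_range_succ, ← add_assoc, ← add_assoc]
      simp only [Store.setv_v]
      rw [Function.update_of_ne (by decide)]
      refine toggle_spec (by decide) ?_ ?_ ?_ ?_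
      · simp [fv, h3]
      · simp only [Store.setv_v]
        rw [Function.update_of_ne (by decide), Function.update_of_ne (by decide),
          Function.update_of_ne (by decide)]
        refine toggle_spec (by decide) ?_ ?_ ?_ ?_
        · simp [fv, h3]
        · simp only [Store.setv_v]
          rw [Function.update_of_ne (by decide)]
          refine toggle_spec (by decide) ?_ ?_ ?_ ?_
          · simp [h3]
          · simpa using h1
          · simp [h4, hx k hk]
          · simp [h4, hz k hk]
        · simp [fv, h4, hx k hk]
        · simp [fv, fa, h4, h2, hβ1]
      · simp [fv, h4, hz k hk]
      · simp [fv, fa, fp, h4, h2, hn', e, hβ2]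
    · simp [fv, h2, h3]; ring
    · simp [fv, h3]
    · funext b
      simp [fa, h4]

/-- Count the Bell measurements with parity zero. -/
def countStmt : Stmt Q :=
  .set 35 0 ;; .set 31 0 ;; .loop 32 5 (bellParityStmt ;; .ite 14 nop (.add 35 35 17))

theorem countStmt_spec {n m : ℕ} {s : Store X} {x z : ℕ → ZMod 2} {β : ℕ → ℕ → ZMod 2}
    (hn : s.p 0 = n) (hm : s.p 5 = m) (hx : Bits n (s.a 0) x) (hz : Bits n (s.a 1) z)
    (hβ : ∀ t < m, ∀ i < 2 * n, s.a 7 (t * (2 * n) + i) = (β t i).val) :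
    (countStmt.eval D inp s).v 35 =
      ((Finset.range m).filter fun t => bellParity n x z (β t) = 0).card := by
  simp only [countStmt, Stmt.eval_seq, Stmt.eval_set]
  refine (Stmt.loop_inv (D := D) (inp := inp) (x := 32) (k := 5)
    (p := bellParityStmt ;; .ite 14 nop (.add 35 35 17)) (N := m) (s := (s.setv 35 0).setv 31 0)
    (fun k (s' : Store X) => s'.v 35 =
        ((Finset.range k).filter fun t => bellParity n x z (β t) = 0).card ∧
      s'.v 31 = k * (2 * n) ∧ s'.a 0 = s.a 0 ∧ s'.a 1 = s.a 1 ∧ s'.a 7 = s.a 7)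
    (by simpa using hm) (by simp) ?_).1
  rintro k hk s' hp ⟨h1, h2, h3, h4, h5⟩
  obtain ⟨b1, b2, b3⟩ := bellParityStmt_spec (D := D) (inp := inp) (s := s'.setv 32 k) (n := n)
    (g := k * (2 * n)) (x := x) (z := z) (β := β k) (by simpa [hp] using hn) (by simpa [h3] using hx)
    (by simpa [h4] using hz) (by simpa using h2) (by simpa [h5] using hβ k hk)
  simp only [Stmt.eval_seq, Stmt.eval_ite, Stmt.eval_add, eval_nop]
  have b4 : (bellParityStmt.eval D inp (s'.setv 32 k)).v 35 = s'.v 35 := by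
    simp (disch := first | exact id rfl | decide) [Stmt.eval_v]
  rw [Finset.range_add_one, Finset.filter_insert]
  by_cases h0 : bellParity n x z (β k) = 0
  · rw [if_neg (by simp [b1, h0]), if_pos h0, Finset.card_insert_of_notMem (by simp)]
    refine ⟨?_, ?_, ?_, ?_, ?_⟩ <;>
      simp (disch := first | exact id rfl | decide) [Stmt.eval_a, b2, b3, b4, h1, h3, h4, h5]
    ring
  · rw [if_pos (by simpa [b1] using h0), if_neg h0]
    refine ⟨?_, ?_, ?_, ?_, ?_⟩ <;>
      simp (disch := first | exact id rfl | decide) [Stmt.eval_a, b2, b4, h1, h3, h4, h5]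
    ring

/-- Compute the set of all operators for which sufficiently many Bell measurements have parity
zero. -/
def thresholdStmt : Stmt Q :=
  .loop 3 4 (unpack 3 0 1 ;; countStmt ;; .par 37 8 ;; .sub 37 37 35 ;;
    .ite 37 (.set 37 0) (.set 37 1) ;; .wr 6 3 37)

/-- Truncated subtraction decides the comparison: `H` minus the count is 0 exactly if the count
reaches `H`. -/
theorem thresholdStmt_spec {n m H : ℕ} {s : Store X} {β : ℕ → ℕ → ZMod 2}
    (hn : s.p 0 = n) (hm : s.p 5 = m) (hW : s.p 4 = 4 ^ n) (hH : s.p 8 = H)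
    (hβ : ∀ t < m, ∀ i < 2 * n, s.a 7 (t * (2 * n) + i) = (β t i).val) :
    ∀ q < 4 ^ n, bitsOf ((thresholdStmt.eval D inp s).a 6) q =
      decide (H ≤ ((Finset.range m).filter fun t => bellParity n (qx q) (qz q) (β t) = 0).card) := by
  refine (Stmt.loop_inv (D := D) (inp := inp) (N := 4 ^ n) (s := s)
    (fun k (s' : Store X) => (∀ q < k, bitsOf (s'.a 6) q = decide (H ≤ ((Finset.range m).filter
        fun t => bellParity n (qx q) (qz q) (β t) = 0).card)) ∧ s'.a 7 = s.a 7)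
    hW (by simp) ?_).1
  rintro k hk s' hp ⟨h1, h7⟩
  obtain ⟨hx, hz⟩ := unpack_spec (D := D) (inp := inp) (q := 3) (ax := 0) (az := 1) (n := n)
    (s := s'.setv 3 k) (by simpa [hp] using hn) (by decide)
  simp only [Stmt.eval_seq, Stmt.eval_par, Stmt.eval_sub, Stmt.eval_ite, Stmt.eval_set,
    Stmt.eval_wr]
  set s₁ := (unpack 3 0 1).eval D inp (s'.setv 3 k) with hs₁
  have p1 : s₁.p = s.p := (Stmt.eval_p _ _).trans hp
  have f1 : s₁.a 7 = s.a 7 ∧ s₁.a 6 = s'.a 6 ∧ s₁.v 3 = k := by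
    simp (disch := first | exact id rfl | decide) [hs₁, Stmt.eval_a, Stmt.eval_v, h7]
  clear_value s₁
  obtain ⟨f17, f16, f13⟩ := f1
  have hc := countStmt_spec (D := D) (inp := inp) (s := s₁) (n := n) (m := m) (by rw [p1, hn])
    (by rw [p1, hm]) hx hz (β := β) (by rw [f17]; exact hβ)
  set s₂ := countStmt.eval D inp s₁ with hs₂
  have p2 : s₂.p = s.p := (Stmt.eval_p _ _).trans p1
  have f2 : s₂.a 7 = s.a 7 ∧ s₂.a 6 = s'.a 6 ∧ s₂.v 3 = k := by
    simp (disch := first | exact id rfl | decide) [hs₂, Stmt.eval_a, Stmt.eval_v, f17, f16, f13]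
  clear_value s₂
  obtain ⟨f27, f26, f23⟩ := f2
  simp only [Store.setv_v, Function.update_self, p2, hH] at hc ⊢
  have key : ∀ b : ℕ, b = (if H ≤ s₂.v 35 then 1 else 0) → ∀ q < k + 1,
      bitsOf (Function.update (s'.a 6) k b) q = decide (H ≤ ((Finset.range m).filter
        fun t => bellParity n (qx q) (qz q) (β t) = 0).card) := by
    rintro b rfl q hq
    by_cases hqk : q = k
    · subst hqk
      rw [bitsOf, Function.update_self, hc]
      split_ifs with h <;> simp [h]
    · rw [bitsOf, Function.update_of_ne hqk, ← bitsOf]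
      exact h1 q (by omega)
  split_ifs with h
  · refine ⟨?_, by simp [f27]⟩
    simpa [f23, f26] using key 0 (by rw [if_neg]; simp at h; omega)
  · refine ⟨?_, by simp [f27]⟩
    simpa [f23, f26] using key 1 (by rw [if_pos]; simp at h; omega)

/-- Copy array `6` to array `5`. -/
def copyStmt : Stmt Q := .loop 3 4 (.rd 37 6 3 ;; .wr 5 3 37)

theorem copyStmt_spec {N : ℕ} {s : Store X} (hN : s.p 4 = N) :
    ∀ k < N, (copyStmt.eval D inp s).a 5 k = s.a 6 k := by
  refine (Stmt.loop_inv (N := N) (fun k (s' : Store X) => (∀ i < k, s'.a 5 i = s.a 6 i) ∧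
    s'.a 6 = s.a 6) hN (by simp) ?_).1
  rintro k hk s' - ⟨h, h6⟩
  refine ⟨fun i hi => ?_, by simpa using h6⟩
  by_cases hik : i = k
  · simp [hik, h6]
  · simpa [hik] using h i (by omega)

end

end PauliLearning

/-! ### The learning program and its measurements. -/

namespace PauliLearning

/-! ### Bell measurements -/

/-- The gates that turn the Bell basis of the first `k` pairs of qubits `i`, `n + i` into the
computational basis. -/
def bellOps (n : ℕ) : ℕ → List Op
  | 0 => []
  | k + 1 => bellOps n k ++ [.C k (n + k), .H k]

/-- The image of `P ⊗ P` under `bellOps n k`. -/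
def bellTableau (n : ℕ) (x z : ℕ → ZMod 2) (k : ℕ) : Tableau :=
  ⟨fun j => if j < n then (if j < k then 0 else x j) else if j - n < k then 0 else x (j - n),
    fun j => if j < n then (if j < k then x j else z j) else z (j - n),
    ∑ i ∈ Finset.range k, x i * z i⟩

theorem bellOps_ok {n k : ℕ} (hk : k ≤ n) : ∀ g ∈ bellOps n k, g.Ok (n + n) := by
  induction k with
  | zero => simp [bellOps]
  | succ k ih =>
    intro g hg
    simp only [bellOps, List.mem_append, List.mem_cons, List.not_mem_nil, or_false] at hg
    rcases hg with h | rfl | rfl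
    · exact ih (by omega) g h
    · simp only [Op.Ok]; omega
    · simp only [Op.Ok]; omega

/-- On each pair of qubits, CNOT followed by a Hadamard gate maps X⊗X to Z⊗𝟙, Z⊗Z to 𝟙⊗Z and Y⊗Y to
-Z⊗Z. So all P⊗P become diagonal at once: the X-bits of P turn into Z-bits on the first copy, its
Z-bits remain on the second, and each Y contributes a sign. -/
theorem conjList_bellOps {n k : ℕ} (hk : k ≤ n) (x z : ℕ → ZMod 2) :
    conjList (bellOps n k) (bellTableau n x z 0) = bellTableau n x z k := by
  induction k with
  | zero => rfl
  | succ k ih =>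
    rw [bellOps, conjList_append, ih (by omega)]
    simp only [conjList, List.foldl_cons, List.foldl_nil, Op.act, bellTableau]
    have h1 : k < n := by omega
    have h2 : ¬ n + k < n := by omega
    have h3 : n + k ≠ k := by omega
    rw [Tableau.mk.injEq]
    refine ⟨?_, ?_, ?_⟩
    · funext j
      simp only [Function.update_apply, h1, h2, if_true, if_false, lt_irrefl]
      by_cases hjk : j = k
      · subst hjk
        simp [h1, add_self_zmod2]
      · by_cases hj : j = n + k
        · subst hj
          simp [h2, add_self_zmod2]
        · simp only [hjk, hj, if_false]
          by_cases hjn : j < n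
          · simp only [hjn, if_true]
            by_cases h : j < k
            · rw [if_pos h, if_pos (by omega)]
            · rw [if_neg h, if_neg (by omega)]
          · simp only [hjn, if_false]
            by_cases h : j - n < k
            · rw [if_pos h, if_pos (by omega)]
            · rw [if_neg h, if_neg (by omega)]
    · funext j
      simp only [Function.update_apply, h1, h2, if_true, if_false, lt_irrefl]
      by_cases hjk : j = k
      · subst hjk
        simp [h1, show n ≠ 0 by omega]
      · simp only [hjk, if_false]
        by_cases hjn : j < n
        · simp only [hjn, if_true]
          by_cases h : j < k
          · rw [if_pos h, if_pos (by omega)]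
          · rw [if_neg h, if_neg (by omega)]
        · simp only [hjn, if_false]
    · rw [Finset.sum_range_succ]
      simp only [Function.update_self, h1, h2, h3.symm, if_true, if_false, lt_irrefl, ne_eq,
        not_false_eq_true, Function.update_of_ne, Nat.add_sub_cancel_left, add_self_zmod2, mul_zero,
        add_zero]
      generalize x k = a
      generalize z k = b
      congr 1
      revert a b
      decide

/-- The circuit of a Bell measurement. -/
def bellCircuit (n : ℕ) : List (Gate (n + n)) := (bellOps n n).flatMap (Op.gates (n + n))

/-- The circuit that is described by `γ`, on the first copy of the state. -/
def classCircuit (n : ℕ) (γ : ℕ → Bool) : List (Gate (n + n)) :=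
  (circOps n γ (2 * n)).flatMap (Op.gates (n + n))

/-! ### The quantum part of the learning program -/

section

variable {n : ℕ} {ω : ℕ → Fin (n + n) → Bool} {inp : List ℕ}

/-- Measurements of the circuits `l` take place, and the bits `b` are written to the output. -/
structure Advance (x x' : QState n) (l : List (List (Gate (n + n)))) (b : List Bool) : Prop where
  circuit : x'.circuit = []
  copies : x'.copies = x.copies + 2 * l.length
  log : x'.log = x.log ++ l
  out : x'.out = x.out ++ b

theorem Advance.refl {x : QState n} (h : x.circuit = []) : Advance x x [] [] :=
  ⟨h, by simp, by simp, by simp⟩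

theorem Advance.trans {x x' x'' : QState n} {l l' b b'} (h : Advance x x' l b)
    (h' : Advance x' x'' l' b') : Advance x x'' (l ++ l') (b ++ b') :=
  ⟨h'.circuit, by rw [h'.copies, h.copies, List.length_append]; ring,
    by rw [h'.log, h.log, List.append_assoc], by rw [h'.out, h.out, List.append_assoc]⟩

section

variable (s : Store (QState n)) (x y : ℕ)

@[simp] theorem eval_gateH : (Stmt.ext (.gateH x)).eval (tapeDevice ω) inp s =
    { s with x := { s.x with circuit := s.x.circuit ++ gateH? (n + n) (s.v x) } } := rfl

@[simp] theorem eval_gateS : (Stmt.ext (.gateS x)).eval (tapeDevice ω) inp s =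
    { s with x := { s.x with circuit := s.x.circuit ++ gateS? (n + n) (s.v x) } } := rfl

@[simp] theorem eval_gateCNOT : (Stmt.ext (.gateCNOT x y)).eval (tapeDevice ω) inp s =
    { s with x := { s.x with circuit := s.x.circuit ++ gateCNOT? (n + n) (s.v x) (s.v y) } } := rfl

@[simp] theorem eval_measure : (Stmt.ext .measure).eval (tapeDevice ω) inp s =
    { s with x := ⟨[], ω s.x.log.length, s.x.copies + 2, s.x.out, s.x.log ++ [s.x.circuit]⟩ } := rfl

@[simp] theorem eval_readout : (Stmt.ext (.readout x y)).eval (tapeDevice ω) inp s =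
    s.setv x (bitAt s.x.outcome (s.v y)) := rfl

@[simp] theorem eval_emit : (Stmt.ext (.emit x)).eval (tapeDevice ω) inp s =
    { s with x := { s.x with out := s.x.out ++ [decide (s.v x ≠ 0)] } } := rfl

end

/-- Apply the circuit of a Bell measurement. -/
def bellCircuitStmt : Stmt LearnerInstr :=
  .loop 13 0 (.par 33 0 ;; .add 33 33 13 ;; .ext (.gateCNOT 13 33) ;; .ext (.gateH 13))

theorem bellCircuitStmt_spec {s : Store (QState n)} (hn : s.p 0 = n) :
    (bellCircuitStmt.eval (tapeDevice ω) inp s).x =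
      { s.x with circuit := s.x.circuit ++ bellCircuit n } := by
  refine Stmt.loop_inv (fun k (s' : Store (QState n)) => s'.x =
    { s.x with circuit := s.x.circuit ++ (bellOps n k).flatMap (Op.gates (n + n)) }) hn
    (by simp [bellOps]) ?_
  rintro k hk s' hp h
  have hn' : s'.p 0 = n := by rw [hp, hn]
  simp [h, hn', bellOps, Op.gates]

/-- Perform Bell measurements and write the outcomes to array `7`. -/
def bellStmt : Stmt LearnerInstr :=
  .set 17 1 ;; .set 31 0 ;; .loop 32 5 (bellCircuitStmt ;; .ext .measure ;;
    .loop 13 2 (.ext (.readout 34 13) ;; .wr 7 31 34 ;; .add 31 31 17))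

theorem bellStmt_spec {s : Store (QState n)} {m : ℕ} (hn : s.p 0 = n) (hn2 : s.p 2 = 2 * n)
    (hm : s.p 5 = m) (hc : s.x.circuit = []) (hl : s.x.log = []) :
    Advance s.x (bellStmt.eval (tapeDevice ω) inp s).x (List.replicate m (bellCircuit n)) [] ∧
      ∀ t < m, ∀ i < 2 * n,
        (bellStmt.eval (tapeDevice ω) inp s).a 7 (t * (2 * n) + i) = bitAt (ω t) i := by
  simp only [bellStmt, Stmt.eval_seq, Stmt.eval_set]
  have := Stmt.loop_inv (D := tapeDevice ω) (inp := inp) (x := 32) (k := 5)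
    (p := bellCircuitStmt ;; .ext .measure ;;
      .loop 13 2 (.ext (.readout 34 13) ;; .wr 7 31 34 ;; .add 31 31 17)) (N := m)
    (s := (s.setv 17 1).setv 31 0)
    (fun k (s' : Store (QState n)) => Advance s.x s'.x (List.replicate k (bellCircuit n)) [] ∧
      (∀ t < k, ∀ i < 2 * n, s'.a 7 (t * (2 * n) + i) = bitAt (ω t) i) ∧ s'.v 31 = k * (2 * n) ∧
      s'.v 17 = 1) (by simpa using hm) ⟨Advance.refl hc, by simp, by simp, by simp⟩ ?_
  · exact ⟨this.1, this.2.1⟩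
  rintro k hk s' hp ⟨hA, h7, h31, h17⟩
  have hp' : s'.p = s.p := hp
  have hx := bellCircuitStmt_spec (ω := ω) (inp := inp) (s := s'.setv 32 k) (by simpa [hp'] using hn)
  simp only [Stmt.eval_seq, eval_measure]
  set s₁ := bellCircuitStmt.eval (tapeDevice ω) inp (s'.setv 32 k) with hs₁
  have f1 : s₁.a 7 = s'.a 7 ∧ s₁.v 31 = k * (2 * n) ∧ s₁.v 17 = 1 ∧ s₁.p = s.p := by
    simp (disch := first | exact id rfl | decide) [hs₁, Stmt.eval_a, Stmt.eval_v, Stmt.eval_p, h31,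
      h17, hp']
  clear_value s₁
  obtain ⟨f7, f31, f17, fp⟩ := f1
  have hlog : s₁.x.log.length = k := by rw [hx]; simp [hA.log, hl]
  have hstep : Advance s'.x (⟨[], ω s₁.x.log.length, s₁.x.copies + 2, s₁.x.out,
      s₁.x.log ++ [s₁.x.circuit]⟩ : QState n) [bellCircuit n] [] := by
    refine ⟨rfl, ?_, ?_, ?_⟩ <;> simp [hx, hA.circuit]
  have hA' := hA.trans hstep
  rw [← List.replicate_succ', List.append_nil] at hA'
  rw [hlog] at hA' ⊢
  generalize hy : (⟨[], ω k, s₁.x.copies + 2, s₁.x.out, s₁.x.log ++ [s₁.x.circuit]⟩ : QState n)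
    = y at hA' ⊢
  have hout : y.outcome = ω k := by rw [← hy]
  have := Stmt.loop_inv (D := tapeDevice ω) (inp := inp) (x := 13) (k := 2)
    (p := .ext (.readout 34 13) ;; .wr 7 31 34 ;; .add 31 31 17) (N := 2 * n)
    (s := { s₁ with x := y })
    (fun i (s'' : Store (QState n)) => s''.x = y ∧
      (∀ j, (∀ i' < i, j ≠ k * (2 * n) + i') → s''.a 7 j = s'.a 7 j) ∧
      (∀ i' < i, s''.a 7 (k * (2 * n) + i') = bitAt (ω k) i') ∧
      s''.v 31 = k * (2 * n) + i ∧ s''.v 17 = 1) (by simpa [fp] using hn2)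
      ⟨rfl, fun j _ => by rw [← f7], by simp, by simpa using f31, f17⟩ ?_
  · obtain ⟨i1, i2, i3, i4, i5⟩ := this
    refine ⟨?_, ?_, ?_, i5⟩
    · rw [i1]; exact hA'
    · intro t ht i hi
      rcases Nat.lt_succ_iff_lt_or_eq.mp ht with h | rfl
      · rw [i2 _ fun i' hi' => ?_, h7 t h i hi]
        have : (t + 1) * (2 * n) ≤ k * (2 * n) := Nat.mul_le_mul_right _ h
        rw [Nat.succ_mul] at this
        omega
      · exact i3 i hi
    · rw [i4]; ring
  · rintro i hi s'' hp'' ⟨i1, i2, i3, i4, i5⟩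
    simp only [Stmt.eval_seq, eval_readout, Stmt.eval_wr, Stmt.eval_add]
    refine ⟨by simpa using i1, fun j hj => ?_, fun i' hi' => ?_, ?_, ?_⟩
    · have hne := hj i (by omega)
      simp [i4, hne]
      exact i2 j fun i' hi' => hj i' (by omega)
    · rcases Nat.lt_succ_iff_lt_or_eq.mp hi' with h | rfl
      · have hne : i' ≠ i := by omega
        simp [i4, hne, i3 i' h]
      · simp [i4, i1, hout]
    · simp [i4, i5]; ring
    · simpa using i5

/-! ### Measuring a class of commuting operators -/

/-- Apply the circuit in array `4`. -/
def circuitStmt : Stmt LearnerInstr :=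
  roundsLoop (.ext (.gateS 13)) (.ext (.gateCNOT 24 13)) (.ext (.gateH 24))

theorem circuitStmt_spec {s : Store (QState n)} (hn : s.p 0 = n) (hn2 : s.p 2 = 2 * n) :
    (circuitStmt.eval (tapeDevice ω) inp s).x =
      { s.x with circuit := s.x.circuit ++ classCircuit n (bitsOf (s.a 4)) } := by
  refine roundsLoop_spec (D := tapeDevice ω) (inp := inp) (fun l (s' : Store (QState n)) => s'.x =
    { s.x with circuit := s.x.circuit ++ l.flatMap (Op.gates (n + n)) }) ?_
    ⟨fun _ _ _ => rfl, rfl⟩ ⟨fun _ _ _ => rfl, rfl⟩ ⟨fun _ _ _ => rfl, rfl⟩ ?_ ?_ ?_ hn hn2 (by simp)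
  · intro l s₁ s₂ _ hx _ _ h
    rw [hx, h]
  · intro l s₁ i _ h13 _ _ h
    simp [h, h13, Op.gates]
  · intro l s₁ i j _ h24 h13 _ _ _ h
    simp [h, h13, h24, Op.gates]
  · intro l s₁ i _ h24 _ _ h
    simp [h, h24, Op.gates]

/-- The first `n` bits of a measurement outcome. -/
def outcomeBits (z : Fin (n + n) → Bool) : List Bool :=
  (List.range n).map fun i => decide (bitAt z i ≠ 0)

/-- Measure the circuit in array `4` repeatedly, and output the outcomes on the first copy. -/
def measureStmt : Stmt LearnerInstr :=
  .loop 32 5 (circuitStmt ;; .ext .measure ;; .loop 13 0 (.ext (.readout 15 13) ;; .ext (.emit 15)))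

theorem measureStmt_spec {s : Store (QState n)} {m : ℕ} (hn : s.p 0 = n) (hn2 : s.p 2 = 2 * n)
    (hm : s.p 5 = m) (hc : s.x.circuit = []) :
    Advance s.x (measureStmt.eval (tapeDevice ω) inp s).x
      (List.replicate m (classCircuit n (bitsOf (s.a 4))))
      ((List.range m).flatMap fun t => outcomeBits (ω (s.x.log.length + t))) := by
  refine (Stmt.loop_inv (D := tapeDevice ω) (inp := inp) (N := m)
    (fun k (s' : Store (QState n)) => Advance s.x s'.x
      (List.replicate k (classCircuit n (bitsOf (s.a 4))))
      ((List.range k).flatMap fun t => outcomeBits (ω (s.x.log.length + t))) ∧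
      s'.a 4 = s.a 4) hm ⟨Advance.refl hc, rfl⟩ ?_).1
  rintro k hk s' hp ⟨hA, h4⟩
  have hx := circuitStmt_spec (ω := ω) (inp := inp) (s := s'.setv 32 k) (by simpa [hp] using hn)
    (by simpa [hp] using hn2)
  refine ⟨?_, by rw [Stmt.eval_a _ _ rfl]; exact h4⟩
  simp only [Stmt.eval_seq, eval_measure]
  set s₁ := circuitStmt.eval (tapeDevice ω) inp (s'.setv 32 k) with hs₁
  have fp : s₁.p = s.p := by simp [hs₁, Stmt.eval_p, hp]
  clear_value s₁
  have hlog : s₁.x.log.length = s.x.log.length + k := by rw [hx]; simp [hA.log]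
  set y : QState n := ⟨[], ω s₁.x.log.length, s₁.x.copies + 2, s₁.x.out,
    s₁.x.log ++ [s₁.x.circuit]⟩ with hy
  have := Stmt.loop_inv (D := tapeDevice ω) (inp := inp) (x := 13) (k := 0)
    (p := .ext (.readout 15 13) ;; .ext (.emit 15)) (N := n) (s := { s₁ with x := y })
    (fun i (s'' : Store (QState n)) => s''.x = { y with
      out := y.out ++ (List.range i).map fun i => decide (bitAt (ω (s.x.log.length + k)) i ≠ 0) })
    (by simpa [fp] using hn) (by simp) ?_
  · rw [this, List.range_succ, List.flatMap_append, List.replicate_succ']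
    refine hA.trans ⟨rfl, ?_, ?_, ?_⟩
    · simp [hy, hx]
    · simp [hy, hx, hA.circuit, h4]
    · simp [hy, hx, outcomeBits]
  · intro i hi s'' _ h
    simp only [Stmt.eval_seq, eval_readout, eval_emit]
    simp [h, List.range_succ, hy, hlog]

/-- Output the circuit in array `4`. -/
def emitStmt : Stmt LearnerInstr := .loop 13 6 (.rd 15 4 13 ;; .ext (.emit 15))

theorem emitStmt_spec {s : Store (QState n)} {N : ℕ} (hN : s.p 6 = N) (hc : s.x.circuit = []) :
    Advance s.x (emitStmt.eval (tapeDevice ω) inp s).x [] ((List.range N).map (bitsOf (s.a 4))) := by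
  refine (Stmt.loop_inv (D := tapeDevice ω) (inp := inp) (N := N)
    (fun k (s' : Store (QState n)) => Advance s.x s'.x [] ((List.range k).map (bitsOf (s.a 4))) ∧
      s'.a 4 = s.a 4) hN ⟨Advance.refl hc, rfl⟩ ?_).1
  rintro k hk s' hp ⟨hA, h4⟩
  refine ⟨?_, by simpa using h4⟩
  simp only [Stmt.eval_seq, Stmt.eval_rd, eval_emit]
  rw [List.range_succ, List.map_append]
  exact hA.trans (l' := []) ⟨hA.circuit, by simp, by simp, by simp [h4, bitsOf]⟩

/-- The part of the description that belongs to one class. -/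
def classBits (m : ℕ) (γ : ℕ → Bool) (z : ℕ → Fin (n + n) → Bool) : List Bool :=
  (List.range (4 * n ^ 2)).map γ ++ (List.range m).flatMap fun t => outcomeBits (z t)

/-- The circuit `γ` diagonalizes the class with number `j` if its members commute. -/
def ServesClass (n K : ℕ) (T : ℕ → Bool) (j : ℕ) (γ : ℕ → Bool) : Prop :=
  ∃ marks : ℕ → Bool, (∀ i < 2 * n, marks i = marksOf n K j i) ∧
    (Commuting n (refineSeq n T marks (2 * n)) →
      ∀ q < 4 ^ n, refineSeq n T marks (2 * n) q = true → DiagBy n γ q)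

/-- Process the class with number `v 40`. -/
def classStmt : Stmt LearnerInstr :=
  marksStmt ;; copyStmt ;; refineLoop ;; basisStmt ;; emitStmt ;; measureStmt

/-- The parameters of the learning program. -/
structure LearnParams (s : Store (QState n)) (K m H : ℕ) : Prop where
  pn : s.p 0 = n
  pK : s.p 1 = K
  pn2 : s.p 2 = 2 * n
  pb : s.p 3 = 2 * n + 1
  pW : s.p 4 = 4 ^ n
  pm : s.p 5 = m
  pg : s.p 6 = 4 * n ^ 2
  pL : s.p 7 = (2 * n + 1) ^ K
  pH : s.p 8 = H

theorem LearnParams.congr {s s' : Store (QState n)} {K m H : ℕ} (h : LearnParams s K m H)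
    (hp : s'.p = s.p) : LearnParams s' K m H := by
  obtain ⟨h1, h2, h3, h4, h5, h6, h7, h8, h9⟩ := h
  constructor <;> rwa [hp]

/-- Everything before `measureStmt` is classical, apart from the output. The family given by the
marks need not commute: then its circuit has no guarantee, but it is recorded and measured all the
same. -/
theorem classStmt_spec {s : Store (QState n)} {K m H j : ℕ} {T : ℕ → Bool}
    (h : LearnParams s K m H) (hj : s.v 40 = j) (hjL : j < (2 * n + 1) ^ K)
    (hT : ∀ q < 4 ^ n, bitsOf (s.a 6) q = T q) (hc : s.x.circuit = []) :
    ∃ γ, Advance s.x (classStmt.eval (tapeDevice ω) inp s).x (List.replicate m (classCircuit n γ))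
        (classBits m γ fun t => ω (s.x.log.length + t)) ∧ ServesClass n K T j γ := by
  have hM := marksStmt_spec (D := tapeDevice ω) (inp := inp) h.pK h.pb h.pL hj hjL
  simp only [classStmt, Stmt.eval_seq]
  set s₁ := marksStmt.eval (tapeDevice ω) inp s with hs₁
  have h1 : LearnParams s₁ K m H := h.congr (Stmt.eval_p _ _)
  have f1 : s₁.a 6 = s.a 6 ∧ s₁.x = s.x := ⟨Stmt.eval_a _ _ rfl _, Stmt.eval_x _ rfl _⟩
  clear_value s₁
  have hC := copyStmt_spec (D := tapeDevice ω) (inp := inp) h1.pW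
  set s₂ := copyStmt.eval (tapeDevice ω) inp s₁ with hs₂
  have h2 : LearnParams s₂ K m H := h1.congr (Stmt.eval_p _ _)
  have f2 : s₂.a 8 = s₁.a 8 ∧ s₂.x = s.x :=
    ⟨Stmt.eval_a _ _ rfl _, (Stmt.eval_x _ rfl _).trans f1.2⟩
  clear_value s₂
  have hR := refineLoop_spec (D := tapeDevice ω) (inp := inp) (T := T) h2.pn h2.pn2 h2.pW
    (fun q hq => by rw [bitsOf, hC q hq, f1.1]; exact hT q hq)
  rw [f2.1] at hR
  set s₃ := refineLoop.eval (tapeDevice ω) inp s₂ with hs₃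
  have h3 : LearnParams s₃ K m H := h2.congr (Stmt.eval_p _ _)
  have f3 : s₃.x = s.x := (Stmt.eval_x _ rfl _).trans f2.2
  clear_value s₃
  have hB := basisStmt_spec (D := tapeDevice ω) (inp := inp) h3.pn h3.pn2 h3.pW h3.pg hR
  set s₄ := basisStmt.eval (tapeDevice ω) inp s₃ with hs₄
  have h4 : LearnParams s₄ K m H := h3.congr (Stmt.eval_p _ _)
  have f4 : s₄.x = s.x := (Stmt.eval_x _ rfl _).trans f3
  clear_value s₄
  have hE := emitStmt_spec (ω := ω) (inp := inp) h4.pg (by rw [f4, hc])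
  set s₅ := emitStmt.eval (tapeDevice ω) inp s₄ with hs₅
  have h5 : LearnParams s₅ K m H := h4.congr (Stmt.eval_p _ _)
  have f5 : s₅.a 4 = s₄.a 4 := Stmt.eval_a _ _ rfl _
  clear_value s₅
  have hS := measureStmt_spec (ω := ω) (inp := inp) h5.pn h5.pn2 h5.pm hE.circuit
  refine ⟨bitsOf (s₄.a 4), ?_, bitsOf (s₁.a 8), hM, hB⟩
  have := hE.trans hS
  rw [f5, hE.log, f4] at this
  simpa [classBits] using this

/-- The learning program, once its parameters are known. -/
def learnStmt : Stmt LearnerInstr := bellStmt ;; thresholdStmt ;; .loop 40 7 classStmt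

/-- A measurement outcome as a sequence of bits. -/
def outcomeF (z : Fin (n + n) → Bool) (i : ℕ) : ZMod 2 := (bitAt z i : ZMod 2)

theorem bitAt_eq_val (z : Fin (n + n) → Bool) (i : ℕ) : bitAt z i = (outcomeF z i).val := by
  rw [outcomeF, ZMod.val_natCast, Nat.mod_eq_of_lt]
  rw [bitAt]
  split_ifs
  · exact Bool.toNat_lt _
  · decide

/-- The set of all operators that pass the threshold test. -/
def passes (n m H : ℕ) (ω : ℕ → Fin (n + n) → Bool) (q : ℕ) : Bool :=
  decide (H ≤ ((Finset.range m).filter fun t =>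
    bellParity n (qx q) (qz q) (outcomeF (ω t)) = 0).card)

/-- The tape is consumed in blocks of length m: first the Bell outcomes, then from position `m + j *
m` on those of class `j`. All the classes are processed whatever the outcomes, so the numbers of
measurements and of output bits are deterministic. -/
theorem learnStmt_spec {s : Store (QState n)} {K m H : ℕ} (h : LearnParams s K m H)
    (hc : s.x.circuit = []) (hl : s.x.log = []) :
    ∃ γ : ℕ → ℕ → Bool, (∀ j < (2 * n + 1) ^ K, ServesClass n K (passes n m H ω) j (γ j)) ∧
      Advance s.x (learnStmt.eval (tapeDevice ω) inp s).x
        (List.replicate m (bellCircuit n) ++ (List.range ((2 * n + 1) ^ K)).flatMap fun j =>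
          List.replicate m (classCircuit n (γ j)))
        ((List.range ((2 * n + 1) ^ K)).flatMap fun j =>
          classBits m (γ j) fun t => ω (m + j * m + t)) := by
  obtain ⟨hA, h7⟩ := bellStmt_spec (ω := ω) (inp := inp) h.pn h.pn2 h.pm hc hl
  simp only [learnStmt, Stmt.eval_seq]
  set s₁ := bellStmt.eval (tapeDevice ω) inp s with hs₁
  have h1 : LearnParams s₁ K m H := h.congr (Stmt.eval_p _ _)
  clear_value s₁
  have hT := thresholdStmt_spec (D := tapeDevice ω) (inp := inp) h1.pn h1.pm h1.pW h1.pH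
    (β := fun t => outcomeF (ω t)) fun t ht i hi => by rw [h7 t ht i hi, bitAt_eq_val]
  set s₂ := thresholdStmt.eval (tapeDevice ω) inp s₁ with hs₂
  have h2 : LearnParams s₂ K m H := h1.congr (Stmt.eval_p _ _)
  have f2 : s₂.x = s₁.x := Stmt.eval_x _ rfl _
  clear_value s₂
  rw [← f2] at hA
  have := Stmt.loop_inv (D := tapeDevice ω) (inp := inp) (x := 40) (k := 7) (p := classStmt)
    (N := (2 * n + 1) ^ K) (s := s₂)
    (fun k (s' : Store (QState n)) => (∃ γ : ℕ → ℕ → Bool,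
      (∀ j < k, ServesClass n K (passes n m H ω) j (γ j)) ∧
      Advance s.x s'.x (List.replicate m (bellCircuit n) ++ (List.range k).flatMap fun j =>
          List.replicate m (classCircuit n (γ j)))
        ((List.range k).flatMap fun j => classBits m (γ j) fun t => ω (m + j * m + t))) ∧
      s'.a 6 = s₂.a 6) h2.pL ⟨⟨fun _ _ => false, by simp, by simpa using hA⟩, rfl⟩ ?_
  · exact this.1
  rintro k hk s' hp ⟨⟨γ, hγ, hA'⟩, h6⟩
  obtain ⟨γ', hA2, hS⟩ := classStmt_spec (ω := ω) (inp := inp) (T := passes n m H ω)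
    (s := s'.setv 40 k) (h2.congr hp) (by simp) hk
    (fun q hq => by simpa [h6, passes] using hT q hq) hA'.circuit
  refine ⟨⟨Function.update γ k γ', fun j hj => ?_, ?_⟩, ?_⟩
  · rcases Nat.lt_succ_iff_lt_or_eq.mp hj with h | rfl
    · rw [Function.update_of_ne h.ne]; exact hγ j h
    · rw [Function.update_self]; exact hS
  · have hlen : s'.x.log.length = m + k * m := by
      rw [hA'.log, hl]
      simp
    have e1 : ∀ {α : Type} (f : ℕ → (ℕ → Bool) → List α), (List.range k).flatMap (fun j =>
        f j (Function.update γ k γ' j)) = (List.range k).flatMap fun j => f j (γ j) := by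
      intro α f
      refine List.flatMap_congr fun j hj => ?_
      rw [Function.update_of_ne (List.mem_range.mp hj).ne]
    rw [List.range_succ, List.flatMap_append, List.flatMap_append,
      e1 (fun j γ => List.replicate m (classCircuit n γ)),
      e1 (fun j γ => classBits m γ fun t => ω (m + j * m + t)), ← List.append_assoc]
    have := hA'.trans hA2
    simp only [Store.setv_x, hlen] at this
    simpa using this
  · rw [Stmt.eval_a _ _ rfl]
    exact h6

end

end PauliLearning

/-! ### The retrieval program and the layout of the description. -/

namespace PauliLearning

section

variable {Q X : Type} {D : Device Q X} {inp : List ℕ}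

/-! ### Retrieval -/

def Pauli.bx : Pauli → ZMod 2
  | .I => 0
  | .X => 1
  | .Y => 1
  | .Z => 0

def Pauli.bz : Pauli → ZMod 2
  | .I => 0
  | .X => 0
  | .Y => 1
  | .Z => 1

theorem Pauli.ofBits_bits (P : Pauli) : Pauli.ofBits P.bx P.bz = P := by
  cases P <;> simp [Pauli.ofBits, Pauli.bx, Pauli.bz]

/-- Load the Pauli operator from the input. -/
def loadStmt : Stmt Q :=
  .set 17 1 ;; .set 20 0 ;; .set 10 2 ;; .loop 13 0 (.inp 15 10 ;; .add 10 10 17 ;; .half 16 15 ;;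
    .wr 1 13 16 ;; .add 36 16 16 ;; .sub 36 15 36 ;; .ite 16 (.sub 36 17 36) nop ;; .wr 0 13 36)

/-- The codes of 𝟙, X, Y, Z are 0, 1, 2, 3. So the upper bit is the Z-bit, while the lower bit is
the X-bit only after a flip in case the upper bit is 1. -/
theorem loadStmt_spec {n : ℕ} {s : Store X} {P : ℕ → Pauli} (hn : s.p 0 = n)
    (hP : ∀ i < n, inp.getD (2 + i) 0 = (P i).code) :
    TabRep n (loadStmt.eval D inp s) ⟨fun i => (P i).bx, fun i => (P i).bz, 0⟩ := by
  simp only [loadStmt, Stmt.eval_seq, Stmt.eval_set]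
  have := Stmt.loop_inv (D := D) (inp := inp) (x := 13) (k := 0)
    (p := .inp 15 10 ;; .add 10 10 17 ;; .half 16 15 ;;
      .wr 1 13 16 ;; .add 36 16 16 ;; .sub 36 15 36 ;; .ite 16 (.sub 36 17 36) nop ;; .wr 0 13 36)
    (N := n) (s := ((s.setv 17 1).setv 20 0).setv 10 2)
    (fun k (s' : Store X) => Bits k (s'.a 0) (fun i => (P i).bx) ∧
      Bits k (s'.a 1) (fun i => (P i).bz) ∧ s'.v 20 = 0 ∧ s'.v 17 = 1 ∧ s'.v 10 = 2 + k)
    (by simpa using hn) (by simp [Bits]) ?_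
  · exact ⟨this.1, this.2.1, by simpa using this.2.2.1⟩
  rintro k hk s' hp ⟨h0, h1, h20, h17, h10⟩
  have hc := hP k hk
  have key : ∀ (x z : ℕ) (f g : ℕ → ℕ), x = (P k).bx.val → z = (P k).bz.val →
      f = Function.update (s'.a 0) k x → g = Function.update (s'.a 1) k z →
      Bits (k + 1) f (fun i => (P i).bx) ∧ Bits (k + 1) g fun i => (P i).bz := by
    rintro x z f g hx hz rfl rfl
    constructor <;> intro i hi
    · by_cases hik : i = k
      · subst hik; simp [hx]
      · simpa [hik] using h0 i (by omega)
    · by_cases hik : i = k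
      · subst hik; simp [hz]
      · simpa [hik] using h1 i (by omega)
  simp only [Stmt.eval_seq, Stmt.eval_inp, Stmt.eval_add, Stmt.eval_half, Stmt.eval_wr,
    Stmt.eval_sub, Stmt.eval_ite, eval_nop]
  have hk' := key _ _ _ _ rfl rfl rfl rfl
  clear key
  rcases e : P k <;> rw [e] at hc hk' <;> simp only [Pauli.code] at hc <;>
    simp [h10, hc, h17, h20, add_assoc, -List.getD_eq_getElem?_getD] <;>
    simpa [Pauli.bx, Pauli.bz, val_one_zmod2] using hk'

/-- Load a circuit from the input. -/
def loadCircuit : Stmt Q := .set 17 1 ;; .loop 13 6 (.inp 15 31 ;; .wr 4 13 15 ;; .add 31 31 17)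

theorem loadCircuit_spec {N g : ℕ} {s : Store X} (hN : s.p 6 = N) (hg : s.v 31 = g) :
    (∀ k < N, (loadCircuit.eval D inp s).a 4 k = inp.getD (g + k) 0) ∧
      (loadCircuit.eval D inp s).v 31 = g + N := by
  simp only [loadCircuit, Stmt.eval_seq, Stmt.eval_set]
  have := Stmt.loop_inv (D := D) (inp := inp) (x := 13) (k := 6)
    (p := .inp 15 31 ;; .wr 4 13 15 ;; .add 31 31 17) (N := N) (s := s.setv 17 1)
    (fun k (s' : Store X) => (∀ i < k, s'.a 4 i = inp.getD (g + i) 0) ∧ s'.v 31 = g + k ∧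
      s'.v 17 = 1) (by simpa using hN) (by simp [hg]) ?_
  · exact ⟨this.1, this.2.1⟩
  rintro k hk s' - ⟨h, h31, h17⟩
  refine ⟨fun i hi => ?_, ?_, ?_⟩
  · by_cases hik : i = k
    · simp [hik, h31]
    · simpa [hik] using h i (by omega)
  · simp [h31, h17, add_assoc]
  · simpa using h17

/-- The sign of a diagonal Pauli operator on a basis vector. -/
def zParity (n : ℕ) (τ : Tableau) (β : ℕ → ZMod 2) : ZMod 2 :=
  τ.s + ∑ i ∈ Finset.range n, τ.z i * β i

/-- Read one measurement outcome from the input, at position `v 31`. -/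
def zParityStmt : Stmt Q :=
  .set 17 1 ;; .mov 14 20 ;; .loop 13 0 (.inp 15 31 ;; .add 31 31 17 ;; .rd 16 1 13 ;;
    toggle 14 16 15)

theorem zParityStmt_spec {n g : ℕ} {s : Store X} {τ : Tableau} {β : ℕ → ZMod 2} (hn : s.p 0 = n)
    (hτ : TabRep n s τ) (hg : s.v 31 = g) (hβ : ∀ i < n, inp.getD (g + i) 0 = (β i).val) :
    (zParityStmt.eval D inp s).v 14 = (zParity n τ β).val ∧
      (zParityStmt.eval D inp s).v 31 = g + n := by
  simp only [zParityStmt, Stmt.eval_seq, Stmt.eval_set, Stmt.eval_mov]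
  have := Stmt.loop_inv (D := D) (inp := inp) (x := 13) (k := 0)
    (p := .inp 15 31 ;; .add 31 31 17 ;; .rd 16 1 13 ;; toggle 14 16 15) (N := n)
    (s := (s.setv 17 1).setv 14 ((s.setv 17 1).v 20))
    (fun k (s' : Store X) => s'.v 14 = (zParity k τ β).val ∧ s'.v 31 = g + k ∧ s'.v 17 = 1 ∧
      s'.a 1 = s.a 1) (by simpa using hn) (by simp [zParity, hτ.s, hg]) ?_
  · exact ⟨this.1, this.2.1⟩
  rintro k hk s' - ⟨h14, h31, h17, h1⟩
  have hb := hβ k hk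
  simp only [Stmt.eval_seq, Stmt.eval_inp, Stmt.eval_add, Stmt.eval_rd]
  refine ⟨?_, ?_, ?_, ?_⟩
  · rw [zParity, Finset.sum_range_succ, ← add_assoc]
    refine toggle_spec (by decide) ?_ ?_ ?_ ?_
    · simpa using h17
    · simpa [zParity] using h14
    · simp [h1, hτ.z k hk]
    · simp [h31, hb, -List.getD_eq_getElem?_getD]
  · simp (disch := first | exact id rfl | decide) [Stmt.eval_v, h31, h17, add_assoc]
  · simp (disch := first | exact id rfl | decide) [Stmt.eval_v, h17]
  · simp (disch := first | exact id rfl | decide) [Stmt.eval_a, h1]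

/-- Count the outcomes with sign `1`. -/
def zCountStmt : Stmt Q :=
  .set 35 0 ;; .loop 32 5 (zParityStmt ;; .ite 14 nop (.add 35 35 17))

theorem zCountStmt_spec {n m g : ℕ} {s : Store X} {τ : Tableau} {β : ℕ → ℕ → ZMod 2}
    (hn : s.p 0 = n) (hm : s.p 5 = m) (hτ : TabRep n s τ) (hg : s.v 31 = g)
    (hβ : ∀ t < m, ∀ i < n, inp.getD (g + t * n + i) 0 = (β t i).val) :
    (zCountStmt.eval D inp s).v 35 = ((Finset.range m).filter fun t => zParity n τ (β t) = 0).card ∧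
      (zCountStmt.eval D inp s).v 31 = g + m * n := by
  simp only [zCountStmt, Stmt.eval_seq, Stmt.eval_set]
  have := Stmt.loop_inv (D := D) (inp := inp) (x := 32) (k := 5)
    (p := zParityStmt ;; .ite 14 nop (.add 35 35 17)) (N := m) (s := s.setv 35 0)
    (fun k (s' : Store X) => s'.v 35 = ((Finset.range k).filter fun t => zParity n τ (β t) = 0).card ∧
      s'.v 31 = g + k * n ∧ TabRep n s' τ) (by simpa using hm)
      (by simpa [hg] using ⟨hτ.x, hτ.z, by simpa using hτ.s⟩) ?_
  · exact ⟨this.1, this.2.1⟩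
  rintro k hk s' hp ⟨h35, h31, hτ'⟩
  have b := zParityStmt_spec (D := D) (inp := inp) (s := s'.setv 32 k) (n := n) (g := g + k * n)
    (β := β k) (by simpa [hp] using hn) ⟨hτ'.x, hτ'.z, by simpa using hτ'.s⟩ (by simpa using h31)
    (hβ k hk)
  have f17 : (zParityStmt.eval D inp (s'.setv 32 k)).v 17 = 1 := by
    simp (disch := first | exact id rfl | decide) [zParityStmt, Stmt.eval_v]
  simp only [Stmt.eval_seq, Stmt.eval_ite, Stmt.eval_add, eval_nop]
  set s₁ := zParityStmt.eval D inp (s'.setv 32 k) with hs₁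
  have f1 : s₁.v 35 = s'.v 35 ∧ s₁.v 20 = s'.v 20 ∧ s₁.a 0 = s'.a 0 ∧ s₁.a 1 = s'.a 1 := by
    simp (disch := first | exact id rfl | decide) [hs₁, Stmt.eval_v, Stmt.eval_a]
  clear_value s₁
  obtain ⟨f35, f20, f0, f1⟩ := f1
  rw [Finset.range_add_one, Finset.filter_insert]
  by_cases h0 : zParity n τ (β k) = 0
  · rw [if_neg (by simp [b.1, h0]), if_pos h0, Finset.card_insert_of_notMem (by simp)]
    refine ⟨by simp [f35, h35, f17], by simp [b.2]; ring, ?_, ?_, ?_⟩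
    · simpa [f0] using hτ'.x
    · simpa [f1] using hτ'.z
    · simpa [f20] using hτ'.s
  · rw [if_pos (by simpa [b.1] using h0), if_neg h0]
    refine ⟨by simp [f35, h35], by simp [b.2]; ring, ?_, ?_, ?_⟩
    · simpa [f0] using hτ'.x
    · simpa [f1] using hτ'.z
    · simpa [f20] using hτ'.s

/-- Evaluate the Pauli operator with the measurements of one class. -/
def evalClass : Stmt Q :=
  loadCircuit ;; loadStmt ;; conjStmt ;; anyX ;; zCountStmt ;;
    .ite 50 nop (.add 0 35 35 ;; .par 1 5)

/-- The outcomes are read even if the operator is not diagonal, so that the reading position always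
advances by the length of a class. A usable class leaves 2 · count and m, and (2 · count - m)/m is
the mean of the signs. -/
theorem evalClass_spec {n m g : ℕ} {s : Store X} {P : ℕ → Pauli} {γ : ℕ → Bool}
    {β : ℕ → ℕ → ZMod 2} {τ : Tableau} (hn : s.p 0 = n) (hn2 : s.p 2 = 2 * n) (hm : s.p 5 = m)
    (h6 : s.p 6 = 4 * n ^ 2) (hg : s.v 31 = g) (hP : ∀ i < n, inp.getD (2 + i) 0 = (P i).code)
    (hγ : ∀ k < 4 * n ^ 2, inp.getD (g + k) 0 = (γ k).toNat)
    (hβ : ∀ t < m, ∀ i < n, inp.getD (g + 4 * n ^ 2 + t * n + i) 0 = (β t i).val)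
    (hτ : τ = conjList (circOps n γ (2 * n)) ⟨fun i => (P i).bx, fun i => (P i).bz, 0⟩) :
    (evalClass.eval D inp s).v 31 = g + (4 * n ^ 2 + m * n) ∧
      ((∀ i < n, τ.x i = 0) → (evalClass.eval D inp s).v 0 =
          2 * ((Finset.range m).filter fun t => zParity n τ (β t) = 0).card ∧
        (evalClass.eval D inp s).v 1 = m) ∧
      (¬(∀ i < n, τ.x i = 0) → (evalClass.eval D inp s).v 0 = s.v 0 ∧
        (evalClass.eval D inp s).v 1 = s.v 1) := by
  simp only [evalClass, Stmt.eval_seq, Stmt.eval_ite, Stmt.eval_add, Stmt.eval_par, eval_nop]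
  have h1 := loadCircuit_spec (D := D) (inp := inp) h6 hg
  set s₁ := loadCircuit.eval D inp s with hs₁
  have p1 : s₁.p = s.p := Stmt.eval_p _ _
  have f1 : s₁.v 0 = s.v 0 ∧ s₁.v 1 = s.v 1 := ⟨Stmt.eval_v _ _ rfl _, Stmt.eval_v _ _ rfl _⟩
  clear_value s₁
  have h2 := loadStmt_spec (D := D) (inp := inp) (s := s₁) (by rw [p1, hn]) hP
  set s₂ := loadStmt.eval D inp s₁ with hs₂
  have p2 : s₂.p = s.p := (Stmt.eval_p _ _).trans p1
  have f2 : s₂.v 0 = s.v 0 ∧ s₂.v 1 = s.v 1 ∧ s₂.v 31 = g + 4 * n ^ 2 ∧ s₂.a 4 = s₁.a 4 :=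
    ⟨(Stmt.eval_v _ _ rfl _).trans f1.1, (Stmt.eval_v _ _ rfl _).trans f1.2,
      (Stmt.eval_v _ _ rfl _).trans h1.2, Stmt.eval_a _ _ rfl _⟩
  clear_value s₂
  have h3 := conjStmt_spec (D := D) (inp := inp) (s := s₂) (by rw [p2, hn]) (by rw [p2, hn2]) h2
  have hcirc : circOps n (bitsOf (s₂.a 4)) (2 * n) = circOps n γ (2 * n) := by
    refine circOps_congr fun k hk => ?_
    have hk' : k < 4 * n ^ 2 := by nlinarith
    rw [bitsOf, f2.2.2.2, h1.1 k hk', hγ k hk']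
    cases γ k <;> simp
  rw [hcirc, ← hτ] at h3
  set s₃ := conjStmt.eval D inp s₂ with hs₃
  have p3 : s₃.p = s.p := (Stmt.eval_p _ _).trans p2
  have f3 : s₃.v 0 = s.v 0 ∧ s₃.v 1 = s.v 1 ∧ s₃.v 31 = g + 4 * n ^ 2 :=
    ⟨(Stmt.eval_v _ _ rfl _).trans f2.1, (Stmt.eval_v _ _ rfl _).trans f2.2.1,
      (Stmt.eval_v _ _ rfl _).trans f2.2.2.1⟩
  clear_value s₃
  have h4 := anyX_spec (D := D) (inp := inp) (by rw [p3, hn]) h3.x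
  set s₄ := anyX.eval D inp s₃ with hs₄
  have p4 : s₄.p = s.p := (Stmt.eval_p _ _).trans p3
  have f4 : s₄.v 0 = s.v 0 ∧ s₄.v 1 = s.v 1 ∧ s₄.v 31 = g + 4 * n ^ 2 :=
    ⟨(Stmt.eval_v _ _ rfl _).trans f3.1, (Stmt.eval_v _ _ rfl _).trans f3.2.1,
      (Stmt.eval_v _ _ rfl _).trans f3.2.2⟩
  have t4 : TabRep n s₄ τ := by
    refine ⟨?_, ?_, ?_⟩
    · rw [hs₄, Stmt.eval_a _ _ rfl]; exact h3.x
    · rw [hs₄, Stmt.eval_a _ _ rfl]; exact h3.z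
    · rw [hs₄, Stmt.eval_v _ _ rfl]; exact h3.s
  clear_value s₄
  have h5 := zCountStmt_spec (D := D) (inp := inp) (s := s₄) (by rw [p4, hn]) (by rw [p4, hm]) t4
    f4.2.2 hβ
  set s₅ := zCountStmt.eval D inp s₄ with hs₅
  have p5 : s₅.p = s.p := (Stmt.eval_p _ _).trans p4
  have f5 : s₅.v 0 = s.v 0 ∧ s₅.v 1 = s.v 1 ∧ s₅.v 50 = s₄.v 50 :=
    ⟨(Stmt.eval_v _ _ rfl _).trans f4.1, (Stmt.eval_v _ _ rfl _).trans f4.2.1,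
      Stmt.eval_v _ _ rfl _⟩
  clear_value s₅
  obtain ⟨f50, f51, f550⟩ := f5
  by_cases hd : ∀ i < n, τ.x i = 0
  · rw [if_neg (by rw [f550]; simpa using h4.mpr hd)]
    refine ⟨?_, fun _ => ⟨?_, ?_⟩, fun h => absurd hd h⟩
    · simp [h5.2]; ring
    · simp [h5.1]; ring
    · simp [p5, hm]
  · rw [if_pos (by rw [f550]; exact fun e => hd (h4.mp e))]
    refine ⟨?_, fun h => absurd h hd, fun _ => ⟨?_, ?_⟩⟩
    · simp [h5.2]; ring
    · simp [f50]
    · simp [f51]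

/-- The retrieval program, once its parameters are known. -/
def retrieveStmt : Stmt Q :=
  .set 0 0 ;; .set 1 0 ;; .set 17 1 ;; .set 31 2 ;; .par 37 0 ;; .add 31 31 37 ;;
    .loop 40 7 evalClass

/-- Later usable classes overwrite earlier ones. It does not matter which one is kept: on a good
tape every class that diagonalizes an operator estimates it well. -/
theorem retrieveStmt_spec {n m L : ℕ} {s : Store X} {P : ℕ → Pauli} {γ : ℕ → ℕ → Bool}
    {β : ℕ → ℕ → ℕ → ZMod 2} {τ : ℕ → Tableau} (hn : s.p 0 = n) (hn2 : s.p 2 = 2 * n)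
    (hm : s.p 5 = m) (h6 : s.p 6 = 4 * n ^ 2) (hL : s.p 7 = L)
    (hP : ∀ i < n, inp.getD (2 + i) 0 = (P i).code)
    (hγ : ∀ j < L, ∀ k < 4 * n ^ 2,
      inp.getD (2 + n + j * (4 * n ^ 2 + m * n) + k) 0 = (γ j k).toNat)
    (hβ : ∀ j < L, ∀ t < m, ∀ i < n,
      inp.getD (2 + n + j * (4 * n ^ 2 + m * n) + 4 * n ^ 2 + t * n + i) 0 = (β j t i).val)
    (hτ : ∀ j, τ j = conjList (circOps n (γ j) (2 * n)) ⟨fun i => (P i).bx, fun i => (P i).bz, 0⟩) :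
    ((∀ j < L, ¬ ∀ i < n, (τ j).x i = 0) ∧ (retrieveStmt.eval D inp s).v 0 = 0 ∧
        (retrieveStmt.eval D inp s).v 1 = 0) ∨
      ∃ j < L, (∀ i < n, (τ j).x i = 0) ∧ (retrieveStmt.eval D inp s).v 0 =
          2 * ((Finset.range m).filter fun t => zParity n (τ j) (β j t) = 0).card ∧
        (retrieveStmt.eval D inp s).v 1 = m := by
  simp only [retrieveStmt, Stmt.eval_seq, Stmt.eval_set, Stmt.eval_par, Stmt.eval_add]
  set s₀ := (((((s.setv 0 0).setv 1 0).setv 17 1).setv 31 2).setv 37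
    (((((s.setv 0 0).setv 1 0).setv 17 1).setv 31 2).p 0)) with hs₀
  refine (Stmt.loop_inv (D := D) (inp := inp) (x := 40) (k := 7) (p := evalClass) (N := L)
    (s := s₀.setv 31 (s₀.v 31 + s₀.v 37))
    (fun k (s' : Store X) => (((∀ j < k, ¬ ∀ i < n, (τ j).x i = 0) ∧ s'.v 0 = 0 ∧ s'.v 1 = 0) ∨
      ∃ j < k, (∀ i < n, (τ j).x i = 0) ∧ s'.v 0 =
          2 * ((Finset.range m).filter fun t => zParity n (τ j) (β j t) = 0).card ∧ s'.v 1 = m) ∧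
      s'.v 31 = 2 + n + k * (4 * n ^ 2 + m * n)) (by simpa [hs₀] using hL) ?_ ?_).1
  · simp [hs₀, hn]
  rintro k hk s' hp ⟨h, h31⟩
  have hp' : s'.p = s.p := hp
  obtain ⟨e1, e2, e3⟩ := evalClass_spec (D := D) (inp := inp) (s := s'.setv 40 k) (n := n) (m := m)
    (P := P) (γ := γ k) (β := β k) (by simpa [hp'] using hn) (by simpa [hp'] using hn2)
    (by simpa [hp'] using hm) (by simpa [hp'] using h6) (by simpa using h31) hP (hγ k hk) (hβ k hk)
    (hτ k)
  refine ⟨?_, by rw [e1]; ring⟩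
  by_cases hd : ∀ i < n, (τ k).x i = 0
  · exact Or.inr ⟨k, by omega, hd, (e2 hd).1, (e2 hd).2⟩
  · obtain ⟨v0, v1⟩ := e3 hd
    rw [v0, v1]
    rcases h with ⟨h1, h2⟩ | ⟨j, hj, h1⟩
    · refine Or.inl ⟨fun j hj => ?_, by simpa using h2⟩
      rcases Nat.lt_succ_iff_lt_or_eq.mp hj with h | rfl
      · exact h1 j h
      · exact hd
    · exact Or.inr ⟨j, by omega, by simpa using h1⟩

/-! ### The layout of the description -/

/-- Locates entries in the description, in the outcomes of a class and in the log of circuits, all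
of which consist of blocks of equal length. -/
theorem getD_flatMap_range {α : Type} (d : α) (f : ℕ → List α) {B L j k : ℕ}
    (hf : ∀ j < L, (f j).length = B) (hj : j < L) (hk : k < B) :
    ((List.range L).flatMap f).getD (j * B + k) d = (f j).getD k d := by
  have hlen : ∀ L' ≤ L, ((List.range L').flatMap f).length = L' * B := by
    intro L' hL'
    induction L' with
    | zero => simp
    | succ L' ih =>
      rw [List.range_succ, List.flatMap_append, List.length_append, ih (by omega)]
      simp [hf L' (by omega)]
      ring
  have : ∀ L' ≤ L, j < L' → ((List.range L').flatMap f).getD (j * B + k) d = (f j).getD k d := by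
    intro L' hL' hj'
    induction L' with
    | zero => omega
    | succ L' ih =>
      rw [List.range_succ, List.flatMap_append]
      rcases Nat.lt_succ_iff_lt_or_eq.mp hj' with h | rfl
      · rw [List.getD_append _ _ _ _ ?_]
        · exact ih (by omega) h
        · rw [hlen L' (by omega)]
          have : (j + 1) * B ≤ L' * B := Nat.mul_le_mul_right _ h
          rw [Nat.succ_mul] at this
          omega
      · rw [List.getD_append_right _ _ _ _ (by rw [hlen j (by omega)]; omega), hlen j (by omega)]
        simp
  exact this L le_rfl hj

section

variable {n : ℕ}

theorem outcomeBits_length (z : Fin (n + n) → Bool) : (outcomeBits z).length = n := by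
  simp [outcomeBits]

theorem classBits_length (m : ℕ) (γ : ℕ → Bool) (z : ℕ → Fin (n + n) → Bool) :
    (classBits m γ z).length = 4 * n ^ 2 + m * n := by
  simp [classBits, outcomeBits_length]

theorem classBits_getD_circuit {m k : ℕ} (γ : ℕ → Bool) (z : ℕ → Fin (n + n) → Bool)
    (hk : k < 4 * n ^ 2) : (classBits m γ z).getD k false = γ k := by
  rw [classBits, List.getD_append _ _ _ _ (by simpa using hk)]
  simp [hk]

theorem classBits_getD_outcome {m t i : ℕ} (γ : ℕ → Bool) (z : ℕ → Fin (n + n) → Bool)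
    (ht : t < m) (hi : i < n) :
    (classBits m γ z).getD (4 * n ^ 2 + t * n + i) false = decide (bitAt (z t) i ≠ 0) := by
  rw [classBits, List.getD_append_right _ _ _ _ (by simp; omega)]
  have := getD_flatMap_range false (fun t => outcomeBits (z t)) (L := m) (j := t) (k := i)
    (fun t _ => outcomeBits_length (z t)) ht hi
  rw [List.length_map, List.length_range, add_assoc, Nat.add_sub_cancel_left, this]
  simp [outcomeBits, hi]

theorem retrievalInput_getD_code (P : Fin n → Pauli) (D : List Bool) {i : ℕ} (hi : i < n) :
    (retrievalInput P D).getD (2 + i) 0 = (P ⟨i, hi⟩).code := by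
  rw [retrievalInput, add_comm 2 i]
  simp only [List.getD_cons_succ]
  rw [List.getD_append _ _ _ _ (by simpa using hi)]
  simp [hi]

theorem retrievalInput_getD_bit (P : Fin n → Pauli) (D : List Bool) (k : ℕ) :
    (retrievalInput P D).getD (2 + n + k) 0 = (D.getD k false).toNat := by
  rw [retrievalInput, show 2 + n + k = n + k + 1 + 1 by ring]
  simp only [List.getD_cons_succ]
  rw [List.getD_append_right _ _ _ _ (by simp)]
  simp
  cases D[k]? <;> simp

end

end

end PauliLearning

/-! ### Resource bounds, and assembly of the two programs. -/

namespace PauliLearning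

section

variable {Q X : Type} {D : Device Q X} {inp : List ℕ}

/-! ### Costs -/

theorem Stmt.cost_mono (p : Stmt Q) {e e' : ℕ → ℕ} (h : ∀ k, e k ≤ e' k) : p.cost e ≤ p.cost e' := by
  induction p with
  | seq p q hp hq => simp only [cost]; omega
  | ite x p q hp hq => simp only [cost]; omega
  | loop x k p hp =>
    simp only [cost]
    have := Nat.mul_le_mul (h k) (Nat.add_le_add_left hp 15)
    omega
  | _ => exact le_rfl

/-- The cost arises from the parameters by sums and products, in a pattern fixed by the syntax. -/
theorem Stmt.cost_polynomial (p : Stmt Q) (f : ℕ → Polynomial ℕ) :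
    ∃ P : Polynomial ℕ, ∀ n, p.cost (fun k => (f k).eval n) = P.eval n := by
  induction p with
  | seq p q hp hq =>
    obtain ⟨P, hP⟩ := hp
    obtain ⟨R, hR⟩ := hq
    exact ⟨1 + P + R, fun n => by simp [cost, hP, hR]⟩
  | ite x p q hp hq =>
    obtain ⟨P, hP⟩ := hp
    obtain ⟨R, hR⟩ := hq
    exact ⟨1 + P + R, fun n => by simp [cost, hP, hR]⟩
  | loop x k p hp =>
    obtain ⟨P, hP⟩ := hp
    exact ⟨10 + f k * (15 + P), fun n => by simp [cost, hP]⟩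
  | _ => exact ⟨20, fun n => by simp [cost]⟩

theorem le_two_pow_mul (a : ℕ) {n : ℕ} (hn : 0 < n) : 2 ^ a ≤ 2 ^ (a * n) :=
  Nat.pow_le_pow_right (by norm_num) (Nat.le_mul_of_pos_right a hn)

/-- Loops multiply bounds of the form 2^(an), and their nesting is a constant of the program. For n
> 0 constant factors can be absorbed into the exponent. -/
theorem Stmt.cost_exponential (p : Stmt Q) (A : ℕ) :
    ∃ C : ℕ, ∀ n, 0 < n → ∀ e : ℕ → ℕ, (∀ k, e k ≤ 2 ^ (A * n)) → p.cost e ≤ 2 ^ (C * n) := by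
  have hadd : ∀ a b x y n : ℕ, 0 < n → x ≤ 2 ^ (a * n) → y ≤ 2 ^ (b * n) →
      1 + x + y ≤ 2 ^ ((a + b + 2) * n) := by
    intro a b x y n hn hx hy
    have h1 : (2 : ℕ) ^ (a * n) ≤ 2 ^ ((a + b) * n) :=
      Nat.pow_le_pow_right (by norm_num) (Nat.mul_le_mul_right _ (by omega))
    have h2 : (2 : ℕ) ^ (b * n) ≤ 2 ^ ((a + b) * n) :=
      Nat.pow_le_pow_right (by norm_num) (Nat.mul_le_mul_right _ (by omega))
    have h3 : 1 ≤ (2 : ℕ) ^ ((a + b) * n) := Nat.one_le_two_pow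
    have h4 := le_two_pow_mul 2 hn
    rw [add_mul (a + b), pow_add]
    nlinarith
  induction p with
  | seq p q hp hq =>
    obtain ⟨a, ha⟩ := hp
    obtain ⟨b, hb⟩ := hq
    exact ⟨_, fun n hn e he => hadd a b _ _ n hn (ha n hn e he) (hb n hn e he)⟩
  | ite x p q hp hq =>
    obtain ⟨a, ha⟩ := hp
    obtain ⟨b, hb⟩ := hq
    exact ⟨_, fun n hn e he => hadd a b _ _ n hn (ha n hn e he) (hb n hn e he)⟩
  | loop x k p hp =>
    obtain ⟨a, ha⟩ := hp
    refine ⟨A + a + 5, fun n hn e he => ?_⟩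
    have h1 := Nat.mul_le_mul (he k) (Nat.add_le_add_left (ha n hn e he) 15)
    have h2 := le_two_pow_mul 5 hn
    have h3 : 1 ≤ (2 : ℕ) ^ (A * n) := Nat.one_le_two_pow
    have h4 : 1 ≤ (2 : ℕ) ^ (a * n) := Nat.one_le_two_pow
    rw [add_mul, add_mul, pow_add, pow_add]
    simp only [cost]
    calc 10 + e k * (15 + p.cost e) ≤ 10 + 2 ^ (A * n) * (15 + 2 ^ (a * n)) := by omega
      _ ≤ 2 ^ (A * n) * 2 ^ (a * n) * 2 ^ 5 := by nlinarith [Nat.mul_le_mul h3 h4]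
      _ ≤ _ := Nat.mul_le_mul_left _ h2
  | _ => exact ⟨5, fun n hn e _ => (by norm_num [cost] : _ ≤ 2 ^ 5).trans (le_two_pow_mul 5 hn)⟩

/-! ### Setting the parameters -/

/-- A statement that computes the value of parameter `key` in variable `res`. -/
structure Stage (Q : Type) where
  stmt : Stmt Q
  key : ℕ
  res : ℕ

/-- Compute parameters one after the other. -/
def setup (R : (ℕ → ℕ) → Q → Q) : List (Stage Q) → Prog Q
  | [] => .const 1 0
  | g :: l => .seq (.seq (g.stmt.comp R 0) (.seq (.const 1 0) (.add (2 + 16 * g.key) (16 * g.res) 1)))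
      (setup R l)

def setupCost (e : ℕ → ℕ) : List (Stage Q) → ℕ
  | [] => 1
  | g :: l => 1 + (1 + g.stmt.cost e + 3) + setupCost e l

/-- The stages compute the parameters `e`; those in `ks` are already known. -/
def Sets (D : Device Q X) (inp : List ℕ) (e : ℕ → ℕ) : List ℕ → List (Stage Q) → Prop
  | _, [] => True
  | ks, g :: l => ((∀ s : Store X, (∀ i ∈ ks, s.p i = e i) → (g.stmt.eval D inp s).v g.res = e g.key) ∧
      g.stmt.classical = true ∧ g.stmt.arrOK = true) ∧ Sets D inp e (g.key :: ks) l

/-- The bound `s.p i ≤ e i` persists while parameters are being set. As costs are monotone, each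
stage may be charged with the final values. -/
theorem setup_correct {e : ℕ → ℕ} {l : List (Stage Q)} {ks : List ℕ} (hl : Sets D inp e ks l)
    {M : ℕ → ℕ} {s : Store X} (hM : Represents M s) (hs : ∀ i ∈ ks, s.p i = e i)
    (hle : ∀ i, s.p i ≤ e i) :
    ∃ (M' : ℕ → ℕ) (s' : Store X), Runs D inp (setup D.relabel l) M s.x M' s.x (setupCost e l) ∧
      Represents M' s' ∧ s'.x = s.x ∧ (∀ i ∈ ks ++ l.map Stage.key, s'.p i = e i) ∧
      ∀ i, s'.p i ≤ e i := by
  induction l generalizing ks M s with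
  | nil =>
    have := hM.hidden 0 0
    exact ⟨_, s, runs_const _ _ _ _, this, rfl, by simpa using hs, hle⟩
  | cons g l ih =>
    obtain ⟨⟨h1, h2, h3⟩, h4⟩ := hl
    obtain ⟨M₁, r1, m1, -⟩ := Stmt.comp_correct (D := D) (inp := inp) g.stmt h3 0 hM
    set s₁ := g.stmt.eval D inp s with hs₁
    have hx : s₁.x = s.x := Stmt.eval_x _ h2 _
    have hp : s₁.p = s.p := Stmt.eval_p _ _
    have m2 := (m1.hidden 0 0).setp g.key (s₁.v g.res)
    have e1 := (m1.hidden 0 0).v g.res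
    simp only [mul_zero, add_zero] at e1 m2
    have r2 : Runs D inp (.seq (.const 1 0) (.add (2 + 16 * g.key) (16 * g.res) 1)) M₁ s₁.x _ _ 3 :=
      (runs_const _ _ _ _).seq (runs_add _ _ _ _ _)
    rw [e1, Function.update_self, add_zero] at r2
    have hv := h1 s hs
    have hu : ∀ i, (s₁.setp g.key (s₁.v g.res)).p i = if i = g.key then e i else s.p i := by
      intro i
      simp only [Store.setp, Function.update_apply, hp]
      split_ifs with h
      · rw [h, ← hv]
      · rfl
    obtain ⟨M', s', r3, m3, x3, k3, l3⟩ := ih h4 m2 (fun i hi => by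
        rw [hu]
        split_ifs with h
        · rfl
        · exact hs i ((List.mem_cons.mp hi).resolve_left h))
      (fun i => by
        rw [hu]
        split_ifs
        · exact le_rfl
        · exact hle i)
    refine ⟨M', s', ?_, m3, x3.trans hx, fun i hi => k3 i ?_, l3⟩
    · have := ((r1.mono (g.stmt.cost_mono hle)).seq r2).seq r3
      rwa [show (s₁.setp g.key (s₁.v g.res)).x = s.x from hx] at this
    · simp only [List.map_cons, List.mem_append, List.mem_cons] at hi ⊢
      tauto

theorem setupCost_polynomial (l : List (Stage Q)) (f : ℕ → Polynomial ℕ) :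
    ∃ P : Polynomial ℕ, ∀ n, setupCost (fun k => (f k).eval n) l = P.eval n := by
  induction l with
  | nil => exact ⟨1, fun n => by simp [setupCost]⟩
  | cons g l ih =>
    obtain ⟨P, hP⟩ := ih
    obtain ⟨R, hR⟩ := g.stmt.cost_polynomial f
    exact ⟨1 + (1 + R + 3) + P, fun n => by simp [setupCost, hP, hR]⟩

theorem setupCost_exponential (l : List (Stage Q)) (A : ℕ) :
    ∃ C : ℕ, ∀ n, 0 < n → ∀ e : ℕ → ℕ, (∀ k, e k ≤ 2 ^ (A * n)) → setupCost e l ≤ 2 ^ (C * n) := by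
  induction l with
  | nil => exact ⟨0, fun n _ e _ => by simp [setupCost]⟩
  | cons g l ih =>
    obtain ⟨a, ha⟩ := ih
    obtain ⟨b, hb⟩ := g.stmt.cost_exponential A
    refine ⟨a + b + 3, fun n hn e he => ?_⟩
    have h1 : (2 : ℕ) ^ (a * n) ≤ 2 ^ ((a + b) * n) :=
      Nat.pow_le_pow_right (by norm_num) (Nat.mul_le_mul_right _ (by omega))
    have h2 : (2 : ℕ) ^ (b * n) ≤ 2 ^ ((a + b) * n) :=
      Nat.pow_le_pow_right (by norm_num) (Nat.mul_le_mul_right _ (by omega))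
    have h3 : 1 ≤ (2 : ℕ) ^ ((a + b) * n) := Nat.one_le_two_pow
    have h4 := le_two_pow_mul 3 hn
    have h5 := ha n hn e he
    have h6 := hb n hn e he
    rw [add_mul (a + b), pow_add]
    simp only [setupCost]
    nlinarith

/-- Multiply parameter `k` by the constant `c`. -/
def scaleStmt (k c : ℕ) : Stmt Q := .set 1 0 ;; .set 2 c ;; .loop 3 k (.add 1 1 2)

theorem scaleStmt_spec (k c : ℕ) (s : Store X) :
    ((scaleStmt k c).eval D inp s).v 1 = c * s.p k := by
  simp only [scaleStmt, Stmt.eval_seq, Stmt.eval_set]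
  refine (Stmt.loop_inv (s := (s.setv 1 0).setv 2 c) (N := s.p k)
    (fun i (s' : Store X) => s'.v 1 = c * i ∧ s'.v 2 = c) rfl (by simp) ?_).1
  rintro i hi s' - ⟨h1, h2⟩
  simp [h1, h2]
  ring

/-- Square parameter `k`. -/
def squareStmt (k : ℕ) : Stmt Q := .set 1 0 ;; .par 2 k ;; .loop 3 k (.add 1 1 2)

theorem squareStmt_spec (k : ℕ) (s : Store X) :
    ((squareStmt k).eval D inp s).v 1 = s.p k * s.p k := by
  simp only [squareStmt, Stmt.eval_seq, Stmt.eval_set, Stmt.eval_par]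
  refine (Stmt.loop_inv (s := (s.setv 1 0).setv 2 ((s.setv 1 0).p k)) (N := s.p k)
    (fun i (s' : Store X) => s'.v 1 = s.p k * i ∧ s'.v 2 = s.p k) rfl (by simp) ?_).1
  rintro i hi s' - ⟨h1, h2⟩
  simp [h1, h2]
  ring

/-- Raise parameter `k` to the power given by parameter `k'`. -/
def powStmt (k k' : ℕ) : Stmt Q :=
  .set 1 1 ;; .loop 3 k' (.set 2 0 ;; .loop 4 k (.add 2 2 1) ;; .mov 1 2)

theorem powStmt_spec (k k' : ℕ) (s : Store X) :
    ((powStmt k k').eval D inp s).v 1 = s.p k ^ s.p k' := by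
  simp only [powStmt, Stmt.eval_seq, Stmt.eval_set]
  refine Stmt.loop_inv (s := s.setv 1 1) (N := s.p k')
    (fun i (s' : Store X) => s'.v 1 = s.p k ^ i) rfl (by simp) ?_
  rintro i hi s' hp h1
  simp only [Stmt.eval_seq, Stmt.eval_set, Stmt.eval_mov]
  have := Stmt.loop_inv (D := D) (inp := inp) (x := 4) (k := k) (p := .add 2 2 1)
    (s := (s'.setv 3 i).setv 2 0) (N := s.p k)
    (fun j (s'' : Store X) => s''.v 2 = s.p k ^ i * j ∧ s''.v 1 = s.p k ^ i) (by simp [hp])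
    (by simp [h1]) ?_
  · simp [this.1, pow_succ]
  · rintro j hj s'' - ⟨h2, h3⟩
    simp [h2, h3]
    ring

/-- The values of the parameters. -/
def params (n K c c' W : ℕ) : ℕ → ℕ
  | 0 => n
  | 1 => K
  | 2 => 2 * n
  | 3 => 2 * n + 1
  | 4 => W
  | 5 => c * n
  | 6 => 4 * n ^ 2
  | 7 => (2 * n + 1) ^ K
  | 8 => c' * n
  | _ => 0

/-- The stages that both programs need. -/
def baseStages (K c : ℕ) : List (Stage Q) :=
  [⟨.set 0 0 ;; .inp 1 0, 0, 1⟩, ⟨.set 1 K, 1, 1⟩, ⟨scaleStmt 0 2, 2, 1⟩,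
    ⟨.par 1 2 ;; .set 2 1 ;; .add 1 1 2, 3, 1⟩, ⟨scaleStmt 0 c, 5, 1⟩, ⟨squareStmt 2, 6, 1⟩,
    ⟨powStmt 3 1, 7, 1⟩]

/-- The stages of the learning program. -/
def learnStages (K c c' : ℕ) : List (Stage Q) :=
  baseStages K c ++ [⟨scaleStmt 0 c', 8, 1⟩, ⟨.set 1 1 ;; .loop 2 0 (.add 1 1 1 ;; .add 1 1 1), 4, 1⟩]

theorem baseStages_sets {n K c c' W : ℕ} (hn : inp.getD 0 0 = n) (l : List (Stage Q))
    (hl : Sets D inp (params n K c c' W) [7, 6, 5, 3, 2, 1, 0] l) :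
    Sets D inp (params n K c c' W) [] (baseStages K c ++ l) := by
  refine ⟨⟨fun s _ => ?_, rfl, rfl⟩, ⟨fun s h => ?_, rfl, rfl⟩, ⟨fun s h => ?_, rfl, rfl⟩,
    ⟨fun s h => ?_, rfl, rfl⟩, ⟨fun s h => ?_, rfl, rfl⟩, ⟨fun s h => ?_, rfl, rfl⟩,
    ⟨fun s h => ?_, rfl, rfl⟩, hl⟩
  · simpa [params, -List.getD_eq_getElem?_getD] using hn
  · simp [params]
  · simp [scaleStmt_spec, params, h 0 (by simp)]
  · simp [params, h 2 (by simp)]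
  · simp [scaleStmt_spec, params, h 0 (by simp)]
  · simp [squareStmt_spec, params, h 2 (by simp)]; ring
  · simp [powStmt_spec, params, h 3 (by simp), h 1 (by simp)]

theorem learnStages_sets {n K c c' : ℕ} (hn : inp.getD 0 0 = n) :
    Sets D inp (params n K c c' (4 ^ n)) [] (learnStages K c c') := by
  refine baseStages_sets hn _ ⟨⟨fun s h => ?_, rfl, rfl⟩, ⟨fun s h => ?_, rfl, rfl⟩, trivial⟩
  · simp [scaleStmt_spec, params, h 0 (by simp)]
  · refine Stmt.loop_inv (s := s.setv 1 1) (N := n) (fun i (s' : Store X) => s'.v 1 = 4 ^ i)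
      (h 0 (by simp)) (by simp) ?_
    intro i hi s' _ h1
    simp [h1, pow_succ]
    ring

theorem params_le {n : ℕ} (hn : 0 < n) (K c c' k : ℕ) :
    params n K c c' (4 ^ n) k ≤ 2 ^ ((K * 2 + c + c' + 4) * n) := by
  have hmono : ∀ {x a : ℕ}, x ≤ 2 ^ (a * n) → a ≤ K * 2 + c + c' + 4 →
      x ≤ 2 ^ ((K * 2 + c + c' + 4) * n) := fun h ha =>
    h.trans (Nat.pow_le_pow_right (by norm_num) (Nat.mul_le_mul_right _ ha))
  have h1 : n ≤ 2 ^ n := Nat.lt_two_pow_self.le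
  have h2 : 2 * n + 1 ≤ 2 ^ (2 * n) := by
    have := Nat.lt_two_pow_self (n := 2 * n)
    omega
  have h3 : ∀ c, c * n ≤ 2 ^ ((c + 1) * n) := fun c => by
    rw [add_mul, one_mul, pow_add]
    exact Nat.mul_le_mul ((Nat.lt_two_pow_self (n := c)).le.trans (le_two_pow_mul c hn)) h1
  match k with
  | 0 => exact hmono (a := 1) (by simpa [params] using h1) (by omega)
  | 1 => exact hmono (a := K) ((Nat.lt_two_pow_self (n := K)).le.trans (le_two_pow_mul K hn)) (by omega)
  | 2 => exact hmono (a := 2) (by simp only [params]; omega) (by omega)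
  | 3 => exact hmono (a := 2) h2 (by omega)
  | 4 => exact hmono (a := 2) (by simp only [params]; rw [pow_mul]; norm_num) (by omega)
  | 5 => exact hmono (a := c + 1) (h3 c) (by omega)
  | 6 =>
    refine hmono (a := 4) ?_ le_add_self
    have : (2 * n) * (2 * n) ≤ 2 ^ (2 * n) * 2 ^ (2 * n) := Nat.mul_le_mul (by omega) (by omega)
    rw [← pow_add] at this
    simp only [params]
    rw [show 4 * n = 2 * n + 2 * n by ring]
    linarith
  | 7 =>
    refine hmono (a := 2 * K) ?_ (by omega)
    simp only [params]
    rw [show 2 * K * n = 2 * n * K by ring, pow_mul]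
    exact Nat.pow_le_pow_left h2 K
  | 8 => exact hmono (a := c' + 1) (h3 c') (by omega)
  | _ + 9 => exact Nat.zero_le _

/-- The parameters of the retrieval program as polynomials. -/
noncomputable def paramPoly (K c c' : ℕ) : ℕ → Polynomial ℕ
  | 0 => .X
  | 1 => (K : Polynomial ℕ)
  | 2 => 2 * .X
  | 3 => 2 * .X + 1
  | 4 => 0
  | 5 => (c : Polynomial ℕ) * .X
  | 6 => 4 * .X ^ 2
  | 7 => (2 * .X + 1) ^ K
  | 8 => (c' : Polynomial ℕ) * .X
  | _ => 0

/-- The retrieval program never sets parameter 4, which is 4^n for the learner. Its value 0 here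
keeps all the loop bounds polynomial. -/
theorem paramPoly_eval (n K c c' : ℕ) :
    (fun k => (paramPoly K c c' k).eval n) = params n K c c' 0 := by
  funext k
  match k with
  | 0 | 1 | 2 | 3 | 4 | 5 | 6 | 7 | 8 | _ + 9 => simp [paramPoly, params]

theorem represents_zero (x : X) :
    Represents (fun _ => 0) (⟨fun _ => 0, fun _ => 0, fun _ _ => 0, x⟩ : Store X) :=
  ⟨fun _ => rfl, fun _ => rfl, fun _ _ _ => rfl⟩

/-- Set the parameters, then run `p`. -/
theorem setup_comp_correct {e : ℕ → ℕ} {l : List (Stage Q)} (hl : Sets D inp e [] l) (p : Stmt Q)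
    (hp : p.arrOK) (x : X) :
    ∃ (M : ℕ → ℕ) (s : Store X), s.x = x ∧ (∀ i ∈ l.map Stage.key, s.p i = e i) ∧
      Runs D inp (.seq (setup D.relabel l) (p.comp D.relabel 0)) (fun _ => 0) x M (p.eval D inp s).x
        (1 + setupCost e l + p.cost e) ∧ Represents M (p.eval D inp s) := by
  obtain ⟨M, s, r1, m1, x1, k1, l1⟩ := setup_correct hl (represents_zero x) (by simp)
    (fun i => Nat.zero_le _)
  obtain ⟨M', r2, m2, -⟩ := Stmt.comp_correct (D := D) (inp := inp) p hp 0 m1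
  refine ⟨M', s, x1, by simpa using k1, ?_, m2⟩
  rw [x1] at r2
  exact r1.seq (r2.mono (p.cost_mono l1))

/-- A halted machine does not move, so an upper bound may replace the exact running time. -/
theorem Runs.halt {pr : Prog Q} {M M' : ℕ → ℕ} {x x' : X} {T T' : ℕ}
    (h : Runs D inp pr M x M' x' T) (hT : T ≤ T') :
    (mstep D inp)^[T'] (⟨[pr], M⟩, x) = (⟨[], M'⟩, x') := by
  obtain ⟨t, ht, h⟩ := h
  obtain ⟨d, rfl⟩ := Nat.exists_eq_add_of_le (ht.trans hT)
  rw [add_comm, Function.iterate_add_apply, h []]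
  exact Function.iterate_fixed rfl d

end

/-! ### The two programs -/

/-- The learning program. -/
def learnProg (K c c' : ℕ) : Prog LearnerInstr :=
  .seq (setup LearnerInstr.relabel (learnStages K c c')) (learnStmt.comp LearnerInstr.relabel 0)

/-- `C` can be chosen before `n` and the tape, because the cost depends only on the parameters and
never on the outcomes. -/
theorem learnProg_spec (K c c' : ℕ) : ∃ C : ℕ, ∀ n, 0 < n → ∀ ω : ℕ → Fin (n + n) → Bool,
    ∃ (M : ℕ → ℕ) (x : QState n) (γ : ℕ → ℕ → Bool),
      tapeRun (learnProg K c c') [n] ω (2 ^ (C * n)) = (⟨[], M⟩, x) ∧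
      (∀ j < (2 * n + 1) ^ K, ServesClass n K (passes n (c * n) (c' * n) ω) j (γ j)) ∧
      Advance ⟨[], fun _ => false, 0, [], []⟩ x
        (List.replicate (c * n) (bellCircuit n) ++ (List.range ((2 * n + 1) ^ K)).flatMap fun j =>
          List.replicate (c * n) (classCircuit n (γ j)))
        ((List.range ((2 * n + 1) ^ K)).flatMap fun j =>
          classBits (c * n) (γ j) fun t => ω (c * n + j * (c * n) + t)) := by
  obtain ⟨a, ha⟩ := setupCost_exponential (Q := LearnerInstr) (learnStages K c c') (K * 2 + c + c' + 4)
  obtain ⟨b, hb⟩ := learnStmt.cost_exponential (K * 2 + c + c' + 4)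
  refine ⟨a + b + 2, fun n hn ω => ?_⟩
  obtain ⟨M, s, hx, hp, hr, -⟩ := setup_comp_correct (D := tapeDevice ω) (inp := [n])
    (learnStages_sets (K := K) (c := c) (c' := c') (n := n) rfl) learnStmt (by decide)
    (⟨[], fun _ => false, 0, [], []⟩ : QState n)
  have hP : LearnParams s K (c * n) (c' * n) := by
    constructor <;> exact hp _ (by simp [learnStages, baseStages])
  obtain ⟨γ, h1, h2⟩ := learnStmt_spec (ω := ω) (inp := [n]) hP (by rw [hx]) (by rw [hx])
  refine ⟨M, _, γ, hr.halt ?_, h1, by rwa [hx] at h2⟩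
  have h3 := ha n hn _ (params_le hn K c c')
  have h4 := hb n hn _ (params_le hn K c c')
  have h5 : (2 : ℕ) ^ (a * n) ≤ 2 ^ ((a + b) * n) :=
    Nat.pow_le_pow_right (by norm_num) (Nat.mul_le_mul_right _ (by omega))
  have h6 : (2 : ℕ) ^ (b * n) ≤ 2 ^ ((a + b) * n) :=
    Nat.pow_le_pow_right (by norm_num) (Nat.mul_le_mul_right _ (by omega))
  have h7 : 1 ≤ (2 : ℕ) ^ ((a + b) * n) := Nat.one_le_two_pow
  have h8 := le_two_pow_mul 2 hn
  rw [add_mul (a + b), pow_add]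
  nlinarith

/-- There are no additional instructions in a classical program. -/
def trivialDevice : Device Empty Unit where
  act q := q.elim
  relabel _ q := q
  act_relabel _ q := q.elim
  target q := q.elim
  act_target q := q.elim

theorem mstep_trivialDevice (inp : List ℕ) (c : Config Empty × Unit) :
    mstep trivialDevice inp c = (Config.step inp c.1, ()) := by
  obtain ⟨⟨_ | ⟨q, K⟩, M⟩, u⟩ := c
  · rfl
  · cases q <;> first | rfl | exact Empty.elim ‹_›

theorem run_eq_mstep (p : Prog Empty) (inp : List ℕ) (t : ℕ) :
    p.run inp t = ((mstep trivialDevice inp)^[t] (⟨[p], fun _ => 0⟩, ())).1 := by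
  induction t with
  | zero => rfl
  | succ t ih =>
    rw [Function.iterate_succ_apply', mstep_trivialDevice, ← ih, Prog.run, Function.iterate_succ_apply']
    rfl

/-- The retrieval program. -/
def retrieveProg (K c : ℕ) : Prog Empty :=
  .seq (.seq (setup (fun _ q => q) (baseStages K c)) (retrieveStmt.comp (fun _ q => q) 0))
    (.seq (.const 17 0) (.seq (.add 1 16 17) (.add 2 82 17)))

theorem retrieveProg_spec (K c : ℕ) : ∃ B : Polynomial ℕ, ∀ (n : ℕ) (inp : List ℕ),
    inp.getD 0 0 = n → ∃ (M : ℕ → ℕ) (s : Store Unit),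
      (retrieveProg K c).run inp (B.eval n) = ⟨[], M⟩ ∧ s.p 0 = n ∧ s.p 2 = 2 * n ∧
      s.p 5 = c * n ∧ s.p 6 = 4 * n ^ 2 ∧ s.p 7 = (2 * n + 1) ^ K ∧
      M 0 = (retrieveStmt.eval trivialDevice inp s).v 0 ∧
      M 1 = (retrieveStmt.eval trivialDevice inp s).v 1 ∧ M 2 = c * n := by
  obtain ⟨P, hP⟩ := setupCost_polynomial (Q := Empty) (baseStages K c) (paramPoly K c 0)
  obtain ⟨R, hR⟩ := (retrieveStmt : Stmt Empty).cost_polynomial (paramPoly K c 0)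
  simp only [paramPoly_eval] at hP hR
  refine ⟨1 + (1 + P + R) + 5, fun n inp hn => ?_⟩
  obtain ⟨M, s, -, hp, hr, hM⟩ := setup_comp_correct (D := trivialDevice) (inp := inp)
    (l := baseStages K c) (e := params n K c 0 0)
    (by simpa using baseStages_sets hn [] trivial) retrieveStmt (by decide) ()
  -- Variable 0 already lives in cell 0. Variable 1 is moved from cell 16, and the denominator,
  -- which is parameter 5, from cell 82 = 2 + 16 · 5.
  obtain ⟨M', hr2, e0, e1, e2⟩ : ∃ M', Runs trivialDevice inp
      (.seq (.const 17 0) (.seq (.add 1 16 17) (.add 2 82 17))) M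
      (retrieveStmt.eval trivialDevice inp s).x M' (retrieveStmt.eval trivialDevice inp s).x 5 ∧
      M' 0 = M 0 ∧ M' 1 = M 16 ∧ M' 2 = M 82 :=
    ⟨_, (runs_const _ _ _ _).seq ((runs_add _ _ _ _ _).seq (runs_add _ _ _ _ _)), by simp, by simp,
      by simp⟩
  have hr3 := (hr.seq hr2).halt (T' := (1 + (1 + P + R) + 5).eval n) (by simp [hP, hR])
  refine ⟨M', s, ?_, hp 0 (by simp [baseStages]), hp 2 (by simp [baseStages]),
    hp 5 (by simp [baseStages]), hp 6 (by simp [baseStages]), hp 7 (by simp [baseStages]), ?_, ?_, ?_⟩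
  · rw [run_eq_mstep]
    exact congrArg Prod.fst hr3
  · rw [e0]; exact hM.v 0
  · rw [e1]; exact hM.v 1
  · have := hM.p 5
    rw [Stmt.eval_p, hp 5 (by simp [baseStages])] at this
    rw [e2]
    simpa [params] using this

end PauliLearning

/-! ### Statistical accuracy and the choice of constants. -/

namespace PauliLearning
open scoped ENNReal

/-! ### Signs of measurement outcomes -/

section

variable {n : ℕ}

/-- The sign of an element of `ℤ/2`, as a real number. -/
noncomputable def realSign (a : ZMod 2) : ℝ := if a = 0 then 1 else -1

theorem sgn_eq_realSign (a : ZMod 2) : sgn a = (realSign a : ℂ) := by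
  rw [sgn, realSign]; split_ifs <;> simp

theorem abs_realSign (a : ZMod 2) : |realSign a| ≤ 1 := by
  rw [realSign]; split_ifs <;> simp

theorem sum_realSign (m : ℕ) (π : ℕ → ZMod 2) :
    ∑ t ∈ Finset.range m, realSign (π t) =
      2 * ((Finset.range m).filter fun t => π t = 0).card - m := by
  induction m with
  | zero => simp
  | succ m ih =>
    rw [Finset.sum_range_succ, ih, Finset.range_add_one, Finset.filter_insert, realSign]
    split_ifs with h
    · rw [Finset.card_insert_of_notMem (by simp)]
      push_cast
      ring
    · push_cast
      ring

theorem bitF_eq_outcomeF (z : Fin (n + n) → Bool) (i : Fin (n + n)) : bitF (z i) = outcomeF z i := by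
  rw [outcomeF, bitAt, dif_pos i.2]
  cases z i <;> simp [bitF]

/-- The sign of a diagonal operator on two copies. -/
theorem diag_parity (τ : Tableau) (z : Fin (n + n) → Bool) :
    τ.s + ∑ i : Fin (n + n), τ.z i * bitF (z i) =
      zParity n τ (outcomeF z) + ∑ i ∈ Finset.range n, τ.z (n + i) * outcomeF z (n + i) := by
  simp only [bitF_eq_outcomeF]
  rw [Fin.sum_univ_eq_sum_range (fun i => τ.z i * outcomeF z i), Finset.sum_range_add, zParity,
    add_assoc]

theorem circuit_diagonalizes {l : List Op} (hl : ∀ g ∈ l, g.Ok (n + n)) {τ : Tableau}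
    (h : ∀ i < n + n, (conjList l τ).x i = 0) :
    (circuitUnitary (l.flatMap (Op.gates (n + n))) : QMat (n + n)) * τ.op (n + n) *
      star (circuitUnitary (l.flatMap (Op.gates (n + n))) : QMat (n + n)) =
      Matrix.diagonal fun z => (realSign (zParity n (conjList l τ) (outcomeF z) +
        ∑ i ∈ Finset.range n, (conjList l τ).z (n + i) * outcomeF z (n + i)) : ℂ) := by
  rw [circuitUnitary_conj hl, op_eq_diagonal h]
  congr 1
  funext z
  rw [sgn_eq_realSign, diag_parity]

theorem bell_diagonalizes (x z : ℕ → ZMod 2) :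
    (circuitUnitary (bellCircuit n) : QMat (n + n)) * (bellTableau n x z 0).op (n + n) *
      star (circuitUnitary (bellCircuit n) : QMat (n + n)) =
      Matrix.diagonal fun w => (realSign (bellParity n x z (outcomeF w)) : ℂ) := by
  have hx : ∀ i < n + n, (conjList (bellOps n n) (bellTableau n x z 0)).x i = 0 := by
    intro i hi
    rw [conjList_bellOps le_rfl, bellTableau]
    by_cases h : i < n
    · simp [h]
    · simp [h, show i - n < n by omega]
  rw [bellCircuit, circuit_diagonalizes (bellOps_ok le_rfl) hx, conjList_bellOps le_rfl]
  congr 1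
  funext w
  congr 2
  rw [zParity, bellTableau, bellParity, ← Finset.sum_add_distrib, ← Finset.sum_add_distrib]
  refine Finset.sum_congr rfl fun i hi => ?_
  have hi := Finset.mem_range.mp hi
  simp [hi]

theorem Op.act_of_le {g : Op} (hg : g.Ok n) (τ : Tableau) {i : ℕ} (hi : n ≤ i) :
    (g.act τ).x i = τ.x i ∧ (g.act τ).z i = τ.z i := by
  cases g with
  | H j =>
    have : i ≠ j := by simp only [Op.Ok] at hg; omega
    simp [Op.act, this]
  | S j =>
    have : i ≠ j := by simp only [Op.Ok] at hg; omega
    simp [Op.act, this]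
  | C j k =>
    have h1 : i ≠ j := by simp only [Op.Ok] at hg; omega
    have h2 : i ≠ k := by simp only [Op.Ok] at hg; omega
    simp [Op.act, h1, h2]

theorem conjList_of_le {l : List Op} (hl : ∀ g ∈ l, g.Ok n) (τ : Tableau) {i : ℕ} (hi : n ≤ i) :
    (conjList l τ).x i = τ.x i ∧ (conjList l τ).z i = τ.z i := by
  induction l generalizing τ with
  | nil => exact ⟨rfl, rfl⟩
  | cons g l ih =>
    have h1 := ih (fun g' hg' => hl g' (List.mem_cons_of_mem _ hg')) (g.act τ)
    have h2 := Op.act_of_le (hl g List.mem_cons_self) τ hi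
    exact ⟨h1.1.trans h2.1, h1.2.trans h2.2⟩

/-- Circuit and operator are trivial on the second copy, so the sign depends only on the first n
bits of the outcome, which are the ones that are recorded. -/
theorem class_diagonalizes {γ : ℕ → Bool} {q : ℕ} (hq : q < 4 ^ n) (h : DiagBy n γ q) :
    (circuitUnitary (classCircuit n γ) : QMat (n + n)) * (tabOf q).op (n + n) *
      star (circuitUnitary (classCircuit n γ) : QMat (n + n)) =
      Matrix.diagonal fun w => (realSign (zParity n
        (conjList (circOps n γ (2 * n)) (tabOf q)) (outcomeF w)) : ℂ) := by
  have hok := circOps_ok n γ (2 * n)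
  rw [classCircuit, circuit_diagonalizes fun g hg => (hok g hg).mono (by omega)]
  · congr 1
    funext w
    congr 2
    rw [Finset.sum_eq_zero, add_zero]
    intro i _
    rw [(conjList_of_le hok _ (Nat.le_add_right n i)).2]
    simp [tabOf, qz_eq_zero hq (Nat.le_add_right n i)]
  · intro i _
    by_cases hi : i < n
    · exact h i hi
    · rw [(conjList_of_le hok _ (not_lt.mp hi)).1]
      exact qx_eq_zero hq (not_lt.mp hi)

/-! ### Expectation values -/

/-- The expectation value of the Pauli operator with number `q`. -/
noncomputable def expect (ρ : DensityMatrix n) (q : ℕ) : ℝ :=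
  ((ρ.mat * pauliTensor n (qx q) (qz q)).trace).re

theorem trace_eq_expect (ρ : DensityMatrix n) (q : ℕ) :
    (ρ.mat * pauliTensor n (qx q) (qz q)).trace = (expect ρ q : ℂ) := by
  apply Complex.ext
  · simp [expect]
  · simpa using trace_mul_hermitian_im ρ (pauliTensor_star n (qx q) (qz q))

theorem bell_trace (ρ : DensityMatrix n) (q : ℕ) :
    ((ρ.twoCopies.mat * (bellTableau n (qx q) (qz q) 0).op (n + n)).trace).re = expect ρ q ^ 2 := by
  have e : (bellTableau n (qx q) (qz q) 0).op (n + n) = pauliTensor (n + n)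
      (bellTableau n (qx q) (qz q) 0).x (bellTableau n (qx q) (qz q) 0).z := by
    rw [Tableau.op]
    simp [bellTableau, sgn]
  rw [e, twoCopies_trace,
    pauliTensor_congr (m := n) (x' := qx q) (z' := qz q) (fun i hi => by simp [bellTableau, hi])
      fun i hi => by simp [bellTableau, hi],
    pauliTensor_congr (m := n) (x := fun i => (bellTableau n (qx q) (qz q) 0).x (n + i))
      (x' := qx q) (z' := qz q) (fun i hi => by simp [bellTableau])
      fun i hi => by simp [bellTableau], trace_eq_expect]
  norm_cast
  ring

theorem class_trace (ρ : DensityMatrix n) {q : ℕ} (hq : q < 4 ^ n) :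
    ((ρ.twoCopies.mat * (tabOf q).op (n + n)).trace).re = expect ρ q := by
  have e : (tabOf q).op (n + n) = pauliTensor (n + n) (qx q) (qz q) := by
    rw [Tableau.op]
    simp [tabOf, sgn]
  have e1 : (fun i => qx q (n + i)) = fun _ => 0 := funext fun i => qx_eq_zero hq (Nat.le_add_right n i)
  have e2 : (fun i => qz q (n + i)) = fun _ => 0 := funext fun i => qz_eq_zero hq (Nat.le_add_right n i)
  rw [e, twoCopies_trace, e1, e2, pauliTensor_zero, mul_one, ρ.trace_eq_one, mul_one, expect]

/-- Few operators with large expectation values can anticommute. -/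
theorem card_anticommuting_le (ρ : DensityMatrix n) {r : ℕ} (hr : 0 < r) (S : Finset ℕ)
    (hS : ∀ q ∈ S, 1 / (4 * (r : ℝ) ^ 2) ≤ expect ρ q ^ 2)
    (hanti : ∀ q ∈ S, ∀ q' ∈ S, q ≠ q' → sympQ n q q' ≠ 0) : S.card ≤ 4 * r ^ 2 := by
  have h := sum_sq_le_one ρ S (fun q => pauliTensor n (qx q) (qz q)) (fun q _ => pauliTensor_star _ _ _)
    (fun q _ => pauliTensor_mul_self _ _ _) fun q hq q' hq' hne => by
      have h1 : symp n (qx q) (qz q) (qx q') (qz q') ≠ 0 := hanti q hq q' hq' hne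
      rw [pauliTensor_comm, sgn, if_neg h1, neg_one_smul]
  have h2 := (Finset.card_nsmul_le_sum S _ _ hS).trans h
  have hr' : (0 : ℝ) < 4 * (r : ℝ) ^ 2 := by positivity
  rw [nsmul_eq_mul, mul_one_div, div_le_one hr'] at h2
  exact_mod_cast h2

/-! ### Block sums -/

section

variable (ρ : DensityMatrix n) (p : Prog LearnerInstr) (T : ℕ) {m N b : ℕ}
  {ω : ℕ → Fin (n + n) → Bool}

/-- Block `b` consists of the measurements `b * m, …, b * m + m - 1`. If they share a circuit that
diagonalizes `A`, each deviation is a sign minus the mean, and the signs sum to 2 · count - m. -/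
theorem sum_blockDeviation (hm : 0 < m) (hN : (b + 1) * m ≤ N) {circ : List (Gate (n + n))}
    (hcirc : ∀ t < m, tapeCircuit p T ω (b * m + t) = circ) {A : QMat (n + n)}
    {π : (Fin (n + n) → Bool) → ZMod 2}
    (hA : (circuitUnitary circ : QMat (n + n)) * A * star (circuitUnitary circ : QMat (n + n)) =
      Matrix.diagonal fun z => (realSign (π z) : ℂ)) :
    ∑ k ∈ Finset.range N, blockDeviation ρ p T m A b ω k =
      2 * ((Finset.range m).filter fun t => π (ω (b * m + t)) = 0).card - m -
        m * ((ρ.twoCopies.mat * A).trace).re := by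
  have e : (Finset.range N).filter (fun k => k / m = b) =
      (Finset.range m).image fun t => b * m + t := by
    ext k
    simp only [Finset.mem_filter, Finset.mem_range, Finset.mem_image, Nat.div_eq_iff hm]
    rw [Nat.succ_mul] at hN
    constructor
    · rintro ⟨h1, h2, h3⟩
      exact ⟨k - b * m, by omega, by omega⟩
    · rintro ⟨t, ht, rfl⟩
      omega
  simp only [blockDeviation]
  rw [← Finset.sum_filter, e, Finset.sum_image fun a _ b _ h => Nat.add_left_cancel h,
    ← sum_realSign m fun t => π (ω (b * m + t))]
  have : ∀ t ∈ Finset.range m, deviation ρ.twoCopies (tapeCircuit p T ω (b * m + t)) A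
      (ω (b * m + t)) = realSign (π (ω (b * m + t))) - ((ρ.twoCopies.mat * A).trace).re := by
    intro t ht
    rw [hcirc t (Finset.mem_range.mp ht)]
    exact deviation_eq _ _ (fun z => abs_realSign _) hA _
  rw [Finset.sum_congr rfl this, Finset.sum_sub_distrib]
  simp

end

/-- The observables that are tested in the different blocks of measurements. -/
noncomputable def testOp (n b q : ℕ) : QMat (n + n) :=
  if b = 0 then (bellTableau n (qx q) (qz q) 0).op (n + n) else (tabOf q).op (n + n)

/-- All the measured mean values are accurate. -/
def GoodTape (ρ : DensityMatrix n) (p : Prog LearnerInstr) (T m L : ℕ) (η : ℝ)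
    (ω : ℕ → Fin (n + n) → Bool) : Prop :=
  ∀ b ≤ L, ∀ q < 4 ^ n,
    |∑ k ∈ Finset.range (m * (L + 1)), blockDeviation ρ p T m (testOp n b q) b ω k| ≤ m * η

theorem log_getD_bell {m L k : ℕ} {x : QState n} {γ : ℕ → ℕ → Bool} {bits : List Bool}
    (h : Advance ⟨[], fun _ => false, 0, [], []⟩ x (List.replicate m (bellCircuit n) ++
      (List.range L).flatMap fun j => List.replicate m (classCircuit n (γ j))) bits) (hk : k < m) :
    x.log.getD k [] = bellCircuit n := by
  rw [h.log, List.nil_append, List.getD_append _ _ _ _ (by simpa using hk)]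
  simp [hk]

theorem log_getD_class {m L j t : ℕ} {x : QState n} {γ : ℕ → ℕ → Bool} {bits : List Bool}
    (h : Advance ⟨[], fun _ => false, 0, [], []⟩ x (List.replicate m (bellCircuit n) ++
      (List.range L).flatMap fun j => List.replicate m (classCircuit n (γ j))) bits) (hj : j < L)
    (ht : t < m) : x.log.getD ((j + 1) * m + t) [] = classCircuit n (γ j) := by
  have hlt : m ≤ (j + 1) * m + t := by nlinarith
  have e : (j + 1) * m + t - m = j * m + t := by rw [Nat.succ_mul]; omega
  rw [h.log, List.nil_append, List.getD_append_right _ _ _ _ (by simpa using hlt),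
    List.length_replicate, e,
    getD_flatMap_range [] (fun j => List.replicate m (classCircuit n (γ j)))
      (fun _ _ => List.length_replicate) hj ht]
  simp [ht]

section

variable {ρ : DensityMatrix n} {p : Prog LearnerInstr} {T m L : ℕ} {η : ℝ}
  {ω : ℕ → Fin (n + n) → Bool} {M : ℕ → ℕ} {x : QState n} {γ : ℕ → ℕ → Bool} {bits : List Bool}

theorem GoodTape.bell (hω : GoodTape ρ p T m L η ω) (hm : 0 < m)
    (hrun : tapeRun p [n] ω T = (⟨[], M⟩, x))
    (h : Advance ⟨[], fun _ => false, 0, [], []⟩ x (List.replicate m (bellCircuit n) ++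
      (List.range L).flatMap fun j => List.replicate m (classCircuit n (γ j))) bits)
    {q : ℕ} (hq : q < 4 ^ n) :
    |2 * (((Finset.range m).filter fun t =>
        bellParity n (qx q) (qz q) (outcomeF (ω t)) = 0).card : ℝ) - m - m * expect ρ q ^ 2| ≤
      m * η := by
  have := hω 0 (Nat.zero_le _) q hq
  rw [testOp, if_pos rfl, sum_blockDeviation ρ p T hm (by nlinarith)
    (fun t ht => ?_) (bell_diagonalizes (qx q) (qz q)), bell_trace] at this
  · simpa using this
  · rw [tapeCircuit, hrun, zero_mul, zero_add]
    exact log_getD_bell h ht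

/-- Class `j` is block `j + 1`, as block 0 holds the Bell measurements. The operator need not belong
to the family of the class; it suffices that the circuit diagonalizes it. -/
theorem GoodTape.class (hω : GoodTape ρ p T m L η ω) (hm : 0 < m)
    (hrun : tapeRun p [n] ω T = (⟨[], M⟩, x))
    (h : Advance ⟨[], fun _ => false, 0, [], []⟩ x (List.replicate m (bellCircuit n) ++
      (List.range L).flatMap fun j => List.replicate m (classCircuit n (γ j))) bits)
    {q j : ℕ} (hq : q < 4 ^ n) (hj : j < L) (hd : DiagBy n (γ j) q) :
    |2 * (((Finset.range m).filter fun t => zParity n (conjList (circOps n (γ j) (2 * n)) (tabOf q))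
        (outcomeF (ω (m + j * m + t))) = 0).card : ℝ) - m - m * expect ρ q| ≤ m * η := by
  have := hω (j + 1) hj q hq
  rw [testOp, if_neg (Nat.succ_ne_zero j), sum_blockDeviation ρ p T hm (by nlinarith)
    (fun t ht => ?_) (class_diagonalizes hq hd), class_trace ρ hq] at this
  · simpa only [Nat.succ_mul, Nat.succ_eq_add_one, add_comm m] using this
  · rw [tapeCircuit, hrun]
    exact log_getD_class h hj ht

end

/-! ### Accuracy -/

/-- Padding by 𝟙 matches the vanishing higher digits of `q`, so the two tableaux agree as functions
on ℕ. -/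
theorem exists_index_pauli (P : Fin n → Pauli) : ∃ (q : ℕ) (P' : ℕ → Pauli), q < 4 ^ n ∧
    (∀ i (hi : i < n), P' i = P ⟨i, hi⟩) ∧
    tabOf q = ⟨fun i => (P' i).bx, fun i => (P' i).bz, 0⟩ ∧
    pauliOp P = pauliTensor n (qx q) (qz q) := by
  set P' : ℕ → Pauli := fun i => if h : i < n then P ⟨i, h⟩ else .I with hP'
  obtain ⟨q, hq, h⟩ := exists_index n (fun i => (P' i).bx) fun i => (P' i).bz
  have hP : ∀ i (hi : i < n), P' i = P ⟨i, hi⟩ := fun i hi => by simp [hP', hi]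
  refine ⟨q, P', hq, hP, ?_, ?_⟩
  · rw [tabOf, Tableau.mk.injEq]
    refine ⟨funext fun i => ?_, funext fun i => ?_, rfl⟩
    · by_cases hi : i < n
      · exact (h i hi).1
      · rw [qx_eq_zero hq (not_lt.mp hi)]
        simp [hP', hi, Pauli.bx]
    · by_cases hi : i < n
      · exact (h i hi).2
      · rw [qz_eq_zero hq (not_lt.mp hi)]
        simp [hP', hi, Pauli.bz]
  · rw [pauliOp, pauliTensor]
    congr 1
    funext i
    rw [pauliMat, (h i i.2).1, (h i i.2).2, Pauli.ofBits_bits, hP i i.2]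

/-- The output of the retrieval program in terms of the data of the learning program. -/
theorem retrieve_output (K c : ℕ) : ∃ B : Polynomial ℕ, ∀ (n : ℕ) (P : Fin n → Pauli) (D : List Bool),
    ((retrieveProg K c).run (retrievalInput P D) (B.eval n)).Halted ∧
    ∀ (γ : ℕ → ℕ → Bool) (ω : ℕ → ℕ → Fin (n + n) → Bool),
      D = (List.range ((2 * n + 1) ^ K)).flatMap (fun j => classBits (c * n) (γ j) (ω j)) →
      ∃ q < 4 ^ n, pauliOp P = pauliTensor n (qx q) (qz q) ∧
        ∃ M, (retrieveProg K c).run (retrievalInput P D) (B.eval n) = ⟨[], M⟩ ∧ M 2 = c * n ∧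
        (((∀ j < (2 * n + 1) ^ K, ¬ DiagBy n (γ j) q) ∧ M 0 = 0 ∧ M 1 = 0) ∨
          ∃ j < (2 * n + 1) ^ K, DiagBy n (γ j) q ∧ M 0 = 2 * ((Finset.range (c * n)).filter fun t =>
            zParity n (conjList (circOps n (γ j) (2 * n)) (tabOf q)) (outcomeF (ω j t)) = 0).card ∧
            M 1 = c * n) := by
  obtain ⟨B, hB⟩ := retrieveProg_spec K c
  refine ⟨B, fun n P D => ?_⟩
  obtain ⟨M, s, hrun, p0, p2, p5, p6, p7, m0, m1, m2⟩ := hB n (retrievalInput P D) rfl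
  refine ⟨by rw [hrun]; rfl, fun γ ω hD => ?_⟩
  obtain ⟨q, P', hq, hP', htab, hop⟩ := exists_index_pauli P
  refine ⟨q, hq, hop, M, hrun, m2, ?_⟩
  have hget : ∀ j < (2 * n + 1) ^ K, ∀ k < 4 * n ^ 2 + c * n * n,
      (retrievalInput P D).getD (2 + n + j * (4 * n ^ 2 + c * n * n) + k) 0 =
        ((classBits (c * n) (γ j) (ω j)).getD k false).toNat := by
    intro j hj k hk
    rw [add_assoc, retrievalInput_getD_bit, hD,
      getD_flatMap_range false _ (fun j _ => classBits_length (c * n) (γ j) (ω j)) hj hk]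
  have := retrieveStmt_spec (D := trivialDevice) (inp := retrievalInput P D) (s := s)
    (n := n) (m := c * n) (L := (2 * n + 1) ^ K) (P := P') (γ := γ)
    (β := fun j t => outcomeF (ω j t))
    (τ := fun j => conjList (circOps n (γ j) (2 * n)) (tabOf q)) p0 p2 p5 p6 p7
    (fun i hi => by rw [retrievalInput_getD_code P D hi, hP' i hi])
    (fun j hj k hk => by rw [hget j hj k (by omega), classBits_getD_circuit _ _ hk])
    (fun j hj t ht i hi => by
      have hlt : t * n + i < c * n * n := by
        have : (t + 1) * n ≤ c * n * n := Nat.mul_le_mul_right _ ht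
        rw [Nat.succ_mul] at this
        omega
      rw [add_assoc _ (4 * n ^ 2), add_assoc _ (4 * n ^ 2 + t * n), hget j hj _ (by omega), classBits_getD_outcome _ _ ht hi,
        ← bitAt_eq_val]
      rw [bitAt_eq_val]
      have := (outcomeF (ω j t) i).val_lt
      interval_cases (outcomeF (ω j t) i).val <;> rfl)
    (fun j => by rw [htab])
  rw [← m0, ← m1] at this
  exact this

theorem abs_div_sub_le {m v w η : ℝ} (hm : 0 < m) (h : |v - m - m * w| ≤ m * η) :
    |(v - m) / m - w| ≤ η := by
  have : (v - m) / m - w = (v - m - m * w) / m := by field_simp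
  rw [this, abs_div, abs_of_pos hm, div_le_iff₀ hm, mul_comm η]
  exact h

/-- On a good tape all the retrieved values are accurate. -/
theorem approximates_of_good {ρ : DensityMatrix n} {p : Prog LearnerInstr} {T r d K m H : ℕ} {ε : ℝ}
    {ω : ℕ → Fin (n + n) → Bool} {M : ℕ → ℕ} {x : QState n} {γ : ℕ → ℕ → Bool} {bits : List Bool}
    (hr : 0 < r) (hrε : 1 / (r : ℝ) ≤ ε) (hd : 0 < d) (hK : K = 4 * r ^ 2) (hm : m = 4 * r ^ 2 * d)
    (hH : H = (2 * r ^ 2 + 1) * d)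
    (hω : GoodTape ρ p T m ((2 * n + 1) ^ K) (1 / (4 * (r : ℝ) ^ 2)) ω)
    (hrun : tapeRun p [n] ω T = (⟨[], M⟩, x))
    (h : Advance ⟨[], fun _ => false, 0, [], []⟩ x (List.replicate m (bellCircuit n) ++
      (List.range ((2 * n + 1) ^ K)).flatMap fun j => List.replicate m (classCircuit n (γ j))) bits)
    (hserve : ∀ j < (2 * n + 1) ^ K, ServesClass n K (passes n m H ω) j (γ j))
    {q v₀ v₁ : ℕ} (hq : q < 4 ^ n)
    (hv : ((∀ j < (2 * n + 1) ^ K, ¬ DiagBy n (γ j) q) ∧ v₀ = 0 ∧ v₁ = 0) ∨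
      ∃ j < (2 * n + 1) ^ K, DiagBy n (γ j) q ∧ v₀ = 2 * ((Finset.range m).filter fun t =>
        zParity n (conjList (circOps n (γ j) (2 * n)) (tabOf q))
          (outcomeF (ω (m + j * m + t))) = 0).card ∧ v₁ = m) :
    |((v₀ : ℝ) - v₁) / m - expect ρ q| ≤ ε := by
  have hrR : (1 : ℝ) ≤ r := by exact_mod_cast hr
  have hdR : (0 : ℝ) < d := by exact_mod_cast hd
  have hm0 : 0 < m := by rw [hm]; positivity
  have hmR : (0 : ℝ) < m := by exact_mod_cast hm0
  have hmη : (m : ℝ) * (1 / (4 * (r : ℝ) ^ 2)) = d := by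
    rw [hm]; push_cast; field_simp
  have hηε : 1 / (4 * (r : ℝ) ^ 2) ≤ ε := by
    refine le_trans ?_ hrε
    exact one_div_le_one_div_of_le (by linarith) (by nlinarith)
  rcases hv with ⟨hnd, rfl, rfl⟩ | ⟨j, hj, hdj, rfl, rfl⟩
  -- No class diagonalizes the operator and the answer is 0. If this were off by more than ε, the
  -- operator would pass the threshold and lie in a commuting family that some class diagonalizes.
  · by_contra hlt
    have hbig : 1 / (r : ℝ) < |expect ρ q| := by
      refine hrε.trans_lt ?_
      simpa using hlt
    -- The constants give 2H - m = 2d and mη = d. So passing implies m · expect² ≥ 2d - d = d, that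
    -- is, expect² ≥ 1/(4r²) = 1/K.
    have hpass : ∀ q < 4 ^ n, passes n m H ω q = true → 1 / (4 * (r : ℝ) ^ 2) ≤ expect ρ q ^ 2 := by
      intro q hq hp
      have hb := (abs_le.mp (hω.bell hm0 hrun h hq)).2
      have hc : (H : ℝ) ≤ (((Finset.range m).filter fun t =>
          bellParity n (qx q) (qz q) (outcomeF (ω t)) = 0).card : ℝ) := by
        exact_mod_cast of_decide_eq_true hp
      rw [hmη] at hb
      have hHm : 2 * (H : ℝ) - m = 2 * d := by rw [hH, hm]; push_cast; ring
      refine le_of_mul_le_mul_left ?_ hmR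
      rw [hmη]
      linarith
    -- Here m · expect² ≥ m/r² = 4d, so 2 · count - m ≥ 3d, which exceeds the threshold 2d.
    have hq0 : passes n m H ω q = true := by
      have hb := (abs_le.mp (hω.bell hm0 hrun h hq)).1
      rw [hmη] at hb
      have hsq : 1 / (r : ℝ) ^ 2 ≤ expect ρ q ^ 2 := by
        rw [← sq_abs (expect ρ q), ← one_div_pow]
        exact pow_le_pow_left₀ (by positivity) hbig.le 2
      have h4 : (m : ℝ) * (1 / (r : ℝ) ^ 2) = 4 * d := by rw [hm]; push_cast; field_simp
      have h5 := mul_le_mul_of_nonneg_left hsq hmR.le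
      have hHm : 2 * (H : ℝ) - m = 2 * d := by rw [hH, hm]; push_cast; ring
      refine decide_eq_true ?_
      have : (H : ℝ) ≤ (((Finset.range m).filter fun t =>
          bellParity n (qx q) (qz q) (outcomeF (ω t)) = 0).card : ℝ) := by linarith
      exact_mod_cast this
    obtain ⟨I, hI, hI', hmarks⟩ := exists_marks (n := n) (T := passes n m H ω) (q₀ := q) (K := K)
      (fun S hS hanti => by
        rw [hK]
        exact card_anticommuting_le ρ hr S (fun q hq => hpass q (hS q hq).1 (hS q hq).2) hanti) hq0
    obtain ⟨j, hj, hjm⟩ := exists_marksOf I hI hI'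
    obtain ⟨marks, hm1, hm2⟩ := hserve j hj
    obtain ⟨h1, h2⟩ := hmarks marks fun s hs => by rw [hm1 s hs, hjm s hs]
    exact hnd j hj (hm2 h2 q hq h1)
  · refine le_trans (abs_div_sub_le hmR ?_) hηε
    have := hω.class hm0 hrun h hq hj hdj
    push_cast
    exact this

/-- The failure probability. -/
theorem failure_le {n r K m : ℕ} (hn : 0 < n) (hr : 0 < r)
    (hm : m = 4 * r ^ 2 * (64 * r ^ 2 * (2 * K + 12) * n)) :
    2 * (((2 * n + 1) ^ K + 1) * 4 ^ n : ℝ) *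
      Real.exp (-(m * (1 / (4 * (r : ℝ) ^ 2)) ^ 2 / 16)) ≤ 1 / 100 := by
  have hrR : (0 : ℝ) < r := by exact_mod_cast hr
  have hnR : (1 : ℝ) ≤ n := by exact_mod_cast hn
  -- In this exponent 2Kn pays for the classes, 2n for the 4^n operators, and 10n leaves a factor of
  -- at most 1/1024 for the constants.
  have e : (m : ℝ) * (1 / (4 * (r : ℝ) ^ 2)) ^ 2 / 16 = (2 * K + 12) * n := by
    rw [hm]; push_cast; field_simp; ring
  have h2 : (2 : ℝ) ≤ Real.exp 1 := by have := Real.add_one_le_exp (1 : ℝ); linarith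
  have h4 : (4 : ℝ) ^ n ≤ Real.exp (2 * n) := by
    rw [mul_comm, Real.exp_nat_mul, show (2 : ℝ) = 1 + 1 by norm_num, Real.exp_add]
    exact pow_le_pow_left₀ (by norm_num) (by nlinarith) n
  have h5 : ((2 * n + 1 : ℝ)) ^ K ≤ Real.exp (2 * K * n) := by
    rw [show (2 * K * n : ℝ) = K * (2 * n) by ring, Real.exp_nat_mul]
    exact pow_le_pow_left₀ (by positivity) (Real.add_one_le_exp _) K
  have h6 : (1 : ℝ) ≤ Real.exp (2 * K * n) := Real.one_le_exp (by positivity)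
  have h7 : (1024 : ℝ) ≤ Real.exp (10 * n) := by
    calc (1024 : ℝ) = 2 ^ 10 := by norm_num
      _ ≤ Real.exp 1 ^ 10 := pow_le_pow_left₀ (by norm_num) h2 10
      _ = Real.exp 10 := by rw [← Real.exp_nat_mul]; norm_num
      _ ≤ _ := Real.exp_le_exp.mpr (by linarith)
  rw [e, Real.exp_neg, show ((2 * K + 12) * n : ℝ) = 2 * K * n + (2 * n + 10 * n) by ring,
    Real.exp_add, Real.exp_add, ← div_eq_mul_inv, div_le_iff₀ (by positivity)]
  set a := Real.exp (2 * K * n)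
  set b := Real.exp (2 * n)
  set c := Real.exp (10 * n)
  have ha : ((2 * n + 1 : ℝ)) ^ K + 1 ≤ 2 * a := by linarith
  have hb : 0 ≤ b := (Real.exp_pos _).le
  calc 2 * (((2 * n + 1 : ℝ) ^ K + 1) * 4 ^ n) ≤ 2 * (2 * a * b) :=
        mul_le_mul_of_nonneg_left (mul_le_mul ha h4 (by positivity) (by linarith)) (by norm_num)
    _ ≤ 1 / 100 * (a * (b * 1024)) := by nlinarith [mul_nonneg (le_trans zero_le_one h6) hb]
    _ ≤ _ := by gcongr

end

end PauliLearning

/-! ### Assembly of the main theorem. -/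

open PauliLearning
open scoped ENNReal
theorem corollary9 (ε : ℝ) (hε0 : 0 < ε) (hε1 : ε < 1) :
    ∃ (learner : Prog LearnerInstr) (retriever : Prog Empty) (C : ℕ)
      (copyBound bitBound timeBound : Polynomial ℕ),
      ∀ n : ℕ, 0 < n → ∀ ρ : DensityMatrix n,
        -- in every run: running time, number of copies, size of the description, retrieval time
        (∀ c ∈ (learner.learn ρ (2 ^ (C * n))).support,
          c.Halted ∧
          c.copies ≤ copyBound.eval n ∧
          c.out.length ≤ bitBound.eval n ∧
          ∀ P : Fin n → Pauli,
            (retriever.run (retrievalInput P c.out) (timeBound.eval n)).Halted) ∧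
        -- with high probability: all the retrieved values are accurate
        (99 / 100 : ℝ≥0∞) ≤ (learner.learn ρ (2 ^ (C * n))).toOuterMeasure
          {c | ∀ P : Fin n → Pauli,
            (retriever.run (retrievalInput P c.out) (timeBound.eval n)).Approximates ε
              (ρ.mat * pauliOp P).trace} := by
  obtain ⟨r', hr'⟩ := exists_nat_one_div_lt hε0
  set r := r' + 1 with hr_def
  have hr : 0 < r := Nat.succ_pos r'
  have hrε : 1 / (r : ℝ) ≤ ε := by rw [hr_def]; push_cast; exact hr'.le
  set K := 4 * r ^ 2 with hK
  -- With m = 4r²dn and η = 1/(4r²), this makes mη²/16 equal to (2K + 12)n, as `failure_le`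
  -- requires.
  set d := 64 * r ^ 2 * (2 * K + 12) with hd
  have hd0 : 0 < d := by positivity
  set c := 4 * r ^ 2 * d with hc
  -- As 2c' - c = 2d, the cut for the estimated squares is at 2η. With accuracy η, squares below η
  -- are rejected and those from 4η = 1/r² on are accepted.
  set c' := (2 * r ^ 2 + 1) * d with hc'
  obtain ⟨C, hC⟩ := learnProg_spec K c c'
  obtain ⟨B, hB⟩ := retrieve_output K c
  refine ⟨learnProg K c c', retrieveProg K c, C,
    2 * ((c : Polynomial ℕ) * .X + (2 * .X + 1) ^ K * ((c : Polynomial ℕ) * .X)),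
    (2 * .X + 1) ^ K * (4 * .X ^ 2 + (c : Polynomial ℕ) * .X * .X), B, fun n hn ρ => ⟨?_, ?_⟩⟩
  · intro cf hcf
    obtain ⟨ω, rfl⟩ := exists_tape _ _ hcf
    obtain ⟨M, x, γ, hrun, -, hA⟩ := hC n hn ω
    rw [hrun]
    refine ⟨rfl, ?_, ?_, fun P => (hB n P _).1⟩
    · simp [toLConfig, hA.copies]
    · simp [toLConfig, hA.out, classBits_length]
  · set m := c * n with hm
    set L := (2 * n + 1) ^ K with hL
    have hm0 : 0 < m := by positivity
    set η : ℝ := 1 / (4 * (r : ℝ) ^ 2) with hη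
    have hrR : (1 : ℝ) ≤ r := by exact_mod_cast hr
    have hη0 : 0 < η := by positivity
    have hη1 : η ≤ 1 := by
      rw [hη, div_le_one (by positivity)]
      nlinarith
    set S : Set (LConfig n) := {c₁ | ∀ P : Fin n → Pauli,
      ((retrieveProg K c).run (retrievalInput P c₁.out) (B.eval n)).Approximates ε
        (ρ.mat * pauliOp P).trace} with hS
    -- The union bound covers all blocks and all operators, so it does not depend on which circuits
    -- the learner ends up choosing.
    have hbad := learn_bad_le ρ (learnProg K c c') (2 ^ (C * n)) m
      (ι := Fin (L + 1) × Fin (4 ^ n)) (fun j => testOp n j.1 j.2) (fun j => j.1) (η := η)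
      (N := m * (L + 1)) hη0 hη1 hm0 (fun ω => by
        obtain ⟨M, x, γ, hrun, -, hA⟩ := hC n hn ω
        rw [hrun]
        simp [hA.log]
        ring) S (fun ω hω => ?_)
    · have hle : (learnProg K c c').learn ρ (2 ^ (C * n)) |>.toOuterMeasure Sᶜ |> (· ≤ 1 / 100) := by
        refine hbad.trans ?_
        have hf := failure_le (n := n) (r := r) (K := K) (m := m) hn hr (by rw [hm, hc, hd]; ring)
        rw [show (1 / 100 : ℝ≥0∞) = ENNReal.ofReal (1 / 100) by
          rw [ENNReal.ofReal_div_of_pos (by norm_num)]; simp]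
        refine ENNReal.ofReal_le_ofReal ?_
        rw [← hη] at hf
        simpa [hL] using hf
      have := toOuterMeasure_compl_ge _ S hle
      refine le_trans (le_of_eq ?_) this
      refine ENNReal.eq_sub_of_add_eq (by simp) ?_
      rw [← ENNReal.add_div, show (99 + 1 : ℝ≥0∞) = 100 by norm_num]
      exact ENNReal.div_self (by norm_num) (by norm_num)
    · have hgood : GoodTape ρ (learnProg K c c') (2 ^ (C * n)) m L η ω := fun b hb q hq =>
        hω (⟨b, by omega⟩, ⟨q, hq⟩)
      obtain ⟨M, x, γ, hrun, hserve, hA⟩ := hC n hn ω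
      rw [hrun]
      intro P
      obtain ⟨q, hq, hop, M', hrun', hM2, hv⟩ := (hB n P x.out).2 γ (fun j t => ω (m + j * m + t))
        (by rw [hA.out, List.nil_append])
      have key := approximates_of_good (ε := ε) hr hrε (d := d * n) (by positivity) hK
        (by rw [hm, hc]; ring) (H := c' * n) (by rw [hc']; ring) hgood hrun hA hserve hq hv
      show Config.Approximates ((retrieveProg K c).run (retrievalInput P x.out) (B.eval n)) _ _
      rw [hrun', Config.Approximates, hop, trace_eq_expect]
      simp only [hM2]
      refine ⟨hm0.ne', ?_⟩
      have e : ((M' 0 : ℂ) - (M' 1 : ℂ)) / ((c * n : ℕ) : ℂ) - (expect ρ q : ℂ) =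
          ((((M' 0 : ℝ) - M' 1) / (m : ℝ) - expect ρ q : ℝ) : ℂ) := by
        push_cast [hm]
        ring
      rw [e, Complex.norm_real]
      exact key
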